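/- Fix $d\ge 0$. Let $ID_{\log}$ be the set of infinitely divisible probability measures $\nu$ on $\mathbb{R}^d$ with $\int \log(1+\|x\|)\,\nu(dx)<\infty$. For $\nu\in ID_{\log}$ let $Y_\nu=(Y_\nu(t))_{t\ge 0}$ denote a Lévy process (stationary independent increments, $Y_\nu(0)=0$, càdlàg paths) such that $Y_\nu(1)$ has law $\nu$. For a continuous strictly increasing $r:[0,\infty)\to[0,\infty)$ put $$\int_0^b e^{-s}\,dY_\nu(r(s)) := e^{-b}Y_\nu(r(b))-Y_\nu(r(0))+\int_0^b Y_\nu(r(s))\,e^{-s}\,ds ,$$ and let $\int_0^\infty e^{-s}\,dY_\nu(r(s))$ be the limit in probability of these integrals as $b\to\infty$. Let $\mathcal{L}(X)$ denote the law of $X$, let $\mathcal{I}(\nu):=\mathcal{L}\left(\int_0^\infty e^{-s}\,dY_\nu(s)\right)$ for $\nu\in ID_{\log}$, let $L:=\mathcal{I}(ID_{\log})$ be the class of selfdecomposable distributions, and let $$L^f:=\{\mathcal{I}(\nu):\ \nu\in ID_{\log},\ \mathcal{I}(\nu)*\nu\in L\}$$ be the class of selfdecomposable distributions with the factorization property.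 Then for every $\nu\in ID_{\log}$ the integral $\int_0^\infty e^{-s}\,dY_\nu(s+e^{-s}-1)$ exists and its law depends only on $\nu$, and $$L^f=\left\{\mathcal{L}\left(\int_0^\infty e^{-s}\,dY_\nu(s+e^{-s}-1)\right):\ \nu\in ID_{\log}\right\}.$$ -/

import Mathlib

open MeasureTheory ProbabilityTheory Filter Topology
open scoped NNReal

noncomputable section

/-- The `n`-fold convolution power of a measure; the `0`-th power is the Dirac mass at `0`. -/
def convPow {E : Type*} [AddMonoid E] [MeasurableSpace E] (ρ : Measure E) (n : ℕ) : Measure E :=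
  (fun m : Measure E => Measure.conv m ρ)^[n] (Measure.dirac 0)

/-- Infinitely divisible probability measures. -/
def IsInfinitelyDivisible {E : Type*} [AddMonoid E] [MeasurableSpace E] (ν : Measure E) : Prop :=
  IsProbabilityMeasure ν ∧
    ∀ n : ℕ, 1 ≤ n → ∃ ρ : Measure E, IsProbabilityMeasure ρ ∧ convPow ρ n = ν

/-- The class `ID_log`: infinitely divisible probability measures that integrate
`log (1 + ‖x‖)`. -/
def IDlog (E : Type*) [NormedAddCommGroup E] [MeasurableSpace E] : Set (Measure E) :=
  {ν | IsInfinitelyDivisible ν ∧ Integrable (fun x : E => Real.log (1 + ‖x‖)) ν}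

/-- Lévy processes: stationary independent increments, start at zero, càdlàg paths. -/
structure IsLevyProcess {E : Type*} [NormedAddCommGroup E] [MeasurableSpace E]
    {Ω : Type*} [MeasurableSpace Ω] (P : Measure Ω) (Y : ℝ≥0 → Ω → E) : Prop where
  measurable : ∀ t, Measurable (Y t)
  start_zero : ∀ ω, Y 0 ω = 0
  indep_increments : HasIndepIncrements Y P
  stationary_increments : ∀ s t : ℝ≥0, P.map (fun ω => Y (s + t) ω - Y s ω) = P.map (Y t)
  right_continuous : ∀ ω t, ContinuousWithinAt (fun u => Y u ω) (Set.Ici t) t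
  left_limits : ∀ ω t, ∃ l, Tendsto (fun u => Y u ω) (𝓝[<] t) (𝓝 l)

/-- `Y` is a Lévy process on the probability space `(Ω, P)` with `Y 1` distributed as `ν`. -/
def IsLevyProcessOf {E : Type*} [NormedAddCommGroup E] [MeasurableSpace E]
    {Ω : Type*} [MeasurableSpace Ω] (ν : Measure E) (P : Measure Ω) (Y : ℝ≥0 → Ω → E) : Prop :=
  IsProbabilityMeasure P ∧ IsLevyProcess P Y ∧ P.map (Y 1) = ν

/-- The random integral `∫_(0,b] f(s) dY(r(s))` of a continuously differentiable function `f`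
along the càdlàg path `s ↦ Y (r s) ω`, where the clock `r` is continuous, strictly increasing
and nonnegative on `[0, ∞)`. It is defined pathwise through integration by parts,
`f(b) Y(r(b)) - f(0) Y(r(0)) - ∫_(0,b] Y(r(s)-) df(s)`. As `df(s) = f'(s) ds`, the left limits
`Y(r(s)-)` may be replaced by the values `Y(r(s))`, from which they differ for at most countably
many `s`. -/
def randomIntegral {E : Type*} [NormedAddCommGroup E] [NormedSpace ℝ E] {Ω : Type*}
    (f r : ℝ → ℝ) (Y : ℝ≥0 → Ω → E) (b : ℝ) (ω : Ω) : E :=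
  f b • Y (r b).toNNReal ω - f 0 • Y (r 0).toNNReal ω
    - ∫ s in (0 : ℝ)..b, deriv f s • Y (r s).toNNReal ω

/-- `X` is the improper random integral `∫_0^∞ f(s) dY(r(s))`: the limit in probability of
`∫_(0,b] f(s) dY(r(s))` as `b → ∞`. -/
def IsImproperRandomIntegral {E : Type*} [NormedAddCommGroup E] [NormedSpace ℝ E]
    [MeasurableSpace E] {Ω : Type*} [MeasurableSpace Ω] (P : Measure Ω)
    (f r : ℝ → ℝ) (Y : ℝ≥0 → Ω → E) (X : Ω → E) : Prop :=
  Measurable X ∧ TendstoInMeasure P (randomIntegral f r Y) atTop X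

/-- `μ` is the law of `∫_0^∞ f(s) dY_ν(r(s))`, where `Y_ν` is a Lévy process with `Y_ν(1)`
distributed as `ν`: such processes exist, and for each of them the integral exists and has
law `μ`. -/
def IsRandomIntegralLaw {E : Type*} [NormedAddCommGroup E] [NormedSpace ℝ E]
    [MeasurableSpace E] (f r : ℝ → ℝ) (ν μ : Measure E) : Prop :=
  (∃ (Ω : Type) (_ : MeasurableSpace Ω) (P : Measure Ω) (Y : ℝ≥0 → Ω → E),
    IsLevyProcessOf ν P Y) ∧
  ∀ (Ω : Type) (_ : MeasurableSpace Ω) (P : Measure Ω) (Y : ℝ≥0 → Ω → E),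
    IsLevyProcessOf ν P Y →
      ∃ X : Ω → E, IsImproperRandomIntegral P f r Y X ∧ P.map X = μ

/-- `IsSelfdecomposableMap ν μ` says that `μ = I(ν)`, the law of `∫_0^∞ e^{-s} dY_ν(s)`. -/
def IsSelfdecomposableMap {E : Type*} [NormedAddCommGroup E] [NormedSpace ℝ E]
    [MeasurableSpace E] (ν μ : Measure E) : Prop :=
  IsRandomIntegralLaw (fun s => Real.exp (-s)) (fun s => s) ν μ

/-- The class `L = I(ID_log)` of selfdecomposable distributions. -/
def classL (E : Type*) [NormedAddCommGroup E] [NormedSpace ℝ E] [MeasurableSpace E] :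
    Set (Measure E) :=
  {μ | ∃ ν ∈ IDlog E, IsSelfdecomposableMap ν μ}

/-- The class `L^f` of the selfdecomposable distributions `I(ν)`, `ν ∈ ID_log`, with the
factorization property `I(ν) ∗ ν ∈ L`. -/
def classLf (E : Type*) [NormedAddCommGroup E] [NormedSpace ℝ E] [MeasurableSpace E] :
    Set (Measure E) :=
  {μ | ∃ ν ∈ IDlog E, IsSelfdecomposableMap ν μ ∧ Measure.conv μ ν ∈ classL E}

end

/-! Passing to exponents turns the factorization property into a linear equation along rays. Let ψ
be the continuous logarithm of the characteristic function of ν, and put p(t) = ψ(e^{-t}y). The law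
of ∫ e^{-s} dY_ν(r(s)) has exponent ∫_0^∞ r'(s) p(s) ds at y. If ρ has exponent φ and q(t) =
φ(e^{-t}y), then I(ν) ∗ ν = I(ρ) says that ∫_t^∞ p + p(t) = ∫_t^∞ q for all t. The integrating
factor e^{-t} gives ∫_0^∞ p = ∫_0^∞ (1 - e^{-s}) q(s) ds (`integral_eq_of_tail_add_eq_tail`). As 1 -
e^{-s} is the derivative of s + e^{-s} - 1, this identifies I(ν) as the required integral driven by
ρ.

Conversely, given ρ, let ν be the law of ∫ e^{-s} dY_ρ(1 - e^{-s}), so that p(t) = ∫_0^∞ e^{-s}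
q(t+s) ds. Fubini shows that p is integrable along rays and has the same integral as before
(`integral_integral_exp_neg_smul_comp_add`). The weights 1 - e^{-s} and e^{-s} add up to 1, whence
I(ν) ∗ ν = I(ρ).

Three supports carry this. A finite logarithmic moment is equivalent to integrability of the
exponent along rays (`IsCharExponent.integrable_log_iff`). Lévy processes exist: iterated halving of
ν gives a consistent dyadic array, and a maximal inequality for two successive large moves makes the
dyadic paths regular (`IsInfinitelyDivisible.exists_isLevyProcessOf`). Random integrals are limits
of sums of independent increments, which yields their exponents, and the improper integral converges
because the family is Cauchy in probability (`IsLevyProcessOf.exists_isImproperRandomIntegral`). -/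

set_option linter.unusedSectionVars false

/-! ### Characteristic functions and exponents of infinitely divisible laws -/

section CharFun

variable {E : Type*} [NormedAddCommGroup E] [InnerProductSpace ℝ E] [FiniteDimensional ℝ E]
  [MeasurableSpace E] [BorelSpace E]

/-- On the convex left half-plane the derivative of exp has norm at most 1, so the mean value
inequality applies. -/
theorem norm_exp_sub_one_le_of_re_nonpos {z : ℂ} (hz : z.re ≤ 0) : ‖Complex.exp z - 1‖ ≤ ‖z‖ := by
  have h := Convex.norm_image_sub_le_of_norm_deriv_le (f := Complex.exp) (s := {w : ℂ | w.re ≤ 0})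
    (x := 0) (y := z) (C := 1) (fun x _ => Complex.differentiableAt_exp)
    (fun x hx => by
      rw [Complex.deriv_exp, Complex.norm_exp]
      exact Real.exp_le_one_iff.2 hx)
    (convex_halfSpace_re_le 0) (by simp) hz
  simpa using h

theorem norm_le_two_mul_norm_exp_sub_one {z : ℂ} (hz : ‖z‖ ≤ 1 / 2) :
    ‖z‖ ≤ 2 * ‖Complex.exp z - 1‖ := by
  have h := Complex.norm_exp_sub_one_sub_id_le (x := z) (by linarith)
  have h2 : ‖z‖ ≤ ‖Complex.exp z - 1‖ + ‖Complex.exp z - 1 - z‖ := by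
    have := norm_sub_le (Complex.exp z - 1) (Complex.exp z - 1 - z)
    simpa using this
  nlinarith [norm_nonneg z]

/-- Tail bound in terms of the characteristic function along an orthonormal basis. -/
theorem measureReal_norm_gt_le_sum_integral_charFun (μ : Measure E) [IsProbabilityMeasure μ]
    {c r : ℝ} (hr : 0 < r) (hc : r * (Module.finrank ℝ E + 1) ≤ c) :
    μ.real {x | c < ‖x‖} ≤ ∑ i, 2⁻¹ * r *
      ‖∫ t in (-2 * r⁻¹)..(2 * r⁻¹), 1 - charFun μ (t • stdOrthonormalBasis ℝ E i)‖ := by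
  have hsub : {x : E | c < ‖x‖} ⊆ ⋃ i, {x | r < |inner ℝ (stdOrthonormalBasis ℝ E i) x|} := by
    intro x hx
    by_contra hcon
    simp only [Set.mem_iUnion, Set.mem_ofPred_eq, not_exists, not_lt] at hcon
    have h1 : ‖x‖ ≤ ∑ i, ‖inner ℝ (stdOrthonormalBasis ℝ E i) x‖ := by
      conv_lhs => rw [← (stdOrthonormalBasis ℝ E).sum_repr' x]
      refine (norm_sum_le _ _).trans (Finset.sum_le_sum fun i _ => ?_)
      rw [norm_smul, (stdOrthonormalBasis ℝ E).norm_eq_one, mul_one]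
    have h2 : ∑ i, ‖inner ℝ (stdOrthonormalBasis ℝ E i) x‖ ≤ Module.finrank ℝ E * r := by
      refine (Finset.sum_le_sum fun i _ => hcon i).trans ?_
      simp
    have hx' : c < ‖x‖ := hx
    nlinarith
  refine (measureReal_mono hsub).trans ((measureReal_iUnion_fintype_le _).trans ?_)
  exact Finset.sum_le_sum fun i _ => measureReal_abs_inner_gt_le_integral_charFun hr

theorem re_charFun (μ : Measure E) [IsProbabilityMeasure μ] (z : E) :
    (charFun μ z).re = ∫ x, Real.cos (inner ℝ x z) ∂μ := by
  rw [charFun_apply]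
  have hint : Integrable (fun x : E => Complex.exp (inner ℝ x z * Complex.I)) μ := by
    refine Integrable.of_bound (C := 1) (by fun_prop) (ae_of_all _ fun x => ?_)
    rw [Complex.norm_exp_ofReal_mul_I]
  have := Complex.reCLM.integral_comp_comm hint
  rw [Complex.reCLM_apply] at this
  rw [← this]
  congr 1 with x
  simp [Complex.exp_ofReal_mul_I_re]

/-- Integrate 1 - cos 2θ = 2(1 - cos θ)(1 + cos θ) ≤ 4(1 - cos θ). -/
theorem one_sub_re_charFun_two_smul_le (μ : Measure E) [IsProbabilityMeasure μ] (y : E) :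
    1 - (charFun μ ((2 : ℝ) • y)).re ≤ 4 * (1 - (charFun μ y).re) := by
  have hi : ∀ z : E, Integrable (fun x => Real.cos (inner ℝ x z)) μ := fun z =>
    Integrable.of_bound (C := 1) (by fun_prop) (ae_of_all _ fun x => by
      simpa using Real.abs_cos_le_one _)
  rw [re_charFun, re_charFun]
  have h1 : ∀ z : E, 1 - ∫ x, Real.cos (inner ℝ x z) ∂μ = ∫ x, (1 - Real.cos (inner ℝ x z)) ∂μ := by
    intro z
    rw [integral_sub (integrable_const _) (hi z)]
    simp
  rw [h1, h1, ← integral_const_mul]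
  refine integral_mono ((integrable_const _).sub (hi _))
    (((integrable_const _).sub (hi _)).const_mul _) fun x => ?_
  simp only [inner_smul_right, Real.cos_two_mul]
  nlinarith [Real.cos_le_one (inner ℝ x y), Real.neg_one_le_cos (inner ℝ x y)]

/-- The symmetrisation of μ has characteristic function |μ̂|², which is real, so the bound for real
parts applies to it. -/
theorem one_sub_normSq_charFun_two_smul_le (μ : Measure E) [IsProbabilityMeasure μ] (y : E) :
    1 - ‖charFun μ ((2 : ℝ) • y)‖ ^ 2 ≤ 4 * (1 - ‖charFun μ y‖ ^ 2) := by
  have : IsProbabilityMeasure (μ.map (fun x => (-1 : ℝ) • x)) :=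
    Measure.isProbabilityMeasure_map (by fun_prop)
  have h : ∀ z, charFun (Measure.conv μ (μ.map (fun x => (-1 : ℝ) • x))) z
      = ((‖charFun μ z‖ ^ 2 : ℝ) : ℂ) := by
    intro z
    rw [charFun_conv, charFun_map_smul, neg_one_smul, charFun_neg, Complex.mul_conj]
    rw [Complex.normSq_eq_norm_sq]
  have := one_sub_re_charFun_two_smul_le (Measure.conv μ (μ.map (fun x => (-1 : ℝ) • x))) y
  rwa [h, h, Complex.ofReal_re, Complex.ofReal_re] at this

theorem charFun_convPow (ρ : Measure E) [IsProbabilityMeasure ρ] (n : ℕ) :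
    IsProbabilityMeasure (convPow ρ n) ∧ ∀ y, charFun (convPow ρ n) y = charFun ρ y ^ n := by
  induction n with
  | zero =>
    simp only [convPow, Function.iterate_zero, id_eq]
    refine ⟨inferInstance, fun y => ?_⟩
    rw [charFun_dirac]
    simp
  | succ n ih =>
    have h : convPow ρ (n + 1) = Measure.conv (convPow ρ n) ρ := by
      simp only [convPow, Function.iterate_succ_apply']
    obtain ⟨h1, h2⟩ := ih
    rw [h]
    exact ⟨inferInstance, fun y => by rw [charFun_conv, h2, pow_succ]⟩

/-- Nonvanishing propagates from z to 2z, because convolution roots of high order have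
characteristic function of modulus close to 1 at z. Every point is reached by doubling from a
neighbourhood of 0. -/
theorem IsInfinitelyDivisible.charFun_ne_zero {ν : Measure E} (hν : IsInfinitelyDivisible ν)
    (y : E) : charFun ν y ≠ 0 := by
  obtain ⟨hprob, hroot⟩ := hν
  have hdouble : ∀ z, charFun ν z ≠ 0 → charFun ν ((2 : ℝ) • z) ≠ 0 := by
    intro z hz
    -- This n makes |ρ̂(z)|² > 3/4 for the root ρ of order n + 1. The defect from 1, below 1/4,
    -- grows at most fourfold under doubling and stays below 1.
    obtain ⟨n, hn⟩ := exists_pow_lt_of_lt_one (show 0 < ‖charFun ν z‖ ^ 2 by positivity)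
      (show (3 / 4 : ℝ) < 1 by norm_num)
    obtain ⟨ρ, hρ, hρν⟩ := hroot (n + 1) (by omega)
    have hpow := (charFun_convPow ρ (n + 1)).2
    rw [hρν] at hpow
    have hbig : 3 / 4 < ‖charFun ρ z‖ ^ 2 := by
      by_contra hle
      have h1 : (‖charFun ρ z‖ ^ 2) ^ (n + 1) ≤ (3 / 4) ^ (n + 1) :=
        pow_le_pow_left₀ (by positivity) (not_lt.1 hle) _
      have h2 : ‖charFun ν z‖ ^ 2 = (‖charFun ρ z‖ ^ 2) ^ (n + 1) := by
        rw [hpow, norm_pow, ← pow_mul, ← pow_mul, mul_comm]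
      have h3 : (3 / 4 : ℝ) ^ (n + 1) ≤ (3 / 4) ^ n :=
        pow_le_pow_of_le_one (by norm_num) (by norm_num) (Nat.le_succ n)
      linarith
    have h4 := one_sub_normSq_charFun_two_smul_le ρ z
    intro h0
    rw [hpow] at h0
    have h5 : charFun ρ ((2 : ℝ) • z) = 0 := by simpa using h0
    rw [h5] at h4
    norm_num at h4
    linarith
  have hcont : Continuous (charFun ν) := continuous_charFun
  have hsmall : ∃ k : ℕ, charFun ν (((2 : ℝ) ^ k)⁻¹ • y) ≠ 0 := by
    have ht : Tendsto (fun k : ℕ => charFun ν (((2 : ℝ) ^ k)⁻¹ • y)) atTop (𝓝 (charFun ν 0)) := by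
      refine (hcont.tendsto _).comp ?_
      have : Tendsto (fun k : ℕ => ((2 : ℝ) ^ k)⁻¹) atTop (𝓝 0) :=
        tendsto_inv_atTop_zero.comp (tendsto_pow_atTop_atTop_of_one_lt (by norm_num))
      simpa using this.smul_const y
    have h0 : charFun ν 0 ≠ 0 := by simp
    exact (ht.eventually_ne h0).exists
  obtain ⟨k, hk⟩ := hsmall
  have hiter : ∀ j : ℕ, charFun ν ((2 : ℝ) ^ j • ((2 : ℝ) ^ k)⁻¹ • y) ≠ 0 := by
    intro j
    induction j with
    | zero => simpa using hk
    | succ j ih => simpa [pow_succ', mul_smul] using hdouble _ ih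
  have := hiter k
  rwa [smul_smul, mul_inv_cancel₀ (by positivity), one_smul] at this

/-- `ψ` is the distinguished logarithm of the characteristic function of `ν`. -/
structure IsCharExponent (ν : Measure E) (ψ : E → ℂ) : Prop where
  continuous : Continuous ψ
  map_zero : ψ 0 = 0
  charFun_eq : ∀ y, charFun ν y = Complex.exp (ψ y)

/-- The modulus has a real logarithm; the phase is a map from a simply connected space to the circle
and lifts through the covering `Circle.exp`. -/
theorem IsInfinitelyDivisible.exists_charExponent {ν : Measure E}
    (hν : IsInfinitelyDivisible ν) : ∃ ψ, IsCharExponent ν ψ := by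
  have hne := hν.charFun_ne_zero
  have hprob := hν.1
  have hcont : Continuous (charFun ν) := continuous_charFun
  have hnorm : ∀ y, ‖charFun ν y‖ ≠ 0 := fun y => norm_ne_zero_iff.2 (hne y)
  have hmem : ∀ y, charFun ν y / ‖charFun ν y‖ ∈ Submonoid.unitSphere ℂ := fun y =>
    mem_sphere_zero_iff_norm.2 (by
      rw [norm_div, Complex.norm_real, norm_norm, div_self (hnorm y)])
  let u : C(E, Circle) := ⟨fun y => ⟨charFun ν y / ‖charFun ν y‖, hmem y⟩,
    (hcont.div (by fun_prop) (fun y => by exact_mod_cast hnorm y)).subtype_mk _⟩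
  have hu : ∀ y, (u y : ℂ) = charFun ν y / ‖charFun ν y‖ := fun y => rfl
  obtain ⟨θ, ⟨hθ0, hθ⟩, -⟩ := Circle.isCoveringMap_exp.existsUnique_continuousMap_lifts u 0 0 (by
    apply Circle.ext
    rw [hu]
    simp)
  refine ⟨fun y => (Real.log ‖charFun ν y‖ : ℂ) + θ y * Complex.I, ?_, ?_, fun y => ?_⟩
  · have : Continuous fun y => Real.log ‖charFun ν y‖ := hcont.norm.log hnorm
    fun_prop
  · simp [hθ0]
  · have h : (Circle.exp (θ y) : ℂ) = u y := by rw [← hθ]; rfl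
    rw [Circle.coe_exp, hu] at h
    have h0 : (‖charFun ν y‖ : ℂ) ≠ 0 := by exact_mod_cast hnorm y
    rw [Complex.exp_add, h, ← Complex.ofReal_exp, Real.exp_log (norm_pos_iff.2 (hne y)),
      mul_div_cancel₀ _ h0]

namespace IsCharExponent

variable {ν : Measure E} {ψ : E → ℂ}

theorem re_nonpos [IsProbabilityMeasure ν] (h : IsCharExponent ν ψ) (y : E) : (ψ y).re ≤ 0 := by
  have := norm_charFun_le_one (μ := ν) y
  rwa [h.charFun_eq, Complex.norm_exp, Real.exp_le_one_iff] at this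

/-- A continuous function whose `n`-th power is `exp ∘ ψ` is `exp ∘ (ψ / n)`. -/
theorem eq_exp_div_of_pow_eq (h : IsCharExponent ν ψ) {g : E → ℂ} (hg : Continuous g)
    (hg0 : g 0 = 1) {n : ℕ} (hn : n ≠ 0) (hpow : ∀ y, g y ^ n = Complex.exp (ψ y)) (y : E) :
    g y = Complex.exp (ψ y / n) := by
  have hn' : (n : ℂ) ≠ 0 := Nat.cast_ne_zero.2 hn
  let k : E → ℂ := fun y => g y * Complex.exp (-(ψ y / n))
  have hk : Continuous k := by
    have := h.continuous
    fun_prop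
  have hkn : ∀ y, k y ^ n = 1 := by
    intro y
    simp only [k]
    rw [mul_pow, hpow, ← Complex.exp_nat_mul, ← Complex.exp_add, mul_neg, mul_div_cancel₀ _ hn',
      add_neg_cancel, Complex.exp_zero]
  -- A continuous map from a connected space into the finite set of n-th roots of unity is constant.
  have hfin : {z : ℂ | z ^ n = 1}.Finite := by
    have hp : (Polynomial.X ^ n - 1 : Polynomial ℂ) ≠ 0 :=
      Polynomial.X_pow_sub_C_ne_zero (Nat.pos_of_ne_zero hn) 1
    refine ((Polynomial.X ^ n - 1 : Polynomial ℂ).roots.toFinset.finite_toSet).subset fun z hz => ?_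
    simp only [Finset.mem_coe, Multiset.mem_toFinset]
    rw [Polynomial.mem_roots hp]
    simpa [sub_eq_zero] using hz
  have hsub : (Set.range k).Subsingleton := by
    by_contra hnt
    exact (isPreconnected_range hk).infinite_of_nontrivial (Set.not_subsingleton_iff.1 hnt)
      (hfin.subset (by rintro _ ⟨y, rfl⟩; exact hkn y))
  have hky : k y = k 0 := hsub ⟨y, rfl⟩ ⟨0, rfl⟩
  have hk0 : k 0 = 1 := by simp [k, hg0, h.map_zero]
  have : g y * Complex.exp (-(ψ y / n)) = 1 := hky.trans hk0
  rw [Complex.exp_neg] at this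
  field_simp at this
  exact this

theorem charFun_of_convPow_eq (h : IsCharExponent ν ψ) {ρ : Measure E} [IsProbabilityMeasure ρ]
    {n : ℕ} (hn : n ≠ 0) (hρ : convPow ρ n = ν) (y : E) :
    charFun ρ y = Complex.exp (ψ y / n) := by
  refine h.eq_exp_div_of_pow_eq continuous_charFun (by simp) hn (fun y => ?_) y
  rw [← (charFun_convPow ρ n).2, hρ, h.charFun_eq]

end IsCharExponent

/-- Pointwise convergence of random variables implies convergence of characteristic functions. -/
theorem tendsto_charFun_map {Ω ι : Type*} [MeasurableSpace Ω] {P : Measure Ω}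
    [IsProbabilityMeasure P] {l : Filter ι} [l.IsCountablyGenerated] {X : ι → Ω → E} {Z : Ω → E}
    (hX : ∀ n, AEMeasurable (X n) P) (hZ : AEMeasurable Z P)
    (h : ∀ᵐ ω ∂P, Tendsto (fun n => X n ω) l (𝓝 (Z ω))) (y : E) :
    Tendsto (fun n => charFun (P.map (X n)) y) l (𝓝 (charFun (P.map Z) y)) := by
  have key : ∀ W : Ω → E, AEMeasurable W P →
      charFun (P.map W) y = ∫ ω, Complex.exp (inner ℝ (W ω) y * Complex.I) ∂P := by
    intro W hW
    rw [charFun_apply, integral_map hW (by fun_prop)]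
  rw [key Z hZ]
  simp_rw [key _ (hX _)]
  refine tendsto_integral_filter_of_dominated_convergence (fun _ => 1) ?_ ?_ (integrable_const _) ?_
  · refine Eventually.of_forall fun n => ?_
    have : Continuous fun x : E => Complex.exp (inner ℝ x y * Complex.I) := by fun_prop
    exact (this.measurable.comp_aemeasurable (hX n)).aestronglyMeasurable
  · refine Eventually.of_forall fun n => ae_of_all _ fun ω => ?_
    rw [Complex.norm_exp_ofReal_mul_I]
  · filter_upwards [h] with ω hω
    have : Continuous fun x : E => Complex.exp (inner ℝ x y * Complex.I) := by fun_prop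
    exact (this.tendsto _).comp hω

end CharFun

/-! ### Logarithmic moments and integrability along rays -/

section LogMoment

variable {E : Type*} [NormedAddCommGroup E] [InnerProductSpace ℝ E] [FiniteDimensional ℝ E]
  [MeasurableSpace E] [BorelSpace E]

/-- Up to time log(1 + |a|) the integrand is at most 2; afterwards it is at most e^{-s}|a|, whose
remaining integral is at most 1. -/
theorem lintegral_norm_one_sub_exp_le (a : ℝ) :
    ∫⁻ s in Set.Ioi (0 : ℝ), ‖1 - Complex.exp ((Real.exp (-s) * a : ℝ) * Complex.I)‖ₑ
      ≤ ENNReal.ofReal (2 * Real.log (1 + |a|) + 1) := by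
  have ha := abs_nonneg a
  set S := Real.log (1 + |a|) with hS
  have hS0 : 0 ≤ S := Real.log_nonneg (by linarith)
  have hbound2 : ∀ s : ℝ, ‖1 - Complex.exp ((Real.exp (-s) * a : ℝ) * Complex.I)‖ ≤ 2 := by
    intro s
    refine (norm_sub_le _ _).trans ?_
    rw [Complex.norm_exp_ofReal_mul_I]
    norm_num
  have hbound1 : ∀ s : ℝ, ‖1 - Complex.exp ((Real.exp (-s) * a : ℝ) * Complex.I)‖
      ≤ Real.exp (-s) * |a| := by
    intro s
    rw [norm_sub_rev, mul_comm]
    refine Real.norm_exp_I_mul_ofReal_sub_one_le.trans ?_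
    rw [Real.norm_eq_abs, abs_mul, abs_of_pos (Real.exp_pos _)]
  rw [← Set.Ioc_union_Ioi_eq_Ioi hS0]
  refine (lintegral_union_le _ _ _).trans ?_
  rw [ENNReal.ofReal_add (by positivity) zero_le_one]
  refine add_le_add ?_ ?_
  · refine (lintegral_mono (g := fun _ => 2) fun s => ?_).trans ?_
    · rw [← ofReal_norm]
      exact (ENNReal.ofReal_le_ofReal (hbound2 s)).trans (by simp)
    · rw [setLIntegral_const, Real.volume_Ioc, sub_zero, ENNReal.ofReal_mul (by norm_num)]
      simp
  · calc ∫⁻ s in Set.Ioi S, ‖1 - Complex.exp ((Real.exp (-s) * a : ℝ) * Complex.I)‖ₑ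
        ≤ ∫⁻ s in Set.Ioi S, ENNReal.ofReal (Real.exp (-s) * |a|) := by
          refine lintegral_mono fun s => ?_
          rw [← ofReal_norm]
          exact ENNReal.ofReal_le_ofReal (hbound1 s)
      _ = ENNReal.ofReal (∫ s in Set.Ioi S, Real.exp (-s) * |a|) := by
          rw [ofReal_integral_eq_lintegral_ofReal]
          · exact (integrableOn_exp_neg_Ioi S).mul_const _
          · exact ae_of_all _ fun s => by positivity
      _ ≤ ENNReal.ofReal 1 := by
          refine ENNReal.ofReal_le_ofReal ?_
          rw [integral_mul_const, integral_exp_neg_Ioi, hS, Real.exp_neg,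
            Real.exp_log (by linarith), inv_mul_le_iff₀ (by linarith)]
          linarith

/-- Until time log |a| the phase e^{-s}|a| stays above 1, and the oscillating cosine contributes
only a bounded amount. -/
theorem ofReal_log_sub_le_lintegral_one_sub_cos (a : ℝ) :
    ENNReal.ofReal (Real.log (1 + |a|) - 4)
      ≤ ∫⁻ s in Set.Ioi (0 : ℝ), ENNReal.ofReal (1 - Real.cos (Real.exp (-s) * a)) := by
  have ha := abs_nonneg a
  by_cases h1 : |a| < 1
  · have : Real.log (1 + |a|) ≤ |a| := by
      have := Real.log_le_sub_one_of_pos (show 0 < 1 + |a| by linarith)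
      linarith
    rw [ENNReal.ofReal_of_nonpos (by linarith)]
    exact zero_le
  push Not at h1
  have ha0 : |a| ≠ 0 := by positivity
  set S := Real.log |a| with hS
  have hS0 : 0 ≤ S := Real.log_nonneg h1
  have hcos : ∀ s, Real.cos (Real.exp (-s) * a) = Real.cos (Real.exp (-s) * |a|) := by
    intro s
    rw [← Real.cos_abs, abs_mul, abs_of_pos (Real.exp_pos _)]
  have hlog : Real.log (1 + |a|) ≤ S + 1 := by
    have h2 : Real.log (1 + |a|) ≤ Real.log (2 * |a|) := Real.log_le_log (by linarith) (by linarith)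
    rw [Real.log_mul (by norm_num) ha0] at h2
    have := Real.log_two_lt_d9
    linarith
  -- With u = e^{-s}|a| this is (sin u)/u, as in integrating (cos u)/u by parts: the boundary terms
  -- contribute at most 2 to the cosine integral and the remainder at most 1.
  have hderiv : ∀ s ∈ Set.uIcc 0 S, HasDerivAt
      (fun s => Real.sin (Real.exp (-s) * |a|) * (Real.exp s / |a|))
      (Real.sin (Real.exp (-s) * |a|) * (Real.exp s / |a|) - Real.cos (Real.exp (-s) * |a|)) s := by
    intro s _
    have e1 : HasDerivAt (fun s => Real.exp (-s) * |a|) (-Real.exp (-s) * |a|) s := by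
      have := ((hasDerivAt_neg s).exp).mul_const |a|
      simpa using this
    have e2 := e1.sin.mul ((Real.hasDerivAt_exp s).div_const |a|)
    convert! e2 using 1
    have : Real.exp (-s) * Real.exp s = 1 := by rw [← Real.exp_add]; simp
    field_simp
    linear_combination |a| * (Real.cos (Real.exp (-s) * |a|)) * this
  have hint1 : Continuous fun s => Real.sin (Real.exp (-s) * |a|) * (Real.exp s / |a|) := by
    fun_prop
  have hint2 : Continuous fun s => Real.cos (Real.exp (-s) * |a|) := by fun_prop
  have hftc := intervalIntegral.integral_eq_sub_of_hasDerivAt hderiv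
    ((hint1.sub hint2).intervalIntegrable _ _)
  rw [intervalIntegral.integral_sub (hint1.intervalIntegrable _ _)
    (hint2.intervalIntegrable _ _)] at hftc
  have hb1 : ∫ s in (0 : ℝ)..S, Real.sin (Real.exp (-s) * |a|) * (Real.exp s / |a|) ≤ 1 := by
    have : ∫ s in (0 : ℝ)..S, Real.sin (Real.exp (-s) * |a|) * (Real.exp s / |a|)
        ≤ ∫ s in (0 : ℝ)..S, Real.exp s / |a| := by
      refine intervalIntegral.integral_mono_on hS0 (hint1.intervalIntegrable _ _)
        (Continuous.intervalIntegrable (by fun_prop) _ _) fun s _ => ?_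
      exact mul_le_of_le_one_left (by positivity) (Real.sin_le_one _)
    refine this.trans ?_
    rw [intervalIntegral.integral_div, integral_exp, hS, Real.exp_log (by positivity), Real.exp_zero,
      div_le_one (by positivity)]
    linarith
  have hcosint : ∫ s in (0 : ℝ)..S, Real.cos (Real.exp (-s) * |a|) ≤ 3 := by
    have e1 : -1 ≤ Real.sin (Real.exp (-S) * |a|) * (Real.exp S / |a|) := by
      rw [hS, Real.exp_log (by positivity), div_self ha0, mul_one]
      exact Real.neg_one_le_sin _
    have e2 : Real.sin (Real.exp (-0) * |a|) * (Real.exp 0 / |a|) ≤ 1 := by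
      refine (mul_le_of_le_one_left (by positivity) (Real.sin_le_one _)).trans ?_
      rw [Real.exp_zero, div_le_one (by positivity)]
      exact h1
    linarith
  have hmain : Real.log (1 + |a|) - 4 ≤ ∫ s in (0 : ℝ)..S, (1 - Real.cos (Real.exp (-s) * a)) := by
    simp_rw [hcos]
    rw [intervalIntegral.integral_sub (by simp) (hint2.intervalIntegrable _ _)]
    simp only [intervalIntegral.integral_const, sub_zero, smul_eq_mul, mul_one]
    linarith
  refine (ENNReal.ofReal_le_ofReal hmain).trans ?_
  have hcont : Continuous fun s => 1 - Real.cos (Real.exp (-s) * a) := by fun_prop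
  rw [intervalIntegral.integral_of_le hS0, ofReal_integral_eq_lintegral_ofReal]
  · exact lintegral_mono_set Set.Ioc_subset_Ioi_self
  · exact hcont.integrableOn_Ioc
  · exact ae_of_all _ fun s => by
      have := Real.cos_le_one (Real.exp (-s) * a)
      simpa using this

/-- Tonelli reduces the claim to the bound for a single phase, combined with 1 + |⟨x, y⟩| ≤ (1 +
‖x‖)(1 + ‖y‖). -/
theorem integrableOn_one_sub_charFun_of_integrable_log {μ : Measure E} [IsProbabilityMeasure μ]
    (h : Integrable (fun x : E => Real.log (1 + ‖x‖)) μ) (y : E) :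
    IntegrableOn (fun s : ℝ => 1 - charFun μ (Real.exp (-s) • y)) (Set.Ioi 0) := by
  have hcont : Continuous (charFun μ) := continuous_charFun
  refine ⟨by fun_prop, ?_⟩
  have hexp : ∀ z : E, Integrable (fun x : E => Complex.exp (inner ℝ x z * Complex.I)) μ := by
    intro z
    refine Integrable.of_bound (C := 1) (by fun_prop) (ae_of_all _ fun x => ?_)
    rw [Complex.norm_exp_ofReal_mul_I]
  have h1 : ∀ s : ℝ, ‖1 - charFun μ (Real.exp (-s) • y)‖ₑ ≤ ∫⁻ x,
      ‖1 - Complex.exp ((Real.exp (-s) * inner ℝ x y : ℝ) * Complex.I)‖ₑ ∂μ := by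
    intro s
    have : 1 - charFun μ (Real.exp (-s) • y)
        = ∫ x, (1 - Complex.exp ((Real.exp (-s) * inner ℝ x y : ℝ) * Complex.I)) ∂μ := by
      rw [charFun_apply]
      simp_rw [← inner_smul_right]
      rw [integral_sub (integrable_const _) (hexp _)]
      simp
    rw [this]
    exact enorm_integral_le_lintegral_enorm _
  have h2 : Integrable (fun x : E => 2 * (Real.log (1 + ‖y‖) + Real.log (1 + ‖x‖)) + 1) μ :=
    (((integrable_const _).add h).const_mul 2).add (integrable_const _)
  have hpos : ∀ z : E, 0 ≤ Real.log (1 + ‖z‖) := fun z =>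
    Real.log_nonneg (by linarith [norm_nonneg z])
  calc ∫⁻ s in Set.Ioi (0 : ℝ), ‖1 - charFun μ (Real.exp (-s) • y)‖ₑ
      ≤ ∫⁻ s in Set.Ioi (0 : ℝ), ∫⁻ x,
        ‖1 - Complex.exp ((Real.exp (-s) * inner ℝ x y : ℝ) * Complex.I)‖ₑ ∂μ :=
        lintegral_mono h1
    _ = ∫⁻ x, (∫⁻ s in Set.Ioi (0 : ℝ),
        ‖1 - Complex.exp ((Real.exp (-s) * inner ℝ x y : ℝ) * Complex.I)‖ₑ) ∂μ := by
        refine lintegral_lintegral_swap ?_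
        refine Measurable.aemeasurable ?_
        simp only [Function.uncurry_def]
        fun_prop
    _ ≤ ∫⁻ x, ENNReal.ofReal (2 * (Real.log (1 + ‖y‖) + Real.log (1 + ‖x‖)) + 1) ∂μ := by
        refine lintegral_mono fun x => (lintegral_norm_one_sub_exp_le _).trans ?_
        refine ENNReal.ofReal_le_ofReal ?_
        have hle : Real.log (1 + |inner ℝ x y|) ≤ Real.log (1 + ‖y‖) + Real.log (1 + ‖x‖) := by
          rw [← Real.log_mul (by positivity) (by positivity)]
          refine Real.log_le_log (by positivity) ?_
          nlinarith [abs_real_inner_le_norm x y, norm_nonneg x, norm_nonneg y]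
        linarith
    _ < ⊤ := by
        rw [← ofReal_integral_eq_lintegral_ofReal h2]
        · exact ENNReal.ofReal_lt_top
        · exact ae_of_all _ fun x => by
            have := hpos x
            have := hpos y
            positivity

/-- The real part of 1 - μ̂ is an integral of the nonnegative function 1 - cos, so Tonelli and the
lower bound for a single phase apply. -/
theorem integrable_log_inner_of_integrableOn_one_sub_charFun {μ : Measure E}
    [IsProbabilityMeasure μ] {y : E}
    (h : IntegrableOn (fun s : ℝ => 1 - charFun μ (Real.exp (-s) • y)) (Set.Ioi 0)) :
    Integrable (fun x : E => Real.log (1 + |inner ℝ x y|)) μ := by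
  have hcosint : ∀ z : E, Integrable (fun x => Real.cos (inner ℝ x z)) μ := fun z =>
    Integrable.of_bound (C := 1) (by fun_prop) (ae_of_all _ fun x => by
      simpa using Real.abs_cos_le_one _)
  have hre : ∀ s : ℝ, ∫⁻ x, ENNReal.ofReal (1 - Real.cos (Real.exp (-s) * inner ℝ x y)) ∂μ
      ≤ ‖1 - charFun μ (Real.exp (-s) • y)‖ₑ := by
    intro s
    simp_rw [← inner_smul_right]
    have hi : Integrable (fun x => 1 - Real.cos (inner ℝ x (Real.exp (-s) • y))) μ :=
      (integrable_const _).sub (hcosint _)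
    rw [← ofReal_integral_eq_lintegral_ofReal hi, ← ofReal_norm]
    · refine ENNReal.ofReal_le_ofReal ?_
      refine le_trans (le_of_eq ?_) (Complex.re_le_norm _)
      rw [Complex.sub_re, re_charFun, integral_sub (integrable_const _) (hcosint _)]
      simp
    · exact ae_of_all _ fun x => by
        have := Real.cos_le_one (inner ℝ x (Real.exp (-s) • y))
        simpa using this
  have hfin : ∫⁻ x, ENNReal.ofReal (Real.log (1 + |inner ℝ x y|) - 4) ∂μ < ⊤ := by
    calc ∫⁻ x, ENNReal.ofReal (Real.log (1 + |inner ℝ x y|) - 4) ∂μ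
        ≤ ∫⁻ x, (∫⁻ s in Set.Ioi (0 : ℝ),
          ENNReal.ofReal (1 - Real.cos (Real.exp (-s) * inner ℝ x y))) ∂μ :=
          lintegral_mono fun x => ofReal_log_sub_le_lintegral_one_sub_cos _
      _ = ∫⁻ s in Set.Ioi (0 : ℝ),
          ∫⁻ x, ENNReal.ofReal (1 - Real.cos (Real.exp (-s) * inner ℝ x y)) ∂μ := by
          refine lintegral_lintegral_swap ?_
          refine Measurable.aemeasurable ?_
          simp only [Function.uncurry_def]
          fun_prop
      _ ≤ ∫⁻ s in Set.Ioi (0 : ℝ), ‖1 - charFun μ (Real.exp (-s) • y)‖ₑ := lintegral_mono hre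
      _ < ⊤ := h.2
  have hnn : ∀ x : E, 0 ≤ Real.log (1 + |inner ℝ x y|) := fun x =>
    Real.log_nonneg (by linarith [abs_nonneg (inner ℝ x y)])
  refine ⟨?_, ?_⟩
  · exact Measurable.aestronglyMeasurable (Real.measurable_log.comp (by fun_prop))
  · calc ∫⁻ x, ‖Real.log (1 + |inner ℝ x y|)‖ₑ ∂μ
        ≤ ∫⁻ x, (ENNReal.ofReal (Real.log (1 + |inner ℝ x y|) - 4) + ENNReal.ofReal 4) ∂μ := by
          refine lintegral_mono fun x => ?_
          rw [Real.enorm_of_nonneg (hnn x)]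
          have := ENNReal.ofReal_add_le (p := Real.log (1 + |inner ℝ x y|) - 4) (q := 4)
          rwa [sub_add_cancel] at this
      _ < ⊤ := by
          rw [lintegral_add_right _ measurable_const]
          simp [hfin]

theorem integrable_log_norm_of_forall_inner {μ : Measure E}
    (h : ∀ y : E, Integrable (fun x : E => Real.log (1 + |inner ℝ x y|)) μ) :
    Integrable (fun x : E => Real.log (1 + ‖x‖)) μ := by
  let b := stdOrthonormalBasis ℝ E
  have hsum : Integrable (fun x => ∑ i, Real.log (1 + |inner ℝ x (b i)|)) μ :=
    integrable_finsetSum _ fun i _ => h (b i)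
  have hlogsum : ∀ (s : Finset (Fin (Module.finrank ℝ E))) (a : Fin (Module.finrank ℝ E) → ℝ),
      (∀ i, 0 ≤ a i) → Real.log (1 + ∑ i ∈ s, a i) ≤ ∑ i ∈ s, Real.log (1 + a i) := by
    intro s a ha
    induction s using Finset.induction_on with
    | empty => simp
    | insert i s hi ih =>
      rw [Finset.sum_insert hi, Finset.sum_insert hi]
      have hs : 0 ≤ ∑ i ∈ s, a i := Finset.sum_nonneg fun i _ => ha i
      have hi' := ha i
      calc Real.log (1 + (a i + ∑ i ∈ s, a i)) ≤ Real.log ((1 + a i) * (1 + ∑ i ∈ s, a i)) := by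
            refine Real.log_le_log (by positivity) ?_
            nlinarith [mul_nonneg hi' hs]
        _ = Real.log (1 + a i) + Real.log (1 + ∑ i ∈ s, a i) :=
            Real.log_mul (by positivity) (by positivity)
        _ ≤ _ := by linarith
  refine hsum.mono' ?_ (ae_of_all _ fun x => ?_)
  · exact Measurable.aestronglyMeasurable (Real.measurable_log.comp (by fun_prop))
  · rw [Real.norm_of_nonneg (Real.log_nonneg (by linarith [norm_nonneg x]))]
    refine le_trans ?_ (hlogsum Finset.univ (fun i => |inner ℝ x (b i)|) fun i => abs_nonneg _)
    refine Real.log_le_log (by positivity) ?_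
    gcongr
    conv_lhs => rw [← b.sum_repr' x]
    refine (norm_sum_le _ _).trans (Finset.sum_le_sum fun i _ => ?_)
    rw [norm_smul, b.norm_eq_one, mul_one, real_inner_comm]
    rfl

/-- An infinitely divisible law has a finite logarithmic moment exactly when its exponent is
integrable along all rays in logarithmic coordinates. -/
theorem IsCharExponent.integrable_log_iff {μ : Measure E} [IsProbabilityMeasure μ] {ψ : E → ℂ}
    (hψ : IsCharExponent μ ψ) :
    Integrable (fun x : E => Real.log (1 + ‖x‖)) μ ↔
      ∀ y, IntegrableOn (fun s : ℝ => ψ (Real.exp (-s) • y)) (Set.Ioi 0) := by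
  have hc := hψ.continuous
  have hcφ : Continuous (charFun μ) := continuous_charFun
  constructor
  · intro h y
    have h1 := integrableOn_one_sub_charFun_of_integrable_log h y
    have htend : Tendsto (fun s : ℝ => ψ (Real.exp (-s) • y)) atTop (𝓝 0) := by
      have : Tendsto (fun s : ℝ => Real.exp (-s) • y) atTop (𝓝 0) := by
        simpa using Real.tendsto_exp_neg_atTop_nhds_zero.smul_const y
      have h2 := (hc.tendsto 0).comp this
      rwa [hψ.map_zero] at h2
    -- Beyond T the exponent is small enough to be controlled by exp ψ - 1; before T continuity
    -- suffices. The converse needs no cutoff, since Re ψ ≤ 0.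
    obtain ⟨T, hT⟩ := eventually_atTop.1
      (htend.norm.eventually (gt_mem_nhds (show ‖(0 : ℂ)‖ < 1 / 2 by norm_num)))
    have hcont : Continuous fun s : ℝ => ψ (Real.exp (-s) • y) := by fun_prop
    have hsub : Set.Ioi (0 : ℝ) ⊆ Set.Ioc 0 (max T 0) ∪ Set.Ioi (max T 0) := by
      rw [Set.Ioc_union_Ioi_eq_Ioi (le_max_right _ _)]
    refine IntegrableOn.mono_set (IntegrableOn.union hcont.integrableOn_Ioc ?_) hsub
    have h3 : IntegrableOn (fun s : ℝ => 1 - charFun μ (Real.exp (-s) • y)) (Set.Ioi (max T 0)) :=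
      h1.mono_set (Set.Ioi_subset_Ioi (le_max_right _ _))
    refine Integrable.mono' (h3.norm.const_mul 2) hcont.aestronglyMeasurable ?_
    filter_upwards [ae_restrict_mem measurableSet_Ioi] with s hs
    rw [hψ.charFun_eq, norm_sub_rev]
    exact norm_le_two_mul_norm_exp_sub_one (hT s ((le_max_left _ _).trans (le_of_lt hs))).le
  · intro h
    refine integrable_log_norm_of_forall_inner fun y =>
      integrable_log_inner_of_integrableOn_one_sub_charFun ?_
    refine Integrable.mono (h y) (by fun_prop) (ae_of_all _ fun s => ?_)
    rw [hψ.charFun_eq, norm_sub_rev]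
    exact norm_exp_sub_one_le_of_re_nonpos (hψ.re_nonpos _)

end LogMoment

/-! ### Inverse limits of consistent laws -/

theorem MeasureTheory.Measure.map_prodMap_id_compProd_comap {α β γ : Type*} [MeasurableSpace α]
    [MeasurableSpace β] [MeasurableSpace γ] (μ : Measure α) [SFinite μ] (κ : Kernel β γ)
    [IsSFiniteKernel κ] {g : α → β} (hg : Measurable g) :
    (μ ⊗ₘ κ.comap g hg).map (Prod.map g id) = μ.map g ⊗ₘ κ := by
  ext s hs
  rw [Measure.map_apply (by fun_prop) hs, Measure.compProd_apply (by measurability),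
    Measure.compProd_apply hs, lintegral_map (Kernel.measurable_kernel_prodMk_left hs) hg]
  rfl

/-- A sequence of probability measures that is consistent under a measurable map can be realised
on one probability space. -/
theorem exists_measure_inverseLimit {α : Type*} [TopologicalSpace α] [PolishSpace α]
    [MeasurableSpace α] [BorelSpace α] [Nonempty α] (π : ℕ → Measure α)
    [∀ n, IsProbabilityMeasure (π n)] {T : α → α} (hT : Measurable T)
    (hπ : ∀ n, (π (n + 1)).map T = π n) :
    ∃ P : Measure (ℕ → α), IsProbabilityMeasure P ∧ (∀ n, P.map (fun ω => ω n) = π n) ∧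
      ∀ᵐ ω ∂P, ∀ n, ω n = T (ω (n + 1)) := by
  let g : ∀ n : ℕ, (Finset.Iic n → α) → α := fun n x => x ⟨n, Finset.mem_Iic.2 le_rfl⟩
  have hg : ∀ n, Measurable (g n) := fun n => measurable_pi_apply _
  -- Given the present state, the next one is drawn from the conditional law of x given T x under `π
  -- (n + 1)`; consecutive states are then distributed as (T x, x).
  let κ : ∀ n : ℕ, Kernel (Finset.Iic n → α) α :=
    fun n => (condDistrib id T (π (n + 1))).comap (g n) (hg n)
  let P : Measure (ℕ → α) := Kernel.trajMeasure (X := fun _ => α) (π 0) κ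
  have hP : IsProbabilityMeasure P := by infer_instance
  have hfr : ∀ n, Measurable (fun ω : ℕ → α => Preorder.frestrictLe (π := fun _ => α) n ω) := by
    intro n
    fun_prop
  have hstep : ∀ n, P.map (fun ω => ω n) = π n →
      P.map (fun ω => (ω n, ω (n + 1))) = (π (n + 1)).map (fun x => (T x, x)) := by
    intro n hn
    have h1 := Kernel.map_frestrictLe_trajMeasure_compProd_eq_map_trajMeasure
      (X := fun _ => α) (κ := κ) (μ₀ := π 0) (a := n)
    have h2 := congrArg (fun m => Measure.map (Prod.map (g n) id) m) h1
    have h3 := Measure.map_prodMap_id_compProd_comap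
      (P.map (Preorder.frestrictLe (π := fun _ => α) n)) (condDistrib id T (π (n + 1))) (hg n)
    rw [Measure.map_map (hg n) (hfr n)] at h3
    have h4 : (g n) ∘ (Preorder.frestrictLe (π := fun _ => α) n) = fun ω : ℕ → α => ω n := rfl
    rw [h4, hn, ← hπ n, compProd_map_condDistrib (by fun_prop)] at h3
    rw [Measure.map_map (by fun_prop) (by fun_prop)] at h2
    exact h2.symm.trans h3
  have hmarg : ∀ n, P.map (fun ω => ω n) = π n := by
    intro n
    induction n with
    | zero =>
      have h0 : P.map (Preorder.frestrictLe (π := fun _ => α) 0)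
          = (π 0).map (MeasurableEquiv.piUnique (fun _ : Finset.Iic 0 => α)).symm := by
        simp only [P, Kernel.trajMeasure]
        rw [Measure.map_comp _ _ (hfr 0), Kernel.traj_map_frestrictLe, Kernel.partialTraj_self,
          Measure.id_comp]
      have h4 : (g 0) ∘ (Preorder.frestrictLe (π := fun _ => α) 0) = fun ω : ℕ → α => ω 0 := rfl
      rw [← h4, ← Measure.map_map (hg 0) (hfr 0), h0, Measure.map_map (hg 0) (by fun_prop)]
      have h5 : g 0 ∘ (MeasurableEquiv.piUnique (fun _ : Finset.Iic 0 => α)).symm = id := by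
        ext x
        rfl
      rw [h5, Measure.map_id]
    | succ n ih =>
      have h1 := congrArg (fun m => Measure.map Prod.snd m) (hstep n ih)
      rw [Measure.map_map measurable_snd (by fun_prop),
        Measure.map_map measurable_snd (by fun_prop)] at h1
      simpa [Function.comp_def] using h1
  refine ⟨P, hP, hmarg, ae_all_iff.2 fun n => ?_⟩
  have hmeas : MeasurableSet {p : α × α | p.1 = T p.2} := by
    have : Measurable fun p : α × α => (p.1, T p.2) := by fun_prop
    exact this isClosed_diagonal.measurableSet
  have h1 : ∀ᵐ p ∂(P.map (fun ω => (ω n, ω (n + 1)))), p.1 = T p.2 := by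
    rw [hstep n (hmarg n), ae_map_iff (by fun_prop) hmeas]
    simp
  rwa [ae_map_iff (by fun_prop) hmeas] at h1

/-! ### Maximal inequalities for random walks -/

section RandomWalk

variable {Ω E : Type*} [MeasurableSpace Ω] {P : Measure Ω} [NormedAddCommGroup E]
  [MeasurableSpace E] [BorelSpace E] [SecondCountableTopology E] {ξ : ℕ → Ω → E}

theorem measurable_iSup_comap_sum {I : Set ℕ} {s : Finset ℕ} (hs : ↑s ⊆ I) :
    Measurable[⨆ i ∈ I, MeasurableSpace.comap (ξ i) inferInstance] fun ω => ∑ i ∈ s, ξ i ω := by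
  refine Finset.measurable_fun_sum s fun i hi => ?_
  have h : MeasurableSpace.comap (ξ i) inferInstance
      ≤ ⨆ i ∈ I, MeasurableSpace.comap (ξ i) inferInstance :=
    le_iSup₂_of_le i (hs hi) le_rfl
  exact (comap_measurable (ξ i)).mono h le_rfl

theorem iIndepFun.measureReal_inter_past_future (hξ : ∀ i, Measurable (ξ i)) (hind : iIndepFun ξ P)
    {k : ℕ} {A B : Set Ω}
    (hA : MeasurableSet[⨆ i ∈ Set.Iio k, MeasurableSpace.comap (ξ i) inferInstance] A)
    (hB : MeasurableSet[⨆ i ∈ Set.Ici k, MeasurableSpace.comap (ξ i) inferInstance] B) :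
    P.real (A ∩ B) = P.real A * P.real B := by
  have h := indep_iSup_of_disjoint (fun i => (hξ i).comap_le) hind
    (Set.disjoint_left.2 (fun i hi hi' => not_lt.2 (Set.mem_Ici.1 hi') (Set.mem_Iio.1 hi)) :
      Disjoint (Set.Iio k) (Set.Ici k))
  rw [measureReal_def, (Indep_iff _ _ _).1 h A B hA hB, ENNReal.toReal_mul]
  rfl

/-- The random walk leaves the ball of radius `c` for the first time at step `k`. -/
def firstExit (ξ : ℕ → Ω → E) (c : ℝ) (k : ℕ) : Set Ω :=
  {ω | (∀ j < k, ‖∑ i ∈ Finset.range j, ξ i ω‖ ≤ c) ∧ c < ‖∑ i ∈ Finset.range k, ξ i ω‖}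

theorem measurableSet_firstExit (c : ℝ) (k : ℕ) :
    MeasurableSet[⨆ i ∈ Set.Iio k, MeasurableSpace.comap (ξ i) inferInstance]
      (firstExit ξ c k) := by
  have hS : ∀ j ≤ k, Measurable[⨆ i ∈ Set.Iio k, MeasurableSpace.comap (ξ i) inferInstance]
      fun ω => ‖∑ i ∈ Finset.range j, ξ i ω‖ := fun j hj =>
    measurable_norm.comp (measurable_iSup_comap_sum (fun i hi => by
      have : i < j := by simpa using hi
      exact Set.mem_Iio.2 (by omega)))
  have : firstExit ξ c k = (⋂ j, ⋂ (_ : j < k), {ω | ‖∑ i ∈ Finset.range j, ξ i ω‖ ≤ c}) ∩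
      {ω | c < ‖∑ i ∈ Finset.range k, ξ i ω‖} := by
    ext ω
    simp [firstExit]
  rw [this]
  refine MeasurableSet.inter (MeasurableSet.iInter fun j => MeasurableSet.iInter fun hj => ?_) ?_
  · exact hS j hj.le measurableSet_Iic
  · exact hS k le_rfl measurableSet_Ioi

theorem pairwise_disjoint_firstExit (c : ℝ) : Pairwise (Function.onFun Disjoint (firstExit ξ c)) := by
  have key : ∀ i j, i < j → Disjoint (firstExit ξ c i) (firstExit ξ c j) := fun i j hij =>
    Set.disjoint_left.2 fun ω hi hj => not_lt.2 (hj.1 i hij) hi.2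
  intro i j hij
  rcases lt_or_gt_of_ne hij with h | h
  · exact key i j h
  · exact (key j i h).symm

theorem exists_mem_firstExit {c : ℝ} {N : ℕ} {ω : Ω}
    (h : ∃ k ≤ N, c < ‖∑ i ∈ Finset.range k, ξ i ω‖) : ∃ k ≤ N, ω ∈ firstExit ξ c k := by
  classical
  have h' : ∃ k, c < ‖∑ i ∈ Finset.range k, ξ i ω‖ := let ⟨k, _, hk⟩ := h; ⟨k, hk⟩
  obtain ⟨k, hkN, hk⟩ := h
  exact ⟨Nat.find h', (Nat.find_le hk).trans hkN,
    fun j hj => not_lt.1 (Nat.find_min h' hj), Nat.find_spec h'⟩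

/-- Ottaviani's maximal inequality. -/
theorem iIndepFun.measureReal_exists_norm_sum_gt_le [IsProbabilityMeasure P]
    (hξ : ∀ i, Measurable (ξ i)) (hind : iIndepFun ξ P) {N : ℕ} {c α : ℝ} (hα : α ≤ 1 / 2)
    (h : ∀ k ≤ N, P.real {ω | c < ‖∑ i ∈ Finset.Ico k N, ξ i ω‖} ≤ α) :
    P.real {ω | ∃ k ≤ N, 2 * c < ‖∑ i ∈ Finset.range k, ξ i ω‖} ≤ 2 * α := by
  have hmeas : ∀ k, MeasurableSet (firstExit ξ (2 * c) k) := fun k =>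
    (iSup₂_le fun i _ => (hξ i).comap_le) _ (measurableSet_firstExit (2 * c) k)
  -- `B k` depends on the steps from k on, hence is independent of a first exit at k, and has
  -- probability at least 1/2. Together the two events force the endpoint out of the ball of radius
  -- c.
  let B : ℕ → Set Ω := fun k => {ω | ‖∑ i ∈ Finset.Ico k N, ξ i ω‖ ≤ c}
  have hB : ∀ k, MeasurableSet[⨆ i ∈ Set.Ici k, MeasurableSpace.comap (ξ i) inferInstance] (B k) :=
    fun k => (measurable_norm.comp (measurable_iSup_comap_sum (fun i hi => by
      simp only [Finset.coe_Ico, Set.mem_Ico] at hi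
      exact hi.1))) measurableSet_Iic
  have hBm : ∀ k, MeasurableSet (B k) := fun k =>
    (iSup₂_le fun i _ => (hξ i).comap_le) _ (hB k)
  have hBP : ∀ k ≤ N, 1 / 2 ≤ P.real (B k) := by
    intro k hk
    have : B k = {ω | c < ‖∑ i ∈ Finset.Ico k N, ξ i ω‖}ᶜ := by
      ext ω
      simp [B]
    rw [this, probReal_compl_eq_one_sub]
    · linarith [h k hk]
    · rw [← MeasurableSet.compl_iff, ← this]
      exact hBm k
  have hcover : {ω | ∃ k ≤ N, 2 * c < ‖∑ i ∈ Finset.range k, ξ i ω‖}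
      ⊆ ⋃ k ∈ Finset.range (N + 1), firstExit ξ (2 * c) k := by
    intro ω hω
    obtain ⟨k, hk, hk'⟩ := exists_mem_firstExit hω
    simp only [Set.mem_iUnion, Finset.mem_range]
    exact ⟨k, by omega, hk'⟩
  have hsub : (⋃ k ∈ Finset.range (N + 1), firstExit ξ (2 * c) k ∩ B k)
      ⊆ {ω | c < ‖∑ i ∈ Finset.Ico 0 N, ξ i ω‖} := by
    intro ω hω
    simp only [Set.mem_iUnion, Finset.mem_range] at hω
    obtain ⟨k, hk, ⟨-, h1⟩, h2⟩ := hω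
    have h2' : ‖∑ i ∈ Finset.Ico k N, ξ i ω‖ ≤ c := h2
    have h3 := Finset.sum_range_add_sum_Ico (fun i => ξ i ω) (show k ≤ N by omega)
    simp only [Set.mem_ofPred_eq, Nat.Ico_zero_eq_range]
    rw [← h3]
    have h4 := norm_sub_le_norm_add (∑ i ∈ Finset.range k, ξ i ω) (∑ i ∈ Finset.Ico k N, ξ i ω)
    linarith
  have hdisj : Set.PairwiseDisjoint ↑(Finset.range (N + 1)) (fun k => firstExit ξ (2 * c) k ∩ B k) :=
    fun i _ j _ hij => (pairwise_disjoint_firstExit (2 * c) hij).mono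
      Set.inter_subset_left Set.inter_subset_left
  calc P.real {ω | ∃ k ≤ N, 2 * c < ‖∑ i ∈ Finset.range k, ξ i ω‖}
      ≤ P.real (⋃ k ∈ Finset.range (N + 1), firstExit ξ (2 * c) k) :=
        measureReal_mono hcover (measure_ne_top _ _)
    _ ≤ ∑ k ∈ Finset.range (N + 1), P.real (firstExit ξ (2 * c) k) :=
        measureReal_biUnion_finset_le _ _
    _ ≤ ∑ k ∈ Finset.range (N + 1), 2 * P.real (firstExit ξ (2 * c) k ∩ B k) := by
        refine Finset.sum_le_sum fun k hk => ?_
        rw [iIndepFun.measureReal_inter_past_future hξ hind (measurableSet_firstExit (2 * c) k) (hB k)]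
        have := hBP k (by have := Finset.mem_range.1 hk; omega)
        nlinarith [measureReal_nonneg (μ := P) (s := firstExit ξ (2 * c) k)]
    _ = 2 * P.real (⋃ k ∈ Finset.range (N + 1), firstExit ξ (2 * c) k ∩ B k) := by
        rw [← Finset.mul_sum, measureReal_biUnion_finset hdisj fun k _ => (hmeas k).inter (hBm k)]
    _ ≤ 2 * P.real {ω | c < ‖∑ i ∈ Finset.Ico 0 N, ξ i ω‖} := by
        gcongr
        exact measure_ne_top _ _
    _ ≤ 2 * α := by
        gcongr
        exact h 0 (Nat.zero_le _)

/-- A random walk whose increments are small in probability is unlikely to make two large moves. -/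
theorem iIndepFun.measureReal_exists_two_moves_le [IsProbabilityMeasure P]
    (hξ : ∀ i, Measurable (ξ i)) (hind : iIndepFun ξ P) {N : ℕ} {c α : ℝ} (hα : α ≤ 1 / 2)
    (h : ∀ k l, k ≤ l → l ≤ N → P.real {ω | c < ‖∑ i ∈ Finset.Ico k l, ξ i ω‖} ≤ α) :
    P.real {ω | ∃ i j l, i < j ∧ j < l ∧ l ≤ N ∧ 4 * c < ‖∑ a ∈ Finset.Ico i j, ξ a ω‖ ∧
      4 * c < ‖∑ a ∈ Finset.Ico j l, ξ a ω‖} ≤ (2 * α) ^ 2 := by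
  have hα0 : 0 ≤ α := measureReal_nonneg.trans (h 0 0 le_rfl (Nat.zero_le _))
  have hmeas : ∀ k, MeasurableSet (firstExit ξ (2 * c) k) := fun k =>
    (iSup₂_le fun i _ => (hξ i).comap_le) _ (measurableSet_firstExit (2 * c) k)
  -- `B k` says that the walk restarted at time k moves by more than 2c. It is independent of a
  -- first exit at k, which produces the product of two factors 2α.
  let B : ℕ → Set Ω := fun k => {ω | ∃ l ≤ N - k, 2 * c < ‖∑ i ∈ Finset.range l, ξ (k + i) ω‖}
  have hB : ∀ k, MeasurableSet[⨆ i ∈ Set.Ici k, MeasurableSpace.comap (ξ i) inferInstance]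
      (B k) := by
    intro k
    have : B k = ⋃ l, ⋃ (_ : l ≤ N - k), {ω | 2 * c < ‖∑ i ∈ Finset.Ico k (k + l), ξ i ω‖} := by
      ext ω
      simp [B, Finset.sum_Ico_eq_sum_range]
    rw [this]
    refine MeasurableSet.iUnion fun l => MeasurableSet.iUnion fun _ => ?_
    exact (measurable_norm.comp (measurable_iSup_comap_sum (fun i hi => by
      simp only [Finset.coe_Ico, Set.mem_Ico] at hi
      exact hi.1))) measurableSet_Ioi
  have hBP : ∀ k ≤ N, P.real (B k) ≤ 2 * α := by
    intro k hk
    refine iIndepFun.measureReal_exists_norm_sum_gt_le (ξ := fun i => ξ (k + i)) (fun i => hξ _)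
      (hind.precomp (add_right_injective k)) hα fun j hj => ?_
    have := h (k + j) (k + (N - k)) (by omega) (by omega)
    simp_rw [Finset.sum_Ico_eq_sum_range] at this ⊢
    rw [show k + (N - k) - (k + j) = N - k - j by omega] at this
    simpa only [add_assoc] using this
  have hcover : {ω | ∃ i j l, i < j ∧ j < l ∧ l ≤ N ∧ 4 * c < ‖∑ a ∈ Finset.Ico i j, ξ a ω‖ ∧
      4 * c < ‖∑ a ∈ Finset.Ico j l, ξ a ω‖}
      ⊆ ⋃ k ∈ Finset.range (N + 1), firstExit ξ (2 * c) k ∩ B k := by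
    rintro ω ⟨i, j, l, hij, hjl, hlN, h1, h2⟩
    let S : ℕ → E := fun k => ∑ a ∈ Finset.range k, ξ a ω
    have hS : ∀ a b, a ≤ b → ∑ e ∈ Finset.Ico a b, ξ e ω = S b - S a := fun a b hab =>
      Finset.sum_Ico_eq_sub _ hab
    rw [hS i j hij.le] at h1
    rw [hS j l hjl.le] at h2
    have htri : ∀ a b, ‖S b - S a‖ ≤ ‖S b‖ + ‖S a‖ := fun a b => norm_sub_le _ _
    have hex : ∃ k ≤ N, 2 * c < ‖∑ a ∈ Finset.range k, ξ a ω‖ := by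
      by_contra hno
      push Not at hno
      have := hno i (by omega)
      have := hno j (by omega)
      have := htri i j
      change ‖S i‖ ≤ _ at *
      linarith
    obtain ⟨k, hkN, hk⟩ := exists_mem_firstExit hex
    simp only [Set.mem_iUnion, Finset.mem_range]
    refine ⟨k, by omega, hk, ?_⟩
    by_contra hno
    simp only [B, Set.mem_ofPred_eq, not_exists, not_and, not_lt] at hno
    have hafter : ∀ b, k ≤ b → b ≤ N → ‖S b - S k‖ ≤ 2 * c := by
      intro b hkb hbN
      have := hno (b - k) (by omega)
      rw [← hS k b hkb, Finset.sum_Ico_eq_sum_range]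
      exact this
    -- Before the exit time k the walk stays within 2c of 0, afterwards (if `B k` fails) within 2c
    -- of its position at k. A move above 4c must therefore straddle k, and two successive intervals
    -- cannot both do so.
    have hpair : ∀ a b, a < b → b ≤ N → 4 * c < ‖S b - S a‖ → a < k ∧ k ≤ b := by
      intro a b hab hbN hbig
      constructor
      · by_contra hka
        have e1 := hafter a (by omega) (by omega)
        have e2 := hafter b (by omega) (by omega)
        have e3 := norm_sub_le (S b - S k) (S a - S k)
        rw [sub_sub_sub_cancel_right] at e3
        linarith
      · by_contra hkb
        have e1 : ‖S a‖ ≤ 2 * c := hk.1 a (by omega)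
        have e2 : ‖S b‖ ≤ 2 * c := hk.1 b (by omega)
        have := htri a b
        linarith
    have e1 := hpair i j hij (by omega) h1
    have e2 := hpair j l hjl hlN h2
    omega
  calc _ ≤ P.real (⋃ k ∈ Finset.range (N + 1), firstExit ξ (2 * c) k ∩ B k) :=
        measureReal_mono hcover (measure_ne_top _ _)
    _ ≤ ∑ k ∈ Finset.range (N + 1), P.real (firstExit ξ (2 * c) k ∩ B k) :=
        measureReal_biUnion_finset_le _ _
    _ ≤ ∑ k ∈ Finset.range (N + 1), P.real (firstExit ξ (2 * c) k) * (2 * α) := by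
        refine Finset.sum_le_sum fun k hk => ?_
        rw [iIndepFun.measureReal_inter_past_future hξ hind (measurableSet_firstExit (2 * c) k) (hB k)]
        have := hBP k (by have := Finset.mem_range.1 hk; omega)
        gcongr
    _ = P.real (⋃ k ∈ Finset.range (N + 1), firstExit ξ (2 * c) k) * (2 * α) := by
        rw [← Finset.sum_mul, measureReal_biUnion_finset
          (fun i _ j _ hij => pairwise_disjoint_firstExit (2 * c) hij) fun k _ => hmeas k]
    _ ≤ 2 * α * (2 * α) := by
        gcongr
        refine (measureReal_mono (?_ : _ ⊆ {ω | ∃ k ≤ N, 2 * c < ‖∑ i ∈ Finset.range k, ξ i ω‖})).trans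
          (iIndepFun.measureReal_exists_norm_sum_gt_le hξ hind hα fun k hk => h k N hk le_rfl)
        intro ω hω
        simp only [Set.mem_iUnion, Finset.mem_range] at hω
        obtain ⟨k, hk, hk'⟩ := hω
        exact ⟨k, by omega, hk'.2⟩
    _ = (2 * α) ^ 2 := by ring

end RandomWalk

/-! ### Tails of laws with exponent tψ -/

section Tail

variable {E : Type*} [NormedAddCommGroup E] [InnerProductSpace ℝ E] [FiniteDimensional ℝ E]
  [MeasurableSpace E] [BorelSpace E]

/-- Laws with characteristic function `exp (t ψ)` have tails of order `t`. -/
theorem exists_measureReal_norm_gt_le_mul {ψ : E → ℂ} (hψ : Continuous ψ)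
    (hre : ∀ y, (ψ y).re ≤ 0) {c : ℝ} (hc : 0 < c) :
    ∃ C : ℝ, 0 ≤ C ∧ ∀ (μ : Measure E) (t : ℝ), IsProbabilityMeasure μ → 0 ≤ t →
      (∀ y, charFun μ y = Complex.exp (t * ψ y)) → μ.real {x | c < ‖x‖} ≤ C * t := by
  have hn : (0 : ℝ) < Module.finrank ℝ E + 1 := by positivity
  set r : ℝ := c / (Module.finrank ℝ E + 1) with hr
  have hr0 : 0 < r := by positivity
  obtain ⟨M, hM⟩ := (isCompact_closedBall (0 : E) (2 * r⁻¹)).exists_bound_of_continuousOn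
    hψ.continuousOn
  have hM0 : 0 ≤ M := (norm_nonneg _).trans (hM 0 (by simp; positivity))
  -- Each basis direction contributes 2Mt: the factor r/2 times the length 4/r of the interval times
  -- the bound tM on |1 - μ̂|.
  refine ⟨Module.finrank ℝ E * (2 * M), by positivity, fun μ t hμ ht hchar => ?_⟩
  refine (measureReal_norm_gt_le_sum_integral_charFun μ hr0 ?_).trans ?_
  · rw [hr, div_mul_cancel₀ _ hn.ne']
  have hterm : ∀ i, 2⁻¹ * r *
      ‖∫ u in (-2 * r⁻¹)..(2 * r⁻¹), 1 - charFun μ (u • stdOrthonormalBasis ℝ E i)‖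
      ≤ 2 * M * t := by
    intro i
    have hle := intervalIntegral.norm_integral_le_of_norm_le_const (a := -2 * r⁻¹) (b := 2 * r⁻¹)
      (f := fun u => 1 - charFun μ (u • stdOrthonormalBasis ℝ E i)) (C := t * M) (fun u hu => by
        have hpos : 0 < r⁻¹ := by positivity
        rw [Set.uIoc_of_le (by linarith)] at hu
        have hu' : |u| ≤ 2 * r⁻¹ := abs_le.2 ⟨by linarith [hu.1], hu.2⟩
        rw [hchar, norm_sub_rev]
        refine (norm_exp_sub_one_le_of_re_nonpos ?_).trans ?_
        · rw [Complex.re_ofReal_mul]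
          exact mul_nonpos_of_nonneg_of_nonpos ht (hre _)
        · rw [norm_mul, Complex.norm_real, Real.norm_of_nonneg ht]
          gcongr
          refine hM _ ?_
          rw [mem_closedBall_zero_iff, norm_smul, (stdOrthonormalBasis ℝ E).norm_eq_one, mul_one]
          exact hu')
    have habs : |2 * r⁻¹ - -2 * r⁻¹| = 4 * r⁻¹ := by
      rw [show 2 * r⁻¹ - -2 * r⁻¹ = 4 * r⁻¹ by ring, abs_of_pos (by positivity)]
    rw [habs] at hle
    calc _ ≤ 2⁻¹ * r * (t * M * (4 * r⁻¹)) := by gcongr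
      _ = 2 * M * t * (r * r⁻¹) := by ring
      _ = 2 * M * t := by rw [mul_inv_cancel₀ hr0.ne', mul_one]
  refine (Finset.sum_le_sum fun i _ => hterm i).trans (le_of_eq ?_)
  simp
  ring

end Tail

/-! ### Independent increments of random walks -/

section RandomWalkIncrements

variable {Ω E : Type*} [MeasurableSpace Ω] {P : Measure Ω} [NormedAddCommGroup E]
  [MeasurableSpace E] [BorelSpace E] [SecondCountableTopology E] {ξ : ℕ → Ω → E}

/-- The random walk with independent steps has independent increments. -/
theorem iIndepFun.hasIndepIncrements_sum_range [IsProbabilityMeasure P]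
    (hξ : ∀ i, Measurable (ξ i)) (hind : iIndepFun ξ P) :
    HasIndepIncrements (fun n ω => ∑ i ∈ Finset.range n, ξ i ω) P := by
  refine HasIndepIncrements.of_nat fun a ha _ => ?_
  have hsum : (fun i ω => ∑ j ∈ Finset.range (a (i + 1)), ξ j ω
      - ∑ j ∈ Finset.range (a i), ξ j ω) = fun i ω => ∑ j ∈ Finset.Ico (a i) (a (i + 1)), ξ j ω := by
    ext i ω
    rw [Finset.sum_Ico_eq_sub _ (ha (Nat.le_succ i))]
  rw [hsum]
  rw [iIndepFun_iff_measure_inter_preimage_eq_mul]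
  intro s
  -- The last block uses only steps from `a m` on, all earlier blocks only steps before `a m`.
  induction s using Finset.induction_on_max with
  | empty => simp
  | insert m s hm ih =>
    intro sets hsets
    have hms : m ∉ s := fun h => lt_irrefl _ (hm m h)
    rw [Finset.set_biInter_insert, Finset.prod_insert hms, Set.inter_comm, mul_comm,
      ← ih fun i hi => hsets i (Finset.mem_insert_of_mem hi)]
    have h := indep_iSup_of_disjoint (fun i => (hξ i).comap_le) hind
      (Set.disjoint_left.2 (fun i hi hi' => not_lt.2 (Set.mem_Ici.1 hi') (Set.mem_Iio.1 hi)) :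
        Disjoint (Set.Iio (a m)) (Set.Ici (a m)))
    refine (Indep_iff _ _ _).1 h _ _ ?_ ?_
    · refine Finset.measurableSet_biInter s fun i hi => ?_
      refine measurable_iSup_comap_sum (fun j hj => ?_) (hsets i (Finset.mem_insert_of_mem hi))
      simp only [Finset.coe_Ico, Set.mem_Ico] at hj
      exact hj.2.trans_le (ha (hm i hi))
    · refine measurable_iSup_comap_sum (fun j hj => ?_) (hsets m (Finset.mem_insert_self m s))
      simp only [Finset.coe_Ico, Set.mem_Ico] at hj
      exact hj.1

end RandomWalkIncrements

/-! ### One-sided limits along the dyadic rationals -/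

section Regularisation

variable {E : Type*} [NormedAddCommGroup E] {F : ℝ≥0 → E}

/-- A function that makes no two successive large moves near a one-sided limit point converges. -/
theorem exists_tendsto_of_no_two_moves [CompleteSpace E] {l : Filter ℝ≥0}
    (hside : (∃ V ∈ l, ∀ x ∈ V, ∀ᶠ y in l, y < x) ∨ (∃ V ∈ l, ∀ x ∈ V, ∀ᶠ y in l, x < y))
    (h : ∀ ε > 0, ∃ U ∈ l, ∀ s ∈ U, ∀ t ∈ U, ∀ u ∈ U, s < t → t < u →
      dist (F s) (F t) ≤ ε ∨ dist (F t) (F u) ≤ ε) :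
    ∃ x, Tendsto F l (𝓝 x) := by
  rcases l.eq_or_neBot with rfl | hl
  · exact ⟨0, tendsto_bot⟩
  rw [← cauchy_map_iff_exists_tendsto, Metric.cauchy_iff]
  refine ⟨inferInstance, fun ε hε => ?_⟩
  obtain ⟨U, hU, hmoves⟩ := h (ε / 4) (by positivity)
  -- A large move from s to s' forces both F v and F v' to be within ε/4 of F s', so a later pair
  -- cannot be far apart.
  have hquad : ∀ s ∈ U, ∀ s' ∈ U, ∀ v ∈ U, ∀ v' ∈ U, s < s' → s' < v → v < v' →
      2 * (ε / 4) < dist (F s) (F s') → 2 * (ε / 4) < dist (F v) (F v') → False := by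
    intro s hs s' hs' v hv v' hv' h1 h2 h3 hd hd'
    have e1 := hmoves s hs s' hs' v hv h1 h2
    have e2 := hmoves s hs s' hs' v' hv' h1 (h2.trans h3)
    have e3 := dist_triangle_left (F v) (F v') (F s')
    rcases e1 with e1 | e1 <;> rcases e2 with e2 | e2 <;> linarith
  have hcauchy : ∃ V ∈ l, ∀ v ∈ V, ∀ v' ∈ V, dist (F v) (F v') ≤ 2 * (ε / 4) := by
    by_contra hno
    push Not at hno
    have hpair : ∀ V ∈ l, ∃ v ∈ V, ∃ v' ∈ V, v < v' ∧ 2 * (ε / 4) < dist (F v) (F v') := by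
      intro V hV
      obtain ⟨v, hv, v', hv', hd⟩ := hno V hV
      rcases lt_trichotomy v v' with hlt | heq | hgt
      · exact ⟨v, hv, v', hv', hlt, hd⟩
      · rw [heq, dist_self] at hd
        linarith
      · exact ⟨v', hv', v, hv, hgt, by rwa [dist_comm]⟩
    -- One-sidedness of the filter allows a second large pair wholly on one side of the first.
    rcases hside with ⟨V, hV, hlt⟩ | ⟨V, hV, hlt⟩
    · obtain ⟨v, hv, v', hv', hvv, hd⟩ := hpair (U ∩ V) (inter_mem hU hV)
      obtain ⟨s, hs, s', hs', hss, hd'⟩ := hpair (U ∩ {y | y < v}) (inter_mem hU (hlt v hv.2))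
      exact hquad s hs.1 s' hs'.1 v hv.1 v' hv'.1 hss hs'.2 hvv hd' hd
    · obtain ⟨s, hs, s', hs', hss, hd⟩ := hpair (U ∩ V) (inter_mem hU hV)
      obtain ⟨v, hv, v', hv', hvv, hd'⟩ := hpair (U ∩ {y | s' < y}) (inter_mem hU (hlt s' hs'.2))
      exact hquad s hs.1 s' hs'.1 v hv.1 v' hv'.1 hss hv.2 hvv hd hd'
  obtain ⟨V, hV, hd⟩ := hcauchy
  refine ⟨F '' V, image_mem_map hV, ?_⟩
  rintro _ ⟨v, hv, rfl⟩ _ ⟨v', hv', rfl⟩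
  linarith [hd v hv v' hv']

theorem eventually_lt_nhdsWithin_inter_Ioi {D : Set ℝ≥0} {t b : ℝ≥0} (hb : t < b) :
    ∀ᶠ q in 𝓝[D ∩ Set.Ioi t] t, q < b :=
  eventually_nhdsWithin_of_eventually_nhds (eventually_lt_nhds hb)

theorem eventually_gt_nhdsWithin_inter_Iio {D : Set ℝ≥0} {t b : ℝ≥0} (hb : b < t) :
    ∀ᶠ q in 𝓝[D ∩ Set.Iio t] t, b < q :=
  eventually_nhdsWithin_of_eventually_nhds (eventually_gt_nhds hb)

/-- The function of right limits along a set is right continuous. -/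
theorem continuousWithinAt_of_tendsto_right {D : Set ℝ≥0} {G : ℝ≥0 → E}
    (hD : ∀ t, (𝓝[D ∩ Set.Ioi t] t).NeBot)
    (hG : ∀ t, Tendsto F (𝓝[D ∩ Set.Ioi t] t) (𝓝 (G t))) (t : ℝ≥0) :
    ContinuousWithinAt G (Set.Ici t) t := by
  refine Metric.tendsto_nhds.2 fun ε hε => ?_
  have h1 := (Metric.tendsto_nhds.1 (hG t)) (ε / 2) (by positivity)
  obtain ⟨O, hO, htO, hsub⟩ := mem_nhdsWithin.1 h1
  obtain ⟨b, hb, hbO⟩ := exists_Ico_subset_of_mem_nhds (hO.mem_nhds htO) ⟨t + 1, by simp⟩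
  filter_upwards [inter_mem_nhdsWithin _ (Iio_mem_nhds hb)] with u hu
  have hle : dist (G u) (G t) ≤ ε / 2 := by
    refine le_of_tendsto ((hG u).dist tendsto_const_nhds) ?_
    filter_upwards [eventually_lt_nhdsWithin_inter_Ioi (D := D) (show u < b from hu.2),
      self_mem_nhdsWithin] with q hq hqD
    have htq : t < q := lt_of_le_of_lt hu.1 hqD.2
    exact le_of_lt (hsub ⟨hbO ⟨htq.le, hq⟩, hqD.1, htq⟩)
  linarith

/-- The function of right limits along a set inherits left limits. -/
theorem tendsto_left_of_tendsto_right {D : Set ℝ≥0} {G : ℝ≥0 → E} {x : E} {t : ℝ≥0}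
    (hD : ∀ t, (𝓝[D ∩ Set.Ioi t] t).NeBot)
    (hG : ∀ t, Tendsto F (𝓝[D ∩ Set.Ioi t] t) (𝓝 (G t)))
    (hx : Tendsto F (𝓝[D ∩ Set.Iio t] t) (𝓝 x)) :
    Tendsto G (𝓝[<] t) (𝓝 x) := by
  rcases eq_or_ne t 0 with rfl | ht
  · have : Set.Iio (0 : ℝ≥0) = ∅ := by
      ext
      simp
    rw [this, nhdsWithin_empty]
    exact tendsto_bot
  refine Metric.tendsto_nhds.2 fun ε hε => ?_
  have h1 := (Metric.tendsto_nhds.1 hx) (ε / 2) (by positivity)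
  obtain ⟨O, hO, htO, hsub⟩ := mem_nhdsWithin.1 h1
  obtain ⟨b, hb, hbO⟩ := exists_Ioc_subset_of_mem_nhds (hO.mem_nhds htO)
    ⟨0, pos_iff_ne_zero.2 ht⟩
  filter_upwards [inter_mem_nhdsWithin _ (Ioi_mem_nhds hb)] with u hu
  have hle : dist (G u) x ≤ ε / 2 := by
    refine le_of_tendsto ((hG u).dist tendsto_const_nhds) ?_
    filter_upwards [eventually_lt_nhdsWithin_inter_Ioi (D := D) (show u < t from hu.1),
      self_mem_nhdsWithin] with q hq hqD
    have hbq : b < q := lt_trans hu.2 hqD.2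
    exact le_of_lt (hsub ⟨hbO ⟨hbq, hq.le⟩, hqD.1, hq⟩)
  linarith

/-- The dyadic rationals in `[0, ∞)`. -/
def dyadics : Set ℝ≥0 := {t | ∃ n k : ℕ, t = k / 2 ^ n}

/-- The least multiple of `2⁻ⁿ` that is strictly larger than `t`. -/
noncomputable def nextDyadic (n : ℕ) (t : ℝ≥0) : ℝ≥0 := ((⌊2 ^ n * t⌋₊ + 1 : ℕ) : ℝ≥0) / 2 ^ n

theorem nextDyadic_mem (n : ℕ) (t : ℝ≥0) : nextDyadic n t ∈ dyadics := ⟨n, _, rfl⟩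

theorem lt_nextDyadic (n : ℕ) (t : ℝ≥0) : t < nextDyadic n t := by
  rw [nextDyadic, lt_div_iff₀ (by positivity), mul_comm]
  exact_mod_cast Nat.lt_floor_add_one _

theorem nextDyadic_le (n : ℕ) (t : ℝ≥0) : nextDyadic n t ≤ t + (1 / 2) ^ n := by
  rw [nextDyadic, div_le_iff₀ (by positivity), add_mul, ← mul_pow]
  have := Nat.floor_le (show 0 ≤ 2 ^ n * t by positivity)
  push_cast
  rw [mul_comm t]
  norm_num
  exact this

theorem tendsto_nextDyadic (t : ℝ≥0) :
    Tendsto (fun n => nextDyadic n t) atTop (𝓝[dyadics ∩ Set.Ioi t] t) := by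
  refine tendsto_nhdsWithin_iff.2 ⟨?_, Eventually.of_forall fun n =>
    ⟨nextDyadic_mem n t, lt_nextDyadic n t⟩⟩
  have h : Tendsto (fun n : ℕ => t + (1 / 2 : ℝ≥0) ^ n) atTop (𝓝 (t + 0)) := by
    refine tendsto_const_nhds.add (NNReal.tendsto_pow_atTop_nhds_zero_of_lt_one ?_)
    rw [← NNReal.coe_lt_coe]
    norm_num
  rw [add_zero] at h
  exact tendsto_of_tendsto_of_tendsto_of_le_of_le tendsto_const_nhds h
    (fun n => (lt_nextDyadic n t).le) fun n => nextDyadic_le n t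

instance neBot_nhdsWithin_dyadics (t : ℝ≥0) : (𝓝[dyadics ∩ Set.Ioi t] t).NeBot :=
  (tendsto_nextDyadic t).neBot

theorem exists_eq_div_of_le {n N k : ℕ} (h : n ≤ N) :
    ((k : ℝ≥0) / 2 ^ n) = ((k * 2 ^ (N - n) : ℕ) : ℝ≥0) / 2 ^ N := by
  obtain ⟨m, rfl⟩ := Nat.exists_eq_add_of_le h
  rw [Nat.add_sub_cancel_left, pow_add]
  push_cast
  field_simp

/-- `F` makes no two successive moves larger than `ε` inside the dyadic window `k` of size
`2⁻ᵐ`. -/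
def NoTwoMoves (F : ℝ≥0 → E) (ε : ℝ) (m k : ℕ) : Prop :=
  ∀ s ∈ dyadics, ∀ t ∈ dyadics, ∀ u ∈ dyadics, (k : ℝ≥0) / 2 ^ m ≤ s → s < t → t < u →
    u ≤ ((k + 1 : ℕ) : ℝ≥0) / 2 ^ m → dist (F s) (F t) ≤ ε ∨ dist (F t) (F u) ≤ ε

theorem exists_tendsto_right_of_noTwoMoves [CompleteSpace E]
    (h : ∀ ε > 0, ∀ T : ℕ, ∃ m, ∀ k ≤ T * 2 ^ m, NoTwoMoves F ε m k) (t : ℝ≥0) :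
    ∃ x, Tendsto F (𝓝[dyadics ∩ Set.Ioi t] t) (𝓝 x) := by
  refine exists_tendsto_of_no_two_moves (.inl ⟨_, self_mem_nhdsWithin, fun x hx =>
    eventually_lt_nhdsWithin_inter_Ioi hx.2⟩) fun ε hε => ?_
  -- The horizon ⌊t⌋ + 1 exceeds t, so the window starting at or just before t is among those
  -- controlled.
  obtain ⟨m, hm⟩ := h ε hε (⌊t⌋₊ + 1)
  have hpos : (0 : ℝ≥0) < 2 ^ m := by positivity
  have hfl : (⌊2 ^ m * t⌋₊ : ℝ≥0) / 2 ^ m ≤ t := by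
    rw [div_le_iff₀ hpos, mul_comm t]
    exact Nat.floor_le (by positivity)
  have hk : ⌊2 ^ m * t⌋₊ ≤ (⌊t⌋₊ + 1) * 2 ^ m := by
    refine Nat.floor_le_of_le ?_
    push_cast
    rw [mul_comm]
    gcongr
    exact (Nat.lt_floor_add_one t).le
  have hno := hm _ hk
  refine ⟨(dyadics ∩ Set.Ioi t) ∩ {q | q < nextDyadic m t}, inter_mem self_mem_nhdsWithin
    (eventually_lt_nhdsWithin_inter_Ioi (lt_nextDyadic m t)), fun s hs v hv u hu hsv hvu => ?_⟩
  exact hno s hs.1.1 v hv.1.1 u hu.1.1 (hfl.trans (le_of_lt hs.1.2)) hsv hvu (le_of_lt hu.2)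

theorem exists_tendsto_left_of_noTwoMoves [CompleteSpace E]
    (h : ∀ ε > 0, ∀ T : ℕ, ∃ m, ∀ k ≤ T * 2 ^ m, NoTwoMoves F ε m k) (t : ℝ≥0) :
    ∃ x, Tendsto F (𝓝[dyadics ∩ Set.Iio t] t) (𝓝 x) := by
  rcases eq_or_ne t 0 with rfl | ht
  · refine ⟨0, ?_⟩
    have : dyadics ∩ Set.Iio (0 : ℝ≥0) = ∅ := by
      ext
      simp
    rw [this, nhdsWithin_empty]
    exact tendsto_bot
  refine exists_tendsto_of_no_two_moves (.inr ⟨_, self_mem_nhdsWithin, fun x hx =>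
    eventually_gt_nhdsWithin_inter_Iio hx.2⟩) fun ε hε => ?_
  obtain ⟨m, hm⟩ := h ε hε (⌊t⌋₊ + 1)
  have hpos : (0 : ℝ≥0) < 2 ^ m := by positivity
  have ht0 : 0 < t := pos_iff_ne_zero.2 ht
  -- The index is the ceiling minus one, not the floor: the window must extend to the left of t even
  -- when t is itself a grid point.
  have hceil : ⌈2 ^ m * t⌉₊ ≠ 0 := (Nat.ceil_pos.2 (by positivity)).ne'
  obtain ⟨k, hk⟩ := Nat.exists_eq_succ_of_ne_zero hceil
  have hkt : (k : ℝ≥0) / 2 ^ m < t := by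
    rw [div_lt_iff₀ hpos, mul_comm t]
    exact Nat.lt_ceil.1 (by omega)
  have htk : t ≤ ((k + 1 : ℕ) : ℝ≥0) / 2 ^ m := by
    rw [le_div_iff₀ hpos, mul_comm t]
    refine (Nat.le_ceil _).trans ?_
    rw [hk]
  have hkT : k ≤ (⌊t⌋₊ + 1) * 2 ^ m := by
    have h1 : (k : ℝ≥0) ≤ ((⌊t⌋₊ + 1) * 2 ^ m : ℕ) := by
      rw [div_lt_iff₀ hpos] at hkt
      refine hkt.le.trans ?_
      push_cast
      gcongr
      exact (Nat.lt_floor_add_one t).le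
    exact_mod_cast h1
  have hno := hm k hkT
  refine ⟨(dyadics ∩ Set.Iio t) ∩ {q | (k : ℝ≥0) / 2 ^ m < q}, inter_mem self_mem_nhdsWithin
    (eventually_gt_nhdsWithin_inter_Iio hkt), fun s hs v hv u hu hsv hvu => ?_⟩
  exact hno s hs.1.1 v hv.1.1 u hu.1.1 (le_of_lt hs.2) hsv hvu ((le_of_lt hu.1.2).trans htk)

end Regularisation

/-! ### Arrays of dyadic increments -/

section DyadicScheme

variable {E : Type*} [NormedAddCommGroup E] [InnerProductSpace ℝ E] [FiniteDimensional ℝ E]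
  [MeasurableSpace E] [BorelSpace E] {ν : Measure E} {ψ : E → ℂ}

/-- Increments at level `n + 1` add up to the increments at level `n`. -/
def DyadicConsistent (ω : ℕ → ℕ → E) : Prop :=
  ∀ n i, ω n i = ω (n + 1) (2 * i) + ω (n + 1) (2 * i + 1)

/-- `P` is a law of dyadic increment arrays with exponent `ψ`. -/
structure IsDyadicScheme (P : Measure (ℕ → ℕ → E)) (ψ : E → ℂ) : Prop where
  isProbabilityMeasure : IsProbabilityMeasure P
  iIndepFun : ∀ n, iIndepFun (fun i (ω : ℕ → ℕ → E) => ω n i) P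
  charFun_eq : ∀ n i y, charFun (P.map fun ω => ω n i) y = Complex.exp (ψ y / ((2 ^ n : ℕ) : ℂ))
  consistent : ∀ᵐ ω ∂P, DyadicConsistent ω

/-- Level n consists of independent copies of a convolution root of order 2^n. Two halves of level n
+ 1 sum to the law of level n because the root's characteristic function is determined by ψ, so the
levels form an inverse system. -/
theorem IsInfinitelyDivisible.exists_isDyadicScheme (hν : IsInfinitelyDivisible ν)
    (hψ : IsCharExponent ν ψ) : ∃ P, IsDyadicScheme P ψ := by
  have hroot : ∀ n : ℕ, ∃ ρ : Measure E, IsProbabilityMeasure ρ ∧ convPow ρ (2 ^ n) = ν :=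
    fun n => hν.2 _ Nat.one_le_two_pow
  choose ρ hρ hρν using hroot
  have hchar : ∀ n y, charFun (ρ n) y = Complex.exp (ψ y / ((2 ^ n : ℕ) : ℂ)) := fun n y =>
    hψ.charFun_of_convPow_eq (by positivity) (hρν n) y
  let π : ℕ → Measure (ℕ → E) := fun n => Measure.infinitePi fun _ => ρ n
  let T : (ℕ → E) → ℕ → E := fun x i => x (2 * i) + x (2 * i + 1)
  have hT : Measurable T := by
    refine measurable_pi_iff.2 fun i => ?_
    fun_prop
  have hcoord : ∀ n, ProbabilityTheory.iIndepFun (fun i (x : ℕ → E) => x i) (π n) := fun n =>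
    iIndepFun_infinitePi (X := fun _ x => x) (fun _ => measurable_id)
  have hπ : ∀ n, (π (n + 1)).map T = π n := by
    intro n
    have h1 := (_root_.iIndepFun.hasIndepIncrements_sum_range (fun i => measurable_pi_apply i)
      (hcoord (n + 1))).nat (t := fun k => 2 * k) (fun a b hab => by dsimp only; omega)
    have h2 : (fun (i : ℕ) (x : ℕ → E) => ∑ j ∈ Finset.range (2 * (i + 1)), x j
        - ∑ j ∈ Finset.range (2 * i), x j) = fun i x => T x i := by
      ext i x
      rw [show 2 * (i + 1) = 2 * i + 1 + 1 by ring, Finset.sum_range_succ, Finset.sum_range_succ]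
      simp only [T]
      abel
    rw [h2] at h1
    have hTi : ∀ i, Measurable fun x => T x i := fun i => (measurable_pi_apply i).comp hT
    have h3 := h1.map_fun_eq_infinitePi_map hTi
    have h4 : ∀ i, (π (n + 1)).map (fun x => T x i) = ρ n := by
      intro i
      have : IsProbabilityMeasure ((π (n + 1)).map (fun x => T x i)) :=
        Measure.isProbabilityMeasure_map (by fun_prop)
      refine Measure.ext_of_charFun ?_
      have hind : IndepFun (fun x : ℕ → E => x (2 * i)) (fun x => x (2 * i + 1)) (π (n + 1)) :=
        (hcoord (n + 1)).indepFun (by omega)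
      have hm : ∀ j, AEMeasurable (fun x : ℕ → E => x j) (π (n + 1)) := fun j =>
        (measurable_pi_apply j).aemeasurable
      have h5 := hind.charFun_map_fun_add_eq_mul (hm _) (hm _)
      ext y
      simp only [T]
      rw [h5, Pi.mul_apply, Measure.infinitePi_map_eval, Measure.infinitePi_map_eval, hchar, hchar,
        ← Complex.exp_add]
      congr 1
      push_cast
      field_simp
      ring
    change (π (n + 1)).map (fun x i => T x i) = π n
    rw [h3]
    simp_rw [h4]
    rfl
  obtain ⟨P, hP, hmarg, hcons⟩ := exists_measure_inverseLimit π hT hπ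
  refine ⟨P, hP, fun n => ?_, fun n i y => ?_, ?_⟩
  · rw [iIndepFun_iff_map_fun_eq_infinitePi_map (by fun_prop)]
    have h1 : ∀ i, P.map (fun ω : ℕ → ℕ → E => ω n i) = ρ n := by
      intro i
      have := Measure.map_map (μ := P) (g := fun x : ℕ → E => x i) (f := fun ω : ℕ → ℕ → E => ω n)
        (by fun_prop) (by fun_prop)
      rw [hmarg, Measure.infinitePi_map_eval] at this
      exact this.symm
    simp_rw [h1]
    exact hmarg n
  · have := Measure.map_map (μ := P) (g := fun x : ℕ → E => x i) (f := fun ω : ℕ → ℕ → E => ω n)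
      (by fun_prop) (by fun_prop)
    rw [hmarg, Measure.infinitePi_map_eval] at this
    rw [← hchar, this]
    rfl
  · filter_upwards [hcons] with ω hω n i
    exact congrFun (hω n) i

theorem DyadicConsistent.sum_range_succ_level {ω : ℕ → ℕ → E} (h : DyadicConsistent ω) (n k : ℕ) :
    ∑ i ∈ Finset.range k, ω n i = ∑ i ∈ Finset.range (k * 2), ω (n + 1) i := by
  induction k with
  | zero => simp
  | succ k ih =>
    rw [Finset.sum_range_succ, ih, show (k + 1) * 2 = k * 2 + 1 + 1 by ring,
      Finset.sum_range_succ, Finset.sum_range_succ, h n k, mul_comm 2 k, add_assoc]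

theorem DyadicConsistent.sum_range_level {ω : ℕ → ℕ → E} (h : DyadicConsistent ω) (n m k : ℕ) :
    ∑ i ∈ Finset.range k, ω n i = ∑ i ∈ Finset.range (k * 2 ^ m), ω (n + m) i := by
  induction m with
  | zero => simp
  | succ m ih =>
    rw [ih, h.sum_range_succ_level, pow_succ, ← mul_assoc]
    rfl

open Classical in
/-- The process at dyadic times that is built from an array of increments. -/
noncomputable def dyadicValue (ω : ℕ → ℕ → E) (t : ℝ≥0) : E :=
  if h : ∃ p : ℕ × ℕ, t = p.2 / 2 ^ p.1 then
    ∑ i ∈ Finset.range h.choose.2, ω h.choose.1 i else 0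

theorem measurable_dyadicValue (t : ℝ≥0) :
    Measurable fun ω : ℕ → ℕ → E => dyadicValue ω t := by
  unfold dyadicValue
  split_ifs
  · fun_prop
  · fun_prop

/-- The chosen representation of a dyadic number is immaterial: any two can be refined to a common
level, where consistency makes the sums agree. -/
theorem DyadicConsistent.dyadicValue_eq {ω : ℕ → ℕ → E} (h : DyadicConsistent ω) (n k : ℕ) :
    dyadicValue ω ((k : ℝ≥0) / 2 ^ n) = ∑ i ∈ Finset.range k, ω n i := by
  have hex : ∃ p : ℕ × ℕ, (k : ℝ≥0) / 2 ^ n = p.2 / 2 ^ p.1 := ⟨(n, k), rfl⟩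
  unfold dyadicValue
  rw [dif_pos hex]
  have hspec := hex.choose_spec
  set p := hex.choose
  have heq : p.2 * 2 ^ n = k * 2 ^ p.1 := by
    rw [div_eq_div_iff (by positivity) (by positivity)] at hspec
    exact_mod_cast hspec.symm
  rw [h.sum_range_level p.1 n p.2, h.sum_range_level n p.1 k, heq, add_comm]

theorem DyadicConsistent.dyadicValue_sub {ω : ℕ → ℕ → E} (h : DyadicConsistent ω) {n a b : ℕ}
    (hab : a ≤ b) : dyadicValue ω ((b : ℝ≥0) / 2 ^ n) - dyadicValue ω ((a : ℝ≥0) / 2 ^ n)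
      = ∑ i ∈ Finset.Ico a b, ω n i := by
  rw [h.dyadicValue_eq, h.dyadicValue_eq, Finset.sum_Ico_eq_sub _ hab]

namespace IsDyadicScheme

variable {P : Measure (ℕ → ℕ → E)}

theorem charFun_sum_Ico (hP : IsDyadicScheme P ψ) (n : ℕ) {a b : ℕ} (hab : a ≤ b) (y : E) :
    charFun (P.map fun ω => ∑ i ∈ Finset.Ico a b, ω n i) y
      = Complex.exp ((((b : ℝ) - a) / 2 ^ n : ℝ) * ψ y) := by
  have := hP.isProbabilityMeasure
  have hm : ∀ i ∈ Finset.Ico a b, AEMeasurable (fun ω : ℕ → ℕ → E => ω n i) P := fun i _ =>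
    ((measurable_pi_apply i).comp (measurable_pi_apply n)).aemeasurable
  have h := ((hP.iIndepFun n).restrict (Finset.Ico a b)).charFun_map_fun_finsetSum_eq_prod hm
  rw [h, Finset.prod_apply]
  simp_rw [hP.charFun_eq]
  rw [Finset.prod_const, ← Complex.exp_nat_mul, Nat.card_Ico, Nat.cast_sub hab]
  congr 1
  push_cast
  ring

theorem measure_not_noTwoMoves_le (hP : IsDyadicScheme P ψ) {ε C : ℝ}
    (hC : ∀ (μ : Measure E) (t : ℝ), IsProbabilityMeasure μ → 0 ≤ t →
      (∀ y, charFun μ y = Complex.exp (t * ψ y)) → μ.real {x | ε / 4 < ‖x‖} ≤ C * t)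
    (hC0 : 0 ≤ C) {m : ℕ} (hm : C * (1 / 2) ^ m ≤ 1 / 2) (k : ℕ) :
    P {ω : ℕ → ℕ → E | DyadicConsistent ω ∧ ¬ NoTwoMoves (dyadicValue ω) ε m k}
      ≤ ENNReal.ofReal ((2 * (C * (1 / 2) ^ m)) ^ 2) := by
  have := hP.isProbabilityMeasure
  -- `B n` records two large moves visible on the grid of level m + n. These events increase with n,
  -- so a bound uniform in n passes to the union.
  let B : ℕ → Set (ℕ → ℕ → E) := fun n => {ω : ℕ → ℕ → E | DyadicConsistent ω ∧ ∃ a b c : ℕ, k * 2 ^ n ≤ a ∧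
    a < b ∧ b < c ∧ c ≤ (k + 1) * 2 ^ n ∧ ε < ‖∑ i ∈ Finset.Ico a b, ω (m + n) i‖ ∧
    ε < ‖∑ i ∈ Finset.Ico b c, ω (m + n) i‖}
  have hBmono : Monotone B := by
    refine monotone_nat_of_le_succ fun n => ?_
    rintro ω ⟨hω, a, b, c, h1, h2, h3, h4, h5, h6⟩
    have hlev : ∀ p q, p < q → ∑ i ∈ Finset.Ico p q, ω (m + n) i
        = ∑ i ∈ Finset.Ico (p * 2) (q * 2), ω (m + (n + 1)) i := by
      intro p q hpq
      rw [Finset.sum_Ico_eq_sub _ hpq.le, Finset.sum_Ico_eq_sub _ (by omega),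
        hω.sum_range_succ_level _ p, hω.sum_range_succ_level _ q]
      rfl
    refine ⟨hω, a * 2, b * 2, c * 2, ?_, by omega, by omega, ?_, ?_, ?_⟩
    · rw [pow_succ, ← mul_assoc]
      omega
    · rw [pow_succ, ← mul_assoc]
      omega
    · rwa [← hlev a b h2]
    · rwa [← hlev b c h3]
  have hsub : {ω : ℕ → ℕ → E | DyadicConsistent ω ∧ ¬ NoTwoMoves (dyadicValue ω) ε m k} ⊆ ⋃ n, B n := by
    rintro ω ⟨hω, hno⟩
    unfold NoTwoMoves at hno
    push Not at hno
    obtain ⟨s, ⟨n₁, a, rfl⟩, t, ⟨n₂, b, rfl⟩, u, ⟨n₃, c, rfl⟩, h1, h2, h3, h4, h5, h6⟩ := hno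
    obtain ⟨n, hn1, hn2, hn3⟩ : ∃ n, n₁ ≤ m + n ∧ n₂ ≤ m + n ∧ n₃ ≤ m + n :=
      ⟨n₁ + n₂ + n₃, by omega, by omega, by omega⟩
    rw [exists_eq_div_of_le hn1] at h1 h2 h5
    rw [exists_eq_div_of_le hn2] at h2 h3 h5 h6
    rw [exists_eq_div_of_le hn3] at h3 h4 h6
    rw [exists_eq_div_of_le (Nat.le_add_right m n)] at h1 h4
    have hp : (0 : ℝ≥0) < 2 ^ (m + n) := by positivity
    rw [div_le_div_iff_of_pos_right hp, Nat.cast_le] at h1 h4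
    rw [div_lt_div_iff_of_pos_right hp, Nat.cast_lt] at h2 h3
    rw [Nat.add_sub_cancel_left] at h1 h4
    rw [dist_comm, dist_eq_norm, hω.dyadicValue_sub h2.le] at h5
    rw [dist_comm, dist_eq_norm, hω.dyadicValue_sub h3.le] at h6
    exact Set.mem_iUnion.2 ⟨n, hω, _, _, _, h1, h2, h3, h4, h5, h6⟩
  refine (measure_mono hsub).trans ?_
  rw [hBmono.measure_iUnion]
  refine iSup_le fun n => ?_
  have htwo : (2 : ℝ) ^ (m + n) = 2 ^ m * 2 ^ n := pow_add _ _ _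
  -- The window is a walk of 2^n steps, and any of its increments spans time at most 2^{-m}, so the
  -- tail bound is C 2^{-m} for every n.
  have hmain := iIndepFun.measureReal_exists_two_moves_le (P := P) (N := 2 ^ n) (c := ε / 4)
    (ξ := fun i (ω : ℕ → ℕ → E) => ω (m + n) (k * 2 ^ n + i)) (fun i => by fun_prop)
    ((hP.iIndepFun (m + n)).precomp (add_right_injective (k * 2 ^ n))) hm (by
      intro p q hpq hqN
      have hshift : (fun ω : ℕ → ℕ → E => ∑ i ∈ Finset.Ico p q, ω (m + n) (k * 2 ^ n + i))
          = fun ω => ∑ i ∈ Finset.Ico (k * 2 ^ n + p) (k * 2 ^ n + q), ω (m + n) i := by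
        ext ω
        rw [Finset.sum_Ico_eq_sum_range, Finset.sum_Ico_eq_sum_range, Nat.add_sub_add_left]
        simp only [add_assoc]
      have hmeas : Measurable fun ω : ℕ → ℕ → E =>
          ∑ i ∈ Finset.Ico (k * 2 ^ n + p) (k * 2 ^ n + q), ω (m + n) i := by fun_prop
      have hb := hC (P.map fun ω => ∑ i ∈ Finset.Ico (k * 2 ^ n + p) (k * 2 ^ n + q), ω (m + n) i)
        ((((k * 2 ^ n + q : ℕ) : ℝ) - (k * 2 ^ n + p : ℕ)) / 2 ^ (m + n))
        (Measure.isProbabilityMeasure_map hmeas.aemeasurable)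
        (div_nonneg (sub_nonneg.2 (by exact_mod_cast Nat.add_le_add_left hpq _)) (by positivity))
        (fun y => hP.charFun_sum_Ico (m + n) (Nat.add_le_add_left hpq _) y)
      rw [map_measureReal_apply hmeas (measurableSet_lt measurable_const measurable_norm),
        ← hshift] at hb
      refine hb.trans ?_
      gcongr
      rw [div_le_iff₀ (by positivity), htwo, ← mul_assoc, ← mul_pow]
      have h1 : (q : ℝ) ≤ 2 ^ n := by exact_mod_cast hqN
      have h2 : (0 : ℝ) ≤ p := Nat.cast_nonneg p
      push_cast
      norm_num
      linarith)
  rw [← ofReal_measureReal (measure_ne_top _ _)]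
  refine ENNReal.ofReal_le_ofReal (le_trans (measureReal_mono ?_ (measure_ne_top _ _)) hmain)
  rintro ω ⟨-, a, b, c, h1, h2, h3, h4, h5, h6⟩
  have hshift : ∀ p q, k * 2 ^ n ≤ p → p ≤ q → ∑ i ∈ Finset.Ico p q, ω (m + n) i
      = ∑ i ∈ Finset.Ico (p - k * 2 ^ n) (q - k * 2 ^ n), ω (m + n) (k * 2 ^ n + i) := by
    intro p q hp hpq
    rw [Finset.sum_Ico_eq_sum_range, Finset.sum_Ico_eq_sum_range,
      show q - k * 2 ^ n - (p - k * 2 ^ n) = q - p by omega]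
    refine Finset.sum_congr rfl fun i _ => ?_
    congr 1
    omega
  rw [add_mul, one_mul] at h4
  refine ⟨a - k * 2 ^ n, b - k * 2 ^ n, c - k * 2 ^ n, by omega, by omega, by omega, ?_, ?_⟩
  · rw [← hshift a b h1 h2.le]
    linarith
  · rw [← hshift b c (by omega) h3.le]
    linarith

/-- There are of order 2^m windows up to T, each bad with probability of order 4^{-m}, so the total
vanishes as m grows. The square gained from two moves is essential: a single large move has total
probability of order 1. -/
theorem ae_forall_noTwoMoves (hP : IsDyadicScheme P ψ) (hψ : Continuous ψ)
    (hre : ∀ y, (ψ y).re ≤ 0) :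
    ∀ᵐ ω ∂P, ∀ ε > 0, ∀ T : ℕ, ∃ m, ∀ k ≤ T * 2 ^ m, NoTwoMoves (E := E) (dyadicValue ω) ε m k := by
  -- The scales 1 / (j + 1) suffice and leave only countably many null sets.
  have hfix : ∀ j T : ℕ, ∀ᵐ ω ∂P, ∃ m, ∀ k ≤ T * 2 ^ m,
      NoTwoMoves (dyadicValue ω) (1 / ((j : ℝ) + 1)) m k := by
    intro j T
    set ε : ℝ := 1 / ((j : ℝ) + 1)
    have hε : 0 < ε := by positivity
    obtain ⟨C, hC0, hC⟩ := exists_measureReal_norm_gt_le_mul (E := E) hψ hre (show 0 < ε / 4 by positivity)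
    have hhalf : Tendsto (fun m : ℕ => (1 / 2 : ℝ) ^ m) atTop (𝓝 0) :=
      tendsto_pow_atTop_nhds_zero_of_lt_one (by norm_num) (by norm_num)
    have hzero : P {ω : ℕ → ℕ → E | DyadicConsistent ω ∧ ¬ ∃ m, ∀ k ≤ T * 2 ^ m,
        NoTwoMoves (dyadicValue ω) ε m k} = 0 := by
      have hlim : Tendsto (fun m : ℕ => ENNReal.ofReal (4 * C ^ 2 * (T + 1) * (1 / 2) ^ m)) atTop
          (𝓝 0) := by
        have := ENNReal.tendsto_ofReal (hhalf.const_mul (4 * C ^ 2 * (T + 1)))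
        rwa [mul_zero, ENNReal.ofReal_zero] at this
      have hsmall : ∀ᶠ m : ℕ in atTop, C * (1 / 2) ^ m ≤ 1 / 2 := by
        have := hhalf.const_mul C
        rw [mul_zero] at this
        exact (this.eventually (gt_mem_nhds (by norm_num : (0 : ℝ) < 1 / 2))).mono fun m h => h.le
      refine le_antisymm (ge_of_tendsto hlim ?_) zero_le
      filter_upwards [hsmall] with m hm
      have hsub : {ω : ℕ → ℕ → E | DyadicConsistent ω ∧ ¬ ∃ m, ∀ k ≤ T * 2 ^ m,
          NoTwoMoves (dyadicValue ω) ε m k} ⊆ ⋃ k ∈ Finset.range (T * 2 ^ m + 1),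
          {ω : ℕ → ℕ → E | DyadicConsistent ω ∧ ¬ NoTwoMoves (dyadicValue ω) ε m k} := by
        rintro ω ⟨hω, hno⟩
        push Not at hno
        obtain ⟨k, hk, hk'⟩ := hno m
        simp only [Set.mem_iUnion, Finset.mem_range]
        exact ⟨k, by omega, hω, hk'⟩
      refine (measure_mono hsub).trans ((measure_biUnion_finset_le _ _).trans ?_)
      refine (Finset.sum_le_sum fun k _ => hP.measure_not_noTwoMoves_le hC hC0 hm k).trans ?_
      rw [Finset.sum_const, Finset.card_range, ← ENNReal.ofReal_nsmul]
      refine ENNReal.ofReal_le_ofReal ?_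
      rw [nsmul_eq_mul]
      have h1 : ((T * 2 ^ m + 1 : ℕ) : ℝ) ≤ (T + 1) * 2 ^ m := by
        push_cast
        have : (1 : ℝ) ≤ 2 ^ m := one_le_pow₀ (by norm_num)
        linarith
      calc _ ≤ ((T + 1) * 2 ^ m) * (2 * (C * (1 / 2) ^ m)) ^ 2 := by gcongr
        _ = 4 * C ^ 2 * (T + 1) * (1 / 2) ^ m * (2 ^ m * (1 / 2) ^ m) := by ring
        _ = 4 * C ^ 2 * (T + 1) * (1 / 2) ^ m := by
            rw [← mul_pow]
            norm_num
    have hae := measure_eq_zero_iff_ae_notMem.1 hzero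
    filter_upwards [hae, hP.consistent] with ω h1 h2
    by_contra hno
    exact h1 ⟨h2, hno⟩
  have hall := ae_all_iff.2 fun j => ae_all_iff.2 fun T => hfix j T
  filter_upwards [hall] with ω hω ε hε T
  obtain ⟨j, hj⟩ := exists_nat_one_div_lt hε
  obtain ⟨m, hm⟩ := hω j T
  refine ⟨m, fun k hk s hs t ht u hu h1 h2 h3 h4 => ?_⟩
  rcases hm k hk s hs t ht u hu h1 h2 h3 h4 with h | h
  · exact .inl (h.trans hj.le)
  · exact .inr (h.trans hj.le)

end IsDyadicScheme

end DyadicScheme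

/-! ### Existence of Lévy processes -/

section LevyExistence

/-- Independence is preserved under almost sure limits. -/
theorem iIndepFun_of_tendsto_ae {E Ω ι : Type*} [NormedAddCommGroup E] [InnerProductSpace ℝ E]
    [FiniteDimensional ℝ E] [MeasurableSpace E] [BorelSpace E] [MeasurableSpace Ω] {P : Measure Ω}
    [IsProbabilityMeasure P] [Fintype ι] {X : ℕ → ι → Ω → E} {Z : ι → Ω → E}
    (hX : ∀ n i, AEMeasurable (X n i) P) (hZ : ∀ i, AEMeasurable (Z i) P)
    (hind : ∀ n, iIndepFun (X n) P)
    (hlim : ∀ i, ∀ᵐ ω ∂P, Tendsto (fun n => X n i ω) atTop (𝓝 (Z i ω))) : iIndepFun Z P := by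
  rw [iIndepFun_iff_charFun_pi hZ]
  intro y
  have hmeas : ∀ W : ι → Ω → E, (∀ i, AEMeasurable (W i) P) →
      AEMeasurable (fun ω => WithLp.toLp 2 fun i => W i ω) P := by
    intro W hW
    exact (WithLp.measurable_toLp 2 _).comp_aemeasurable (aemeasurable_pi_iff.2 hW)
  have h1 := tendsto_charFun_map (P := P) (l := atTop)
    (X := fun n ω => WithLp.toLp 2 fun i => X n i ω)
    (Z := fun ω => WithLp.toLp 2 fun i => Z i ω) (fun n => hmeas _ (hX n)) (hmeas _ hZ) (by
      filter_upwards [ae_all_iff.2 hlim] with ω hω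
      exact ((PiLp.continuous_toLp 2 _).tendsto _).comp (tendsto_pi_nhds.2 hω)) y
  have h2 : Tendsto (fun n => ∏ i, charFun (P.map (X n i)) (y.ofLp i)) atTop
      (𝓝 (∏ i, charFun (P.map (Z i)) (y.ofLp i))) :=
    tendsto_finsetProd _ fun i _ =>
      tendsto_charFun_map (fun n => hX n i) (hZ i) (hlim i) (y.ofLp i)
  simp_rw [(iIndepFun_iff_charFun_pi (hX _)).1 (hind _) y] at h1
  exact tendsto_nhds_unique h1 h2

variable {E : Type*} [NormedAddCommGroup E] [InnerProductSpace ℝ E] [FiniteDimensional ℝ E]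
  [MeasurableSpace E] [BorelSpace E] {ν : Measure E} {ψ : E → ℂ}

/-- The path is the right limit of the dyadic values. Its increments are almost sure limits of block
sums of the array, so their characteristic functions and independence pass to the limit. -/
theorem IsDyadicScheme.exists_isLevyProcess {P : Measure (ℕ → ℕ → E)} (hP : IsDyadicScheme P ψ)
    (hψ : Continuous ψ) (hre : ∀ y, (ψ y).re ≤ 0) :
    ∃ Z : ℝ≥0 → (ℕ → ℕ → E) → E, IsLevyProcess P Z ∧
      ∀ t y, charFun (P.map (Z t)) y = Complex.exp ((t : ℝ) * ψ y) := by
  classical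
  have hprob := hP.isProbabilityMeasure
  let R : Set (ℕ → ℕ → E) := {ω | DyadicConsistent ω ∧ ∀ ε > 0, ∀ T : ℕ, ∃ m, ∀ k ≤ T * 2 ^ m,
    NoTwoMoves (dyadicValue ω) ε m k}
  have hR : P Rᶜ = 0 := by
    have : ∀ᵐ ω ∂P, ω ∈ R := by
      filter_upwards [hP.consistent, hP.ae_forall_noTwoMoves hψ hre] with ω h1 h2
      exact ⟨h1, h2⟩
    exact this
  -- The irregular set need not be measurable. On a measurable null superset the path is set to
  -- zero, which gives càdlàg paths for every ω and keeps the process measurable.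
  obtain ⟨B, hRB, hB, hPB⟩ := exists_measurable_superset_of_null hR
  have hGR : ∀ ω, ω ∈ Bᶜ → ω ∈ R := fun ω hω => by
    by_contra h
    exact hω (hRB h)
  have hG : ∀ᵐ ω ∂P, ω ∈ Bᶜ := by
    rw [ae_iff]
    simpa using hPB
  obtain ⟨Y, hY, hY0⟩ : ∃ Y : ℝ≥0 → (ℕ → ℕ → E) → E,
      (∀ ω ∈ Bᶜ, ∀ t, Tendsto (dyadicValue ω) (𝓝[dyadics ∩ Set.Ioi t] t) (𝓝 (Y t ω))) ∧
      ∀ ω, ω ∉ Bᶜ → ∀ t, Y t ω = 0 := by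
    refine ⟨fun t ω => if h : ω ∈ Bᶜ then
      (exists_tendsto_right_of_noTwoMoves (hGR ω h).2 t).choose else 0, fun ω hω t => ?_,
      fun ω hω t => dif_neg hω⟩
    simp only
    rw [dif_pos hω]
    exact (exists_tendsto_right_of_noTwoMoves (hGR ω hω).2 t).choose_spec
  have hYmeas : ∀ t, Measurable (Y t) := by
    intro t
    refine measurable_of_tendsto_metrizable (f := fun n =>
      Bᶜ.indicator fun ω => dyadicValue ω (nextDyadic n t))
      (fun n => (measurable_dyadicValue _).indicator hB.compl) (tendsto_pi_nhds.2 fun ω => ?_)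
    by_cases hω : ω ∈ Bᶜ
    · simp only [Set.indicator_of_mem hω]
      exact (hY ω hω t).comp (tendsto_nextDyadic t)
    · simp only [Set.indicator_of_notMem hω, hY0 ω hω t]
      exact tendsto_const_nhds
  have hright : ∀ ω t, ContinuousWithinAt (fun u => Y u ω) (Set.Ici t) t := by
    intro ω t
    by_cases hω : ω ∈ Bᶜ
    · exact continuousWithinAt_of_tendsto_right (fun t => inferInstance) (hY ω hω) t
    · simp only [hY0 ω hω]
      exact continuousWithinAt_const
  have hleft : ∀ ω t, ∃ l, Tendsto (fun u => Y u ω) (𝓝[<] t) (𝓝 l) := by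
    intro ω t
    by_cases hω : ω ∈ Bᶜ
    · obtain ⟨x, hx⟩ := exists_tendsto_left_of_noTwoMoves (hGR ω hω).2 t
      exact ⟨x, tendsto_left_of_tendsto_right (fun t => inferInstance) (hY ω hω) hx⟩
    · simp only [hY0 ω hω]
      exact ⟨0, tendsto_const_nhds⟩
  obtain ⟨a, ha, hnext⟩ : ∃ a : ℕ → ℝ≥0 → ℕ, (∀ n, Monotone (a n)) ∧
      ∀ n t, nextDyadic n t = (a n t : ℝ≥0) / 2 ^ n :=
    ⟨fun n t => ⌊2 ^ n * t⌋₊ + 1, fun n s t hst => by dsimp only; gcongr, fun n t => rfl⟩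
  have hincr : ∀ s t : ℝ≥0, s ≤ t → ∀ᵐ ω ∂P, Tendsto
      (fun n => ∑ i ∈ Finset.Ico (a n s) (a n t), ω n i) atTop (𝓝 (Y t ω - Y s ω)) := by
    intro s t hst
    filter_upwards [hG] with ω hω
    have h1 := ((hY ω hω t).comp (tendsto_nextDyadic t)).sub
      ((hY ω hω s).comp (tendsto_nextDyadic s))
    refine h1.congr fun n => ?_
    simp only [Function.comp_apply, hnext]
    exact (hGR ω hω).1.dyadicValue_sub (ha n hst)
  have hsum_meas : ∀ n p q, Measurable fun ω : ℕ → ℕ → E => ∑ i ∈ Finset.Ico p q, ω n i := by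
    intro n p q
    fun_prop
  have hchar : ∀ s t : ℝ≥0, s ≤ t → ∀ y, charFun (P.map fun ω => Y t ω - Y s ω) y
      = Complex.exp (((t : ℝ) - s : ℝ) * ψ y) := by
    intro s t hst y
    have h1 := tendsto_charFun_map (fun n => (hsum_meas n (a n s) (a n t)).aemeasurable)
      ((hYmeas t).sub (hYmeas s)).aemeasurable (hincr s t hst) y
    refine tendsto_nhds_unique h1 ?_
    simp_rw [hP.charFun_sum_Ico _ (ha _ hst)]
    have hdy : ∀ t : ℝ≥0, Tendsto (fun n => (a n t : ℝ) / 2 ^ n) atTop (𝓝 (t : ℝ)) := by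
      intro t
      have h2 := (NNReal.continuous_coe.tendsto t).comp
        ((tendsto_nextDyadic t).mono_right nhdsWithin_le_nhds)
      refine h2.congr fun n => ?_
      simp [hnext]
    have h3 := (hdy t).sub (hdy s)
    have h4 : Continuous fun x : ℝ => Complex.exp (x * ψ y) := by fun_prop
    refine ((h4.tendsto _).comp h3).congr fun n => ?_
    simp [sub_div]
  -- Subtracting `Y 0` makes the process start at zero for every ω without changing its increments.
  have hsubZ : ∀ s t ω, Y t ω - Y 0 ω - (Y s ω - Y 0 ω) = Y t ω - Y s ω := fun s t ω =>
    sub_sub_sub_cancel_right _ _ _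
  have hZmeas : ∀ t, Measurable fun ω => Y t ω - Y 0 ω := fun t => (hYmeas t).sub (hYmeas 0)
  refine ⟨fun t ω => Y t ω - Y 0 ω, ⟨hZmeas, fun ω => sub_self _, ?_, ?_, ?_, ?_⟩, fun t y => ?_⟩
  · intro n t ht
    simp only [hsubZ]
    have hX : ∀ N (i : Fin n), AEMeasurable (fun ω : ℕ → ℕ → E =>
        ∑ j ∈ Finset.Ico (a N (t i.castSucc)) (a N (t i.succ)), ω N j) P :=
      fun N i => (hsum_meas N _ _).aemeasurable
    have hD : ∀ i : Fin n, AEMeasurable (fun ω => Y (t i.succ) ω - Y (t i.castSucc) ω) P :=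
      fun i => ((hYmeas (t i.succ)).sub (hYmeas (t i.castSucc))).aemeasurable
    have hlim : ∀ i : Fin n, ∀ᵐ ω ∂P, Tendsto (fun N => ∑ j ∈ Finset.Ico (a N (t i.castSucc))
        (a N (t i.succ)), ω N j) atTop (𝓝 (Y (t i.succ) ω - Y (t i.castSucc) ω)) :=
      fun i => hincr (t i.castSucc) (t i.succ) (ht i.castSucc_lt_succ.le)
    refine iIndepFun_of_tendsto_ae hX hD (fun N => ?_) hlim
    have h0 : ∀ i, Measurable fun ω : ℕ → ℕ → E => ω N i := fun i => by fun_prop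
    have h1 := (iIndepFun.hasIndepIncrements_sum_range h0 (hP.iIndepFun N)) n
      (fun i => a N (t i)) ((ha N).comp ht)
    have h2 : (fun (i : Fin n) (ω : ℕ → ℕ → E) => ∑ j ∈ Finset.range (a N (t i.succ)), ω N j
        - ∑ j ∈ Finset.range (a N (t i.castSucc)), ω N j)
        = fun i ω => ∑ j ∈ Finset.Ico (a N (t i.castSucc)) (a N (t i.succ)), ω N j := by
      ext i ω
      exact (Finset.sum_Ico_eq_sub _ (ha N (ht (Fin.castSucc_lt_succ (i := i)).le))).symm
    rwa [h2] at h1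
  · intro s t
    simp only [hsubZ]
    have h1 : IsProbabilityMeasure (P.map fun ω => Y (s + t) ω - Y s ω) :=
      Measure.isProbabilityMeasure_map ((hYmeas _).sub (hYmeas _)).aemeasurable
    have h2 : IsProbabilityMeasure (P.map fun ω => Y t ω - Y 0 ω) :=
      Measure.isProbabilityMeasure_map (hZmeas t).aemeasurable
    refine Measure.ext_of_charFun (funext fun y => ?_)
    rw [hchar s (s + t) (by simp), hchar 0 t zero_le]
    simp
  · intro ω t
    exact (hright ω t).sub continuousWithinAt_const
  · intro ω t
    obtain ⟨l, hl⟩ := hleft ω t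
    exact ⟨_, hl.sub tendsto_const_nhds⟩
  · rw [hchar 0 t zero_le]
    simp

/-- Existence of Lévy processes. -/
theorem IsInfinitelyDivisible.exists_isLevyProcessOf (hν : IsInfinitelyDivisible ν) :
    ∃ (P : Measure (ℕ → ℕ → E)) (Z : ℝ≥0 → (ℕ → ℕ → E) → E), IsLevyProcessOf ν P Z := by
  obtain ⟨ψ, hψ⟩ := hν.exists_charExponent
  have := hν.1
  obtain ⟨P, hP⟩ := hν.exists_isDyadicScheme hψ
  obtain ⟨Z, hZ, hchar⟩ := hP.exists_isLevyProcess hψ.continuous hψ.re_nonpos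
  have hprob := hP.isProbabilityMeasure
  have h1 : IsProbabilityMeasure (P.map (Z 1)) :=
    Measure.isProbabilityMeasure_map (hZ.measurable 1).aemeasurable
  refine ⟨P, Z, hprob, hZ, Measure.ext_of_charFun (funext fun y => ?_)⟩
  rw [hchar, hψ.charFun_eq]
  simp

end LevyExistence

/-! ### Marginals of an arbitrary Lévy process -/

section LevyCharFun

variable {E : Type*} [NormedAddCommGroup E] [InnerProductSpace ℝ E] [FiniteDimensional ℝ E]
  [MeasurableSpace E] [BorelSpace E] {ν : Measure E} {ψ : E → ℂ}
  {Ω : Type*} [MeasurableSpace Ω] {P : Measure Ω} {Y : ℝ≥0 → Ω → E}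

theorem IsLevyProcess.charFun_map_add [IsProbabilityMeasure P] (hY : IsLevyProcess P Y)
    (s t : ℝ≥0) (y : E) :
    charFun (P.map (Y (s + t))) y = charFun (P.map (Y s)) y * charFun (P.map (Y t)) y := by
  have hind := hY.indep_increments.indepFun_eval_sub (r := 0) (s := s) (t := s + t) zero_le
    (by simp) (ae_of_all _ hY.start_zero)
  have h1 := hind.charFun_map_add_eq_mul (hY.measurable s).aemeasurable
    ((hY.measurable (s + t)).sub (hY.measurable s)).aemeasurable
  rw [add_sub_cancel] at h1
  have h2 := hY.stationary_increments s t
  rw [h1, Pi.mul_apply, ← h2]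
  rfl

theorem IsLevyProcess.charFun_map_natCast_mul [IsProbabilityMeasure P] (hY : IsLevyProcess P Y)
    (n : ℕ) (t : ℝ≥0) (y : E) :
    charFun (P.map (Y (n * t))) y = charFun (P.map (Y t)) y ^ n := by
  induction n with
  | zero =>
    have : Y 0 = fun _ => 0 := funext hY.start_zero
    simp [this]
  | succ n ih =>
    rw [Nat.cast_succ, add_mul, one_mul, hY.charFun_map_add, ih, pow_succ]

/-- Y(1/n) is a convolution root of ν of order n, so its exponent is ψ/n; multiples give dyadic
times, and right continuity gives all times. -/
theorem IsLevyProcessOf.charFun_map_eq (hY : IsLevyProcessOf ν P Y) (hψ : IsCharExponent ν ψ)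
    (t : ℝ≥0) (y : E) : charFun (P.map (Y t)) y = Complex.exp ((t : ℝ) * ψ y) := by
  obtain ⟨hprob, hL, h1⟩ := hY
  have hunit : ∀ n : ℕ, n ≠ 0 → ∀ y, charFun (P.map (Y (1 / n))) y = Complex.exp (ψ y / n) := by
    intro n hn y
    have : IsProbabilityMeasure (P.map (Y (1 / n))) :=
      Measure.isProbabilityMeasure_map (hL.measurable _).aemeasurable
    refine hψ.eq_exp_div_of_pow_eq continuous_charFun
      (by rw [charFun_zero, probReal_univ, Complex.ofReal_one]) hn (fun y => ?_) y
    rw [← hL.charFun_map_natCast_mul, mul_one_div_cancel (by exact_mod_cast hn), h1,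
      hψ.charFun_eq]
  have hdyad : ∀ n : ℕ, charFun (P.map (Y (nextDyadic n t))) y
      = Complex.exp ((nextDyadic n t : ℝ) * ψ y) := by
    intro n
    have h2 : nextDyadic n t = ((⌊2 ^ n * t⌋₊ + 1 : ℕ) : ℝ≥0) * (1 / ((2 ^ n : ℕ) : ℝ≥0)) := by
      rw [nextDyadic, mul_one_div]
      push_cast
      rfl
    rw [h2, hL.charFun_map_natCast_mul, hunit _ (by positivity), ← Complex.exp_nat_mul]
    congr 1
    push_cast
    ring
  have htend := tendsto_nextDyadic t
  have hright : ∀ ω, Tendsto (fun n => Y (nextDyadic n t) ω) atTop (𝓝 (Y t ω)) := fun ω =>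
    (hL.right_continuous ω t).tendsto.comp (htend.mono_right
      (nhdsWithin_mono _ fun u hu => Set.mem_Ici.2 (le_of_lt hu.2)))
  have h3 := tendsto_charFun_map (P := P) (fun n => (hL.measurable (nextDyadic n t)).aemeasurable)
    (hL.measurable t).aemeasurable (ae_of_all _ hright) y
  refine tendsto_nhds_unique h3 ?_
  simp_rw [hdyad]
  have h4 : Continuous fun x : ℝ => Complex.exp (x * ψ y) := by fun_prop
  exact (h4.tendsto _).comp ((NNReal.continuous_coe.tendsto t).comp
    (htend.mono_right nhdsWithin_le_nhds))

theorem IsLevyProcessOf.charFun_map_sub_eq (hY : IsLevyProcessOf ν P Y) (hψ : IsCharExponent ν ψ)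
    {s t : ℝ≥0} (hst : s ≤ t) (y : E) :
    charFun (P.map fun ω => Y t ω - Y s ω) y = Complex.exp ((t - s : ℝ) * ψ y) := by
  obtain ⟨u, rfl⟩ := exists_add_of_le hst
  rw [hY.2.1.stationary_increments, hY.charFun_map_eq hψ]
  simp

end LevyCharFun

/-! ### Càdlàg bounds, Riemann–Stieltjes sums and clocks -/

/-- A function with one-sided limits is bounded on compact intervals. -/
theorem exists_bound_of_cadlag {E : Type*} [NormedAddCommGroup E] {g : ℝ≥0 → E}
    (hr : ∀ t, ContinuousWithinAt g (Set.Ici t) t) (hl : ∀ t, ∃ x, Tendsto g (𝓝[<] t) (𝓝 x))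
    (T : ℝ≥0) : ∃ M, ∀ t ≤ T, ‖g t‖ ≤ M := by
  have hloc : ∀ t, ∃ M, ∀ᶠ u in 𝓝 t, ‖g u‖ ≤ M := by
    intro t
    obtain ⟨x, hx⟩ := hl t
    have h1 : ∀ᶠ u in 𝓝[<] t, ‖g u‖ ≤ max (‖x‖ + 1) (‖g t‖ + 1) :=
      (hx.norm.eventually (gt_mem_nhds (lt_add_one ‖x‖))).mono fun u hu =>
        hu.le.trans (le_max_left _ _)
    have h2 : ∀ᶠ u in 𝓝[≥] t, ‖g u‖ ≤ max (‖x‖ + 1) (‖g t‖ + 1) :=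
      ((hr t).tendsto.norm.eventually (gt_mem_nhds (lt_add_one ‖g t‖))).mono fun u hu =>
        hu.le.trans (le_max_right _ _)
    refine ⟨max (‖x‖ + 1) (‖g t‖ + 1), ?_⟩
    rw [← nhdsLT_sup_nhdsGE]
    exact eventually_sup.2 ⟨h1, h2⟩
  have hcomp : IsCompact (Set.Icc 0 T) := isCompact_Icc
  have := hcomp.induction_on (p := fun s => ∃ M, ∀ t ∈ s, ‖g t‖ ≤ M) ⟨0, by simp⟩
    (fun s t hst ⟨M, hM⟩ => ⟨M, fun u hu => hM u (hst hu)⟩)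
    (fun s t ⟨M, hM⟩ ⟨N, hN⟩ => ⟨max M N, fun u hu => hu.elim
      (fun h => (hM u h).trans (le_max_left _ _)) fun h => (hN u h).trans (le_max_right _ _)⟩)
    (fun t _ => by
      obtain ⟨M, hM⟩ := hloc t
      exact ⟨_, mem_nhdsWithin_of_mem_nhds hM, M, fun u hu => hu⟩)
  obtain ⟨M, hM⟩ := this
  exact ⟨M, fun t ht => hM t ⟨zero_le, ht⟩⟩

section RiemannSums

variable {F : Type*} [NormedAddCommGroup F] [NormedSpace ℝ F] [CompleteSpace F]
  {a b : ℝ} {g : ℝ → F} {w : ℝ → ℝ}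

/-- The `k`-th point of the equidistant partition of `[a, b]` into `n` intervals. -/
noncomputable def gridPoint (a b : ℝ) (n : ℕ) (k : ℕ) : ℝ := a + k * ((b - a) / n)

/-- The partition point that is `σ` steps after the last partition point up to `s`. -/
noncomputable def gridTag (a b : ℝ) (σ n : ℕ) (s : ℝ) : ℝ :=
  gridPoint a b n (⌊(s - a) / ((b - a) / n)⌋₊ + σ)

theorem gridPoint_zero (n : ℕ) : gridPoint a b n 0 = a := by simp [gridPoint]

theorem gridPoint_self {n : ℕ} (hn : n ≠ 0) : gridPoint a b n n = b := by
  have : (n : ℝ) ≠ 0 := Nat.cast_ne_zero.2 hn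
  rw [gridPoint]
  field_simp
  ring

theorem gridPoint_mono (hab : a ≤ b) (n : ℕ) : Monotone (gridPoint a b n) := by
  intro k l hkl
  have : 0 ≤ (b - a) / n := div_nonneg (by linarith) (Nat.cast_nonneg _)
  have h : (k : ℝ) ≤ l := Nat.cast_le.2 hkl
  unfold gridPoint
  gcongr

theorem gridPoint_mem_Icc (hab : a ≤ b) {n k : ℕ} (hn : n ≠ 0) (hk : k ≤ n) :
    gridPoint a b n k ∈ Set.Icc a b := by
  constructor
  · have := gridPoint_mono hab n (Nat.zero_le k)
    rwa [gridPoint_zero] at this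
  · have := gridPoint_mono hab n hk
    rwa [gridPoint_self hn] at this

theorem floor_eq_of_mem_Ico (hab : a < b) {n k : ℕ} (hn : n ≠ 0) {s : ℝ}
    (hs : s ∈ Set.Ico (gridPoint a b n k) (gridPoint a b n (k + 1))) :
    ⌊(s - a) / ((b - a) / n)⌋₊ = k := by
  have hpos : 0 < (b - a) / n := div_pos (by linarith) (by positivity)
  obtain ⟨h1, h2⟩ := hs
  unfold gridPoint at h1 h2
  push_cast at h2
  rw [Nat.floor_eq_iff]
  · rw [le_div_iff₀ hpos, div_lt_iff₀ hpos]
    constructor <;> linarith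
  · have : 0 ≤ k * ((b - a) / n) := by positivity
    exact div_nonneg (by linarith) hpos.le

theorem floor_lt_of_mem_Ico (hab : a < b) {n : ℕ} (hn : n ≠ 0) {s : ℝ} (hs : s ∈ Set.Ico a b) :
    ⌊(s - a) / ((b - a) / n)⌋₊ < n := by
  have hpos : 0 < (b - a) / n := div_pos (by linarith) (by positivity)
  have hn' : (n : ℝ) ≠ 0 := Nat.cast_ne_zero.2 hn
  rw [Nat.floor_lt (div_nonneg (by linarith [hs.1]) hpos.le), div_lt_iff₀ hpos,
    mul_div_cancel₀ _ hn']
  linarith [hs.2]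

theorem gridTag_mem_Icc (hab : a < b) {σ n : ℕ} (hσ : σ ≤ 1) (hn : n ≠ 0) {s : ℝ}
    (hs : s ∈ Set.Ico a b) : gridTag a b σ n s ∈ Set.Icc a b :=
  gridPoint_mem_Icc hab.le hn (by
    have := floor_lt_of_mem_Ico hab hn hs
    omega)

theorem le_gridTag_one (hab : a < b) {n : ℕ} (hn : n ≠ 0) (s : ℝ) : s ≤ gridTag a b 1 n s := by
  have hpos : 0 < (b - a) / n := div_pos (by linarith) (by positivity)
  have h := Nat.lt_floor_add_one ((s - a) / ((b - a) / n))
  rw [div_lt_iff₀ hpos] at h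
  unfold gridTag gridPoint
  push_cast
  linarith

theorem abs_gridTag_sub_le (hab : a < b) {σ n : ℕ} (hσ : σ ≤ 1) (hn : n ≠ 0) {s : ℝ}
    (hs : a ≤ s) : |gridTag a b σ n s - s| ≤ (b - a) / n := by
  have hpos : 0 < (b - a) / n := div_pos (by linarith) (by positivity)
  have h1 := Nat.lt_floor_add_one ((s - a) / ((b - a) / n))
  have h2 := Nat.floor_le (div_nonneg (by linarith : 0 ≤ s - a) hpos.le)
  rw [div_lt_iff₀ hpos] at h1
  rw [le_div_iff₀ hpos] at h2
  have hσ0 : (0 : ℝ) ≤ σ := Nat.cast_nonneg σ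
  have hσ1 : (σ : ℝ) ≤ 1 := by exact_mod_cast hσ
  unfold gridTag gridPoint
  push_cast
  rw [abs_le]
  constructor <;> nlinarith

theorem tendsto_gridTag (hab : a < b) {σ : ℕ} (hσ : σ ≤ 1) {s : ℝ} (hs : a ≤ s) :
    Tendsto (fun n => gridTag a b σ n s) atTop (𝓝 s) := by
  rw [tendsto_iff_dist_tendsto_zero]
  refine squeeze_zero' (Eventually.of_forall fun _ => dist_nonneg) ?_
    (tendsto_const_div_atTop_nhds_zero_nat (b - a))
  filter_upwards [eventually_ne_atTop 0] with n hn
  exact abs_gridTag_sub_le hab hσ hn hs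

theorem stronglyMeasurable_comp_gridTag (σ n : ℕ) :
    StronglyMeasurable fun s => g (gridTag a b σ n s) := by
  have h1 : StronglyMeasurable fun k : ℕ => g (gridPoint a b n (k + σ)) :=
    StronglyMeasurable.of_discrete
  exact h1.comp_measurable (Nat.measurable_floor.comp (by fun_prop))

/-- Functions that are limits of their values at the tags of equidistant partitions are
integrable. -/
theorem intervalIntegrable_smul_of_tendsto_gridTag (hab : a ≤ b) (hw : Continuous w) {σ : ℕ}
    {M : ℝ} (hM : ∀ s ∈ Set.Icc a b, ‖g s‖ ≤ M)
    (hlim : ∀ s ∈ Set.Ico a b, Tendsto (fun n => g (gridTag a b σ n s)) atTop (𝓝 (g s))) :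
    IntervalIntegrable (fun s => w s • g s) volume a b := by
  have hg : IntervalIntegrable g volume a b := by
    rw [intervalIntegrable_iff_integrableOn_Ico_of_le hab]
    refine Integrable.of_bound ?_ M ?_
    · refine aestronglyMeasurable_of_tendsto_ae (μ := volume.restrict (Set.Ico a b)) atTop
        (f := fun n s => g (gridTag a b σ n s))
        (fun n => (stronglyMeasurable_comp_gridTag σ n).aestronglyMeasurable)
        ((ae_restrict_iff' measurableSet_Ico).2 (ae_of_all _ hlim))
    · exact (ae_restrict_iff' measurableSet_Ico).2
        (ae_of_all _ fun s hs => hM s (Set.Ico_subset_Icc_self hs))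
  exact hg.continuousOn_smul hw.continuousOn

/-- Convergence of Riemann–Stieltjes sums with tags at partition points. -/
theorem tendsto_sum_integral_smul_gridPoint (hab : a ≤ b) (hw : Continuous w) {σ : ℕ} (hσ : σ ≤ 1)
    {M : ℝ} (hM : ∀ s ∈ Set.Icc a b, ‖g s‖ ≤ M)
    (hlim : ∀ s ∈ Set.Ico a b, Tendsto (fun n => g (gridTag a b σ n s)) atTop (𝓝 (g s))) :
    Tendsto (fun n => ∑ k ∈ Finset.range n,
      (∫ s in (gridPoint a b n k)..(gridPoint a b n (k + 1)), w s) • g (gridPoint a b n (k + σ)))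
      atTop (𝓝 (∫ s in a..b, w s • g s)) := by
  rcases hab.eq_or_lt with rfl | hab'
  · simp [gridPoint]
  have hpiece : ∀ n : ℕ, n ≠ 0 → ∀ k, ∀ s ∈ Set.Ioo (gridPoint a b n k) (gridPoint a b n (k + 1)),
      w s • g (gridPoint a b n (k + σ)) = w s • g (gridTag a b σ n s) := by
    intro n hn k s hs
    rw [gridTag, floor_eq_of_mem_Ico hab' hn ⟨hs.1.le, hs.2⟩]
  have hconst : ∀ n k, IntervalIntegrable (fun s => w s • g (gridPoint a b n (k + σ))) volume
      (gridPoint a b n k) (gridPoint a b n (k + 1)) := fun n k =>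
    (hw.smul continuous_const).intervalIntegrable _ _
  -- On each piece the sum is the integral of a step function; the floor in `gridTag` can disagree
  -- only at the right endpoint, a null set.
  have hmem : ∀ n : ℕ, n ≠ 0 → ∀ k, ∀ᵐ s ∂volume,
      s ∈ Set.uIoc (gridPoint a b n k) (gridPoint a b n (k + 1)) →
      w s • g (gridPoint a b n (k + σ)) = w s • g (gridTag a b σ n s) := by
    intro n hn k
    filter_upwards [compl_mem_ae_iff.2 (measure_singleton (gridPoint a b n (k + 1)))] with s hs hs'
    rw [Set.uIoc_of_le (gridPoint_mono hab n (Nat.le_succ k))] at hs'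
    exact hpiece n hn k s ⟨hs'.1, lt_of_le_of_ne hs'.2 hs⟩
  have hsum : ∀ n : ℕ, n ≠ 0 → ∑ k ∈ Finset.range n,
      (∫ s in (gridPoint a b n k)..(gridPoint a b n (k + 1)), w s) • g (gridPoint a b n (k + σ))
      = ∫ s in a..b, w s • g (gridTag a b σ n s) := by
    intro n hn
    have h1 := intervalIntegral.sum_integral_adjacent_intervals
      (f := fun s => w s • g (gridTag a b σ n s)) (a := gridPoint a b n) (n := n) (μ := volume)
      (fun k _ => (hconst n k).congr_ae ((ae_restrict_iff' measurableSet_uIoc).2 (hmem n hn k)))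
    rw [gridPoint_zero, gridPoint_self hn] at h1
    rw [← h1]
    refine Finset.sum_congr rfl fun k _ => ?_
    rw [← intervalIntegral.integral_smul_const]
    exact intervalIntegral.integral_congr_ae (hmem n hn k)
  have hM0 : 0 ≤ M := (norm_nonneg _).trans (hM a (Set.left_mem_Icc.2 hab))
  have hdct : Tendsto (fun n => ∫ s in a..b, w s • g (gridTag a b σ n s)) atTop
      (𝓝 (∫ s in a..b, w s • g s)) := by
    have hne : ∀ᵐ s : ℝ, s ≠ b := compl_mem_ae_iff.2 (measure_singleton b)
    refine intervalIntegral.tendsto_integral_filter_of_dominated_convergence (fun s => |w s| * M)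
      (Eventually.of_forall fun n => ?_) ?_ ((hw.abs.mul continuous_const).intervalIntegrable _ _) ?_
    · exact hw.aestronglyMeasurable.smul
        (stronglyMeasurable_comp_gridTag σ n).aestronglyMeasurable
    · filter_upwards [eventually_ne_atTop 0] with n hn
      filter_upwards [hne] with s hs hs'
      rw [Set.uIoc_of_le hab] at hs'
      rw [norm_smul, Real.norm_eq_abs]
      gcongr
      exact hM _ (gridTag_mem_Icc hab' hσ hn ⟨hs'.1.le, lt_of_le_of_ne hs'.2 hs⟩)
    · filter_upwards [hne] with s hs hs'
      rw [Set.uIoc_of_le hab] at hs'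
      exact (hlim s ⟨hs'.1.le, lt_of_le_of_ne hs'.2 hs⟩).const_smul (w s)
  refine hdct.congr' ?_
  filter_upwards [eventually_ne_atTop 0] with n hn
  exact (hsum n hn).symm

end RiemannSums

/-- Summation by parts, the discrete form of the formula that defines the random integral. -/
theorem sum_smul_sub_eq_sub_sum {F : Type*} [AddCommGroup F] [Module ℝ F] (c : ℕ → ℝ) (v : ℕ → F)
    (n : ℕ) : ∑ k ∈ Finset.range n, c k • (v (k + 1) - v k)
      = c n • v n - c 0 • v 0 - ∑ k ∈ Finset.range n, (c (k + 1) - c k) • v (k + 1) := by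
  induction n with
  | zero => simp
  | succ n ih =>
    rw [Finset.sum_range_succ, Finset.sum_range_succ, ih]
    simp only [smul_sub, sub_smul]
    abel

/-- A continuously differentiable clock with derivative `r'`, nonnegative and nondecreasing on
`[0, ∞)`. -/
structure IsClock (r r' : ℝ → ℝ) : Prop where
  hasDerivAt : ∀ s, HasDerivAt r (r' s) s
  continuous_deriv : Continuous r'
  deriv_nonneg : ∀ s, 0 ≤ s → 0 ≤ r' s
  nonneg_zero : 0 ≤ r 0

namespace IsClock

variable {r r' : ℝ → ℝ}

theorem continuous (h : IsClock r r') : Continuous r :=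
  continuous_iff_continuousAt.2 fun s => (h.hasDerivAt s).continuousAt

theorem monotoneOn (h : IsClock r r') : MonotoneOn r (Set.Ici 0) := by
  refine monotoneOn_of_deriv_nonneg (convex_Ici 0) h.continuous.continuousOn
    (fun s _ => (h.hasDerivAt s).differentiableAt.differentiableWithinAt) fun s hs => ?_
  rw [interior_Ici] at hs
  rw [(h.hasDerivAt s).deriv]
  exact h.deriv_nonneg s (le_of_lt hs)

theorem nonneg (h : IsClock r r') {s : ℝ} (hs : 0 ≤ s) : 0 ≤ r s :=
  h.nonneg_zero.trans (h.monotoneOn (Set.mem_Ici.2 le_rfl) (Set.mem_Ici.2 hs) hs)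

theorem integral_deriv (h : IsClock r r') (a b : ℝ) : ∫ s in a..b, r' s = r b - r a :=
  intervalIntegral.integral_eq_sub_of_hasDerivAt (fun s _ => h.hasDerivAt s)
    (h.continuous_deriv.intervalIntegrable _ _)

end IsClock

/-! ### Random integrals over bounded intervals -/

section PathIntegral

variable {E : Type*} [NormedAddCommGroup E] [InnerProductSpace ℝ E] [FiniteDimensional ℝ E]
  [MeasurableSpace E] [BorelSpace E] {ν : Measure E} {ψ : E → ℂ} {f r r' : ℝ → ℝ} {a b : ℝ}
  {Ω : Type*} [MeasurableSpace Ω] {P : Measure Ω} {Y : ℝ≥0 → Ω → E}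

/-- The random integral over `(a, b]`. -/
noncomputable def randomIntegralIoc (f r : ℝ → ℝ) (Y : ℝ≥0 → Ω → E) (a b : ℝ) (ω : Ω) : E :=
  f b • Y (r b).toNNReal ω - f a • Y (r a).toNNReal ω
    - ∫ s in a..b, deriv f s • Y (r s).toNNReal ω

theorem IsLevyProcess.exists_bound_comp_clock (hY : IsLevyProcess P Y) (hr : IsClock r r')
    (ha : 0 ≤ a) (ω : Ω) : ∃ M, ∀ s ∈ Set.Icc a b, ‖Y (r s).toNNReal ω‖ ≤ M := by
  obtain ⟨M, hM⟩ := exists_bound_of_cadlag (hY.right_continuous ω) (hY.left_limits ω)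
    (r b).toNNReal
  refine ⟨M, fun s hs => hM _ (Real.toNNReal_le_toNNReal ?_)⟩
  exact hr.monotoneOn (ha.trans hs.1) ((ha.trans hs.1).trans hs.2) hs.2

/-- Tags with σ = 1 lie to the right of s, and the clock is monotone, so right continuity of the
path is enough. -/
theorem IsLevyProcess.tendsto_comp_clock_gridTag (hY : IsLevyProcess P Y) (hr : IsClock r r')
    (ha : 0 ≤ a) (ω : Ω) : ∀ s ∈ Set.Ico a b,
    Tendsto (fun n => Y (r (gridTag a b 1 n s)).toNNReal ω) atTop (𝓝 (Y (r s).toNNReal ω)) := by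
  intro s hs
  have hab : a < b := hs.1.trans_lt hs.2
  refine (hY.right_continuous ω _).tendsto.comp (tendsto_nhdsWithin_iff.2 ⟨?_, ?_⟩)
  · exact ((continuous_real_toNNReal.comp hr.continuous).tendsto s).comp
      (tendsto_gridTag hab le_rfl hs.1)
  · filter_upwards [eventually_ne_atTop 0] with n hn
    have h1 := le_gridTag_one hab hn s
    have h0 : 0 ≤ s := ha.trans hs.1
    exact Real.toNNReal_le_toNNReal (hr.monotoneOn h0 (h0.trans h1) h1)

theorem IsLevyProcess.intervalIntegrable_deriv_smul (hY : IsLevyProcess P Y) (hr : IsClock r r')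
    (hf : ContDiff ℝ 1 f) (ha : 0 ≤ a) (hab : a ≤ b) (ω : Ω) :
    IntervalIntegrable (fun s => deriv f s • Y (r s).toNNReal ω) volume a b := by
  obtain ⟨M, hM⟩ := hY.exists_bound_comp_clock hr ha (b := b) ω
  exact intervalIntegrable_smul_of_tendsto_gridTag (g := fun s => Y (r s).toNNReal ω) hab
    (hf.continuous_deriv le_rfl) hM (hY.tendsto_comp_clock_gridTag hr ha ω)

theorem IsLevyProcess.randomIntegral_sub (hY : IsLevyProcess P Y) (hr : IsClock r r')
    (hf : ContDiff ℝ 1 f) (ha : 0 ≤ a) (hab : a ≤ b) (ω : Ω) :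
    randomIntegral f r Y b ω - randomIntegral f r Y a ω = randomIntegralIoc f r Y a b ω := by
  unfold randomIntegral randomIntegralIoc
  rw [← intervalIntegral.integral_add_adjacent_intervals
    (hY.intervalIntegrable_deriv_smul hr hf le_rfl ha ω)
    (hY.intervalIntegrable_deriv_smul hr hf ha hab ω)]
  abel

/-- Summation by parts leaves the boundary terms and a sum with weights ∫ f' over the pieces and
right-hand tags, which converges pathwise. -/
theorem IsLevyProcess.tendsto_randomIntegralIoc (hY : IsLevyProcess P Y) (hr : IsClock r r')
    (hf : ContDiff ℝ 1 f) (ha : 0 ≤ a) (hab : a ≤ b) (ω : Ω) :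
    Tendsto (fun n => ∑ k ∈ Finset.range n, f (gridPoint a b n k) •
      (Y (r (gridPoint a b n (k + 1))).toNNReal ω - Y (r (gridPoint a b n k)).toNNReal ω))
      atTop (𝓝 (randomIntegralIoc f r Y a b ω)) := by
  obtain ⟨M, hM⟩ := hY.exists_bound_comp_clock hr ha (b := b) ω
  have hderiv : Continuous (deriv f) := hf.continuous_deriv le_rfl
  have h1 := tendsto_sum_integral_smul_gridPoint (g := fun s => Y (r s).toNNReal ω) hab
    hderiv le_rfl hM (hY.tendsto_comp_clock_gridTag hr ha ω)
  refine (tendsto_const_nhds.sub h1).congr' ?_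
  filter_upwards [eventually_ne_atTop 0] with n hn
  rw [sum_smul_sub_eq_sub_sum (fun k => f (gridPoint a b n k))
    (fun k => Y (r (gridPoint a b n k)).toNNReal ω), gridPoint_zero, gridPoint_self hn]
  congr 1
  refine Finset.sum_congr rfl fun k _ => ?_
  rw [intervalIntegral.integral_deriv_eq_sub
    (fun s _ => (hf.differentiable one_ne_zero).differentiableAt)
    (hderiv.intervalIntegrable _ _)]

theorem IsLevyProcess.measurable_randomIntegralIoc (hY : IsLevyProcess P Y) (hr : IsClock r r')
    (hf : ContDiff ℝ 1 f) (ha : 0 ≤ a) (hab : a ≤ b) :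
    Measurable (randomIntegralIoc f r Y a b) := by
  refine measurable_of_tendsto_metrizable (fun n => ?_)
    (tendsto_pi_nhds.2 fun ω => hY.tendsto_randomIntegralIoc hr hf ha hab ω)
  refine Finset.measurable_sum _ fun k _ => ?_
  exact ((hY.measurable _).sub (hY.measurable _)).const_smul _

theorem IsLevyProcess.measurable_randomIntegral (hY : IsLevyProcess P Y) (hr : IsClock r r')
    (hf : ContDiff ℝ 1 f) (hb : 0 ≤ b) : Measurable (randomIntegral f r Y b) :=
  hY.measurable_randomIntegralIoc hr hf le_rfl hb

/-- The characteristic function of a random integral over a bounded interval. -/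
theorem IsLevyProcessOf.charFun_map_randomIntegralIoc (hY : IsLevyProcessOf ν P Y)
    (hψ : IsCharExponent ν ψ) (hr : IsClock r r') (hf : ContDiff ℝ 1 f) (ha : 0 ≤ a)
    (hab : a ≤ b) (y : E) :
    charFun (P.map (randomIntegralIoc f r Y a b)) y
      = Complex.exp (∫ s in a..b, r' s • ψ (f s • y)) := by
  obtain ⟨hprob, hL, -⟩ := id hY
  have h1 := tendsto_charFun_map (P := P) (l := atTop)
    (X := fun (n : ℕ) ω => ∑ k ∈ Finset.range n, f (gridPoint a b n k) •
      (Y (r (gridPoint a b n (k + 1))).toNNReal ω - Y (r (gridPoint a b n k)).toNNReal ω))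
    (fun n => (Finset.measurable_sum _ fun k _ =>
      ((hL.measurable _).sub (hL.measurable _)).const_smul _).aemeasurable)
    (hL.measurable_randomIntegralIoc hr hf ha hab).aemeasurable
    (ae_of_all _ fun ω => hL.tendsto_randomIntegralIoc hr hf ha hab ω) y
  refine tendsto_nhds_unique h1 ?_
  have hcont : Continuous fun s => ψ (f s • y) :=
    hψ.continuous.comp (hf.continuous.smul continuous_const)
  obtain ⟨M, hM⟩ := isCompact_Icc.exists_bound_of_continuousOn (s := Set.Icc a b)
    hcont.continuousOn
  -- The exponents of the independent summands form a Riemann sum with left-hand tags and weights ∫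
  -- r', the increments of the clock.
  have h2 := tendsto_sum_integral_smul_gridPoint (g := fun s => ψ (f s • y)) hab
    hr.continuous_deriv zero_le_one hM fun s hs =>
      (hcont.tendsto s).comp (tendsto_gridTag (hs.1.trans_lt hs.2) zero_le_one hs.1)
  refine ((Complex.continuous_exp.tendsto _).comp h2).congr fun n => ?_
  have hpt : ∀ k, 0 ≤ gridPoint a b n k := fun k => by
    have := gridPoint_mono hab n (Nat.zero_le k)
    rw [gridPoint_zero] at this
    exact ha.trans this
  have hmono : Monotone fun k => (r (gridPoint a b n k)).toNNReal := fun k l hkl =>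
    Real.toNNReal_le_toNNReal (hr.monotoneOn (hpt k) (hpt l) (gridPoint_mono hab n hkl))
  have hind := (hL.indep_increments.nat hmono).comp (fun k x => f (gridPoint a b n k) • x)
    (fun k => measurable_const_smul _)
  have hprod := congrFun (iIndepFun.charFun_map_fun_finsetSum_eq_prod (P := P)
    (s := Finset.range n) (X := fun k ω => f (gridPoint a b n k) •
      (Y (r (gridPoint a b n (k + 1))).toNNReal ω - Y (r (gridPoint a b n k)).toNNReal ω))
    (fun k _ => (((hL.measurable _).sub (hL.measurable _)).const_smul _).aemeasurable)
    (hind.restrict _)) y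
  rw [hprod, Finset.prod_apply, Function.comp_apply, Complex.exp_sum]
  refine Finset.prod_congr rfl fun k _ => ?_
  have h3 := hY.charFun_map_sub_eq hψ (hmono (Nat.le_succ k)) (f (gridPoint a b n k) • y)
  have hmeas : Measurable fun ω => Y (r (gridPoint a b n (k + 1))).toNNReal ω
      - Y (r (gridPoint a b n k)).toNNReal ω := (hL.measurable _).sub (hL.measurable _)
  rw [← charFun_map_smul] at h3
  change charFun (Measure.map _ (P.map fun ω => Y (r (gridPoint a b n (k + 1))).toNNReal ω
      - Y (r (gridPoint a b n k)).toNNReal ω)) y = _ at h3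
  rw [Measure.map_map (measurable_const_smul _) hmeas] at h3
  rw [hr.integral_deriv, add_zero]
  simp only [Real.coe_toNNReal _ (hr.nonneg (hpt _))] at h3
  rw [Complex.real_smul]
  exact h3.symm

end PathIntegral

/-! ### Completeness of convergence in measure -/

section CauchyInMeasure

variable {E : Type*} [NormedAddCommGroup E] [CompleteSpace E] [SecondCountableTopology E]
  [MeasurableSpace E] [BorelSpace E] {Ω : Type*} [MeasurableSpace Ω] {P : Measure Ω}
  [IsFiniteMeasure P]

/-- A family of random variables that is Cauchy in measure converges in measure. -/
theorem exists_tendstoInMeasure_of_cauchy {D : ℝ → Ω → E} (hD : ∀ b, 0 ≤ b → Measurable (D b))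
    (h : ∀ ε > 0, ∃ N, ∀ a b, N ≤ a → a ≤ b → P.real {ω | ε < ‖D b ω - D a ω‖} ≤ ε) :
    ∃ X : Ω → E, Measurable X ∧ TendstoInMeasure P D atTop X := by
  choose! N hN using h
  obtain ⟨t, htN, ht0, htmono, httop⟩ : ∃ t : ℕ → ℝ, (∀ k, N ((1 / 2) ^ k) ≤ t k) ∧
      (∀ k, 0 ≤ t k) ∧ Monotone t ∧ Tendsto t atTop atTop := by
    have hnn : ∀ k, (0 : ℝ) ≤ ∑ j ∈ Finset.range (k + 1), |N ((1 / 2) ^ j)| := fun k =>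
      Finset.sum_nonneg fun _ _ => abs_nonneg _
    -- Cumulative sums of absolute values dominate each threshold and are monotone; the added k
    -- drives the times to infinity.
    refine ⟨fun k => ∑ j ∈ Finset.range (k + 1), |N ((1 / 2) ^ j)| + k, fun k => ?_, fun k => ?_,
      ?_, ?_⟩
    · have h1 := Finset.single_le_sum (f := fun j : ℕ => |N ((1 / 2) ^ j)|)
        (fun _ _ => abs_nonneg _) (Finset.self_mem_range_succ k)
      have h2 := le_abs_self (N ((1 / 2) ^ k))
      have h3 : (0 : ℝ) ≤ k := k.cast_nonneg
      dsimp only at h1 ⊢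
      linarith
    · exact add_nonneg (hnn k) k.cast_nonneg
    · refine monotone_nat_of_le_succ fun k => ?_
      rw [Finset.sum_range_succ _ (k + 1)]
      push_cast
      linarith [abs_nonneg (N ((1 / 2) ^ (k + 1)))]
    · exact tendsto_atTop_mono (fun k => le_add_of_nonneg_left (hnn k))
        tendsto_natCast_atTop_atTop
  have hpos : ∀ k : ℕ, (0 : ℝ) < (1 / 2) ^ k := fun k => by positivity
  -- Borel–Cantelli: the increments along the times t k are eventually at most 2^{-k}.
  have hae : ∀ᵐ ω ∂P, ∀ᶠ k in atTop, ω ∉ {ω | (1 / 2) ^ k < ‖D (t (k + 1)) ω - D (t k) ω‖} := by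
    refine ae_eventually_notMem (ne_top_of_le_ne_top (b := ∑' k : ℕ, ENNReal.ofReal ((1 / 2) ^ k))
      ?_ (ENNReal.tsum_le_tsum fun k => ?_))
    · rw [← ENNReal.ofReal_tsum_of_nonneg (fun k => (hpos k).le)
        (summable_geometric_of_lt_one (by norm_num) (by norm_num))]
      exact ENNReal.ofReal_ne_top
    · rw [← ofReal_measureReal]
      exact ENNReal.ofReal_le_ofReal (hN _ (hpos k) _ _ (htN k) (htmono k.le_succ))
  obtain ⟨X, hX, hlim⟩ := measurable_limit_of_tendsto_metrizable_ae (μ := P) (L := atTop)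
    (f := fun k => D (t k)) (fun k => (hD _ (ht0 k)).aemeasurable) (by
      filter_upwards [hae] with ω hω
      obtain ⟨m, hm⟩ := eventually_atTop.1 hω
      refine cauchySeq_tendsto_of_complete ((cauchySeq_shift m).1 ?_)
      refine cauchySeq_of_le_geometric (1 / 2) ((1 / 2) ^ m) (by norm_num) fun k => ?_
      have := hm (k + m) (Nat.le_add_left _ _)
      simp only [not_lt] at this
      rw [dist_comm, dist_eq_norm, add_right_comm, ← pow_add, add_comm m]
      exact this)
  refine ⟨X, hX, ?_⟩
  have hsub := tendstoInMeasure_iff_measureReal_norm.1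
    (tendstoInMeasure_of_tendsto_ae (fun k => (hD _ (ht0 k)).aestronglyMeasurable) hlim)
  rw [tendstoInMeasure_iff_measureReal_norm]
  intro ε hε
  rw [Metric.tendsto_nhds]
  intro η hη
  set δ := min (ε / 2) (η / 2) with hδ
  have hδ0 : 0 < δ := lt_min (half_pos hε) (half_pos hη)
  filter_upwards [eventually_ge_atTop (N δ)] with b hb
  obtain ⟨k, hk1, hk2⟩ := (((hsub (ε / 2) (half_pos hε)).eventually
    (gt_mem_nhds (half_pos hη))).and (httop.eventually (eventually_ge_atTop b))).exists
  rw [Real.dist_0_eq_abs, abs_of_nonneg measureReal_nonneg]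
  have hcover : {ω | ε ≤ ‖D b ω - X ω‖} ⊆
      {ω | δ < ‖D (t k) ω - D b ω‖} ∪ {ω | ε / 2 ≤ ‖D (t k) ω - X ω‖} := by
    intro ω hω
    by_contra hcon
    simp only [Set.mem_union, Set.mem_ofPred_eq, not_or, not_lt, not_le] at hcon hω
    have h1 := norm_sub_le_norm_sub_add_norm_sub (D b ω) (D (t k) ω) (X ω)
    rw [norm_sub_rev (D b ω) (D (t k) ω)] at h1
    have h2 : δ ≤ ε / 2 := min_le_left _ _
    linarith
  calc P.real {ω | ε ≤ ‖D b ω - X ω‖}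
      ≤ _ := measureReal_mono hcover (measure_ne_top _ _)
    _ ≤ _ := measureReal_union_le _ _
    _ ≤ δ + P.real {ω | ε / 2 ≤ ‖D (t k) ω - X ω‖} := by
        gcongr
        exact hN δ hδ0 b (t k) hb hk2
    _ < η / 2 + η / 2 := add_lt_add_of_le_of_lt (min_le_right _ _) hk1
    _ = η := add_halves η

end CauchyInMeasure

/-! ### Improper random integrals and their laws -/

section ImproperIntegral

variable {E : Type*} [NormedAddCommGroup E] [InnerProductSpace ℝ E] [FiniteDimensional ℝ E]
  [MeasurableSpace E] [BorelSpace E] {ν : Measure E} {ψ : E → ℂ} {f r r' : ℝ → ℝ}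
  {Ω : Type*} [MeasurableSpace Ω] {P : Measure Ω} {Y : ℝ≥0 → Ω → E}

/-- The exponent of the integral over (a, b] is a piece of a convergent integral, so the
characteristic function tends to 1; the tail bound along a basis turns this into smallness in
probability. -/
theorem IsLevyProcessOf.exists_measureReal_randomIntegral_sub_le (hY : IsLevyProcessOf ν P Y)
    (hψ : IsCharExponent ν ψ) (hr : IsClock r r') (hf : ContDiff ℝ 1 f)
    (hint : ∀ y, IntegrableOn (fun s => r' s • ψ (f s • y)) (Set.Ioi 0)) {ε : ℝ} (hε : 0 < ε) :
    ∃ N, ∀ a b, N ≤ a → a ≤ b →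
      P.real {ω | ε < ‖randomIntegral f r Y b ω - randomIntegral f r Y a ω‖} ≤ ε := by
  obtain ⟨hprob, hL, -⟩ := id hY
  set ρ : ℝ := ε / (Module.finrank ℝ E + 1) with hρ
  have hρ0 : 0 < ρ := by positivity
  have hρε : ρ * (Module.finrank ℝ E + 1) ≤ ε := by
    rw [hρ, div_mul_cancel₀ _ (by positivity)]
  -- Pairs a ≤ b with both entries tending to infinity, so that the Cauchy condition becomes one
  -- limit.
  set l : Filter (ℝ × ℝ) := (atTop ×ˢ atTop) ⊓ 𝓟 {p | p.1 ≤ p.2} with hl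
  have hord : ∀ᶠ p in l, 0 ≤ p.1 ∧ p.1 ≤ p.2 := by
    have h1 : ∀ᶠ p in l, 0 ≤ p.1 :=
      (tendsto_fst.mono_left inf_le_left).eventually (eventually_ge_atTop 0)
    exact h1.and (mem_inf_of_right (mem_principal_self _))
  have hcont : ∀ y, Continuous fun s => r' s • ψ (f s • y) := fun y =>
    hr.continuous_deriv.smul (hψ.continuous.comp (hf.continuous.smul continuous_const))
  have hzero : ∀ y, Tendsto (fun p : ℝ × ℝ => ∫ s in p.1..p.2, r' s • ψ (f s • y)) l (𝓝 0) := by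
    intro y
    have h1 := intervalIntegral_tendsto_integral_Ioi 0 (hint y)
      ((tendsto_fst (f := atTop (α := ℝ)) (g := atTop (α := ℝ))).mono_left
        (inf_le_left (b := 𝓟 {p : ℝ × ℝ | p.1 ≤ p.2})))
    have h2 := intervalIntegral_tendsto_integral_Ioi 0 (hint y)
      ((tendsto_snd (f := atTop (α := ℝ)) (g := atTop (α := ℝ))).mono_left
        (inf_le_left (b := 𝓟 {p : ℝ × ℝ | p.1 ≤ p.2})))
    have h3 := h2.sub h1
    rw [sub_self] at h3
    refine h3.congr fun p => ?_
    rw [intervalIntegral.integral_interval_sub_left ((hcont y).intervalIntegrable _ _)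
      ((hcont y).intervalIntegrable _ _)]
  have hlim : Tendsto (fun p : ℝ × ℝ => ∑ i, 2⁻¹ * ρ * ‖∫ t in (-2 * ρ⁻¹)..(2 * ρ⁻¹),
      1 - charFun (P.map (randomIntegralIoc f r Y p.1 p.2)) (t • stdOrthonormalBasis ℝ E i)‖)
      l (𝓝 0) := by
    have hterm : ∀ i, Tendsto (fun p : ℝ × ℝ => ∫ t in (-2 * ρ⁻¹)..(2 * ρ⁻¹),
        1 - charFun (P.map (randomIntegralIoc f r Y p.1 p.2)) (t • stdOrthonormalBasis ℝ E i))
        l (𝓝 (∫ t in (-2 * ρ⁻¹)..(2 * ρ⁻¹), (0 : ℂ))) := by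
      intro i
      have hpm : ∀ p : ℝ × ℝ, 0 ≤ p.1 ∧ p.1 ≤ p.2 →
          IsProbabilityMeasure (P.map (randomIntegralIoc f r Y p.1 p.2)) := fun p hp =>
        Measure.isProbabilityMeasure_map
          (hL.measurable_randomIntegralIoc hr hf hp.1 hp.2).aemeasurable
      refine intervalIntegral.tendsto_integral_filter_of_dominated_convergence (fun _ => 2)
        ?_ ?_ intervalIntegrable_const (ae_of_all _ fun t _ => ?_)
      · filter_upwards [hord] with p hp
        have := hpm p hp
        exact (continuous_const.sub (continuous_charFun.comp
          (continuous_id.smul continuous_const))).aestronglyMeasurable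
      · filter_upwards [hord] with p hp
        have := hpm p hp
        exact ae_of_all _ fun t _ => norm_one_sub_charFun_le_two
      · have h1 := ((Complex.continuous_exp.tendsto _).comp
          (hzero (t • stdOrthonormalBasis ℝ E i))).const_sub 1
        rw [Complex.exp_zero, sub_self] at h1
        refine h1.congr' ?_
        filter_upwards [hord] with p hp
        rw [hY.charFun_map_randomIntegralIoc hψ hr hf hp.1 hp.2, Function.comp_apply]
    have := tendsto_finsetSum Finset.univ fun i _ => ((hterm i).norm).const_mul (2⁻¹ * ρ)
    simpa using this
  have hev := hlim.eventually (gt_mem_nhds hε)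
  rw [hl, eventually_inf_principal, prod_atTop_atTop_eq] at hev
  obtain ⟨⟨N₁, N₂⟩, hN⟩ := eventually_atTop.1 hev
  refine ⟨max 0 (max N₁ N₂), fun a b ha hab => ?_⟩
  have ha0 : 0 ≤ a := (le_max_left _ _).trans ha
  have ha1 : N₁ ≤ a := ((le_max_left _ _).trans (le_max_right _ _)).trans ha
  have ha2 : N₂ ≤ a := ((le_max_right _ _).trans (le_max_right _ _)).trans ha
  have hmeas := hL.measurable_randomIntegralIoc hr hf ha0 hab
  have hpm : IsProbabilityMeasure (P.map (randomIntegralIoc f r Y a b)) :=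
    Measure.isProbabilityMeasure_map hmeas.aemeasurable
  simp_rw [hL.randomIntegral_sub hr hf ha0 hab]
  have h1 := (measureReal_norm_gt_le_sum_integral_charFun
    (P.map (randomIntegralIoc f r Y a b)) hρ0 hρε).trans
      (hN (a, b) ⟨ha1, ha2.trans hab⟩ hab).le
  rwa [map_measureReal_apply hmeas (measurableSet_lt measurable_const measurable_norm)] at h1

/-- Existence of the improper random integral, and its characteristic function. -/
theorem IsLevyProcessOf.exists_isImproperRandomIntegral (hY : IsLevyProcessOf ν P Y)
    (hψ : IsCharExponent ν ψ) (hr : IsClock r r') (hf : ContDiff ℝ 1 f)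
    (hint : ∀ y, IntegrableOn (fun s => r' s • ψ (f s • y)) (Set.Ioi 0)) :
    ∃ X : Ω → E, IsImproperRandomIntegral P f r Y X ∧
      ∀ y, charFun (P.map X) y = Complex.exp (∫ s in Set.Ioi 0, r' s • ψ (f s • y)) := by
  obtain ⟨hprob, hL, -⟩ := id hY
  obtain ⟨X, hX, hlim⟩ := exists_tendstoInMeasure_of_cauchy
    (fun b hb => hL.measurable_randomIntegral hr hf hb)
    (fun ε hε => hY.exists_measureReal_randomIntegral_sub_le hψ hr hf hint hε)
  refine ⟨X, ⟨hX, hlim⟩, fun y => ?_⟩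
  obtain ⟨u, hu, hae⟩ := hlim.exists_seq_tendsto_ae'
  obtain ⟨m, hm⟩ := eventually_atTop.1 (hu.eventually (eventually_ge_atTop 0))
  have hu' : Tendsto (fun k => u (k + m)) atTop atTop := hu.comp (tendsto_add_atTop_nat m)
  have hnn : ∀ k, 0 ≤ u (k + m) := fun k => hm _ (Nat.le_add_left _ _)
  have h1 := tendsto_charFun_map (P := P)
    (fun k => (hL.measurable_randomIntegral hr hf (hnn k)).aemeasurable) hX.aemeasurable
    (hae.mono fun ω hω => hω.comp (tendsto_add_atTop_nat m)) y
  refine tendsto_nhds_unique h1 ?_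
  refine ((Complex.continuous_exp.tendsto _).comp
    (intervalIntegral_tendsto_integral_Ioi 0 (hint y) hu')).congr fun k => ?_
  exact (hY.charFun_map_randomIntegralIoc hψ hr hf le_rfl (hnn k) y).symm

theorem IsImproperRandomIntegral.map_eq {X X' : Ω → E} (hX : IsImproperRandomIntegral P f r Y X)
    (hX' : IsImproperRandomIntegral P f r Y X') : P.map X = P.map X' :=
  Measure.map_congr (tendstoInMeasure_ae_unique hX.2 hX'.2)

/-- The existence clause in the definition supplies a process on which both laws are realised; the
universal clause alone could be vacuous. -/
theorem IsRandomIntegralLaw.eq {μ μ' : Measure E} (h : IsRandomIntegralLaw f r ν μ)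
    (h' : IsRandomIntegralLaw f r ν μ') : μ = μ' := by
  obtain ⟨Ω, _, P, Y, hY⟩ := h.1
  obtain ⟨X, hX, rfl⟩ := h.2 Ω _ P Y hY
  obtain ⟨X', hX', rfl⟩ := h'.2 Ω _ P Y hY
  exact hX.map_eq hX'

/-- The law is determined by its exponent, hence is the same for every driving process. `E : Type`
puts the sample space of arrays in `Type`, as the definition requires. -/
theorem exists_isRandomIntegralLaw {E : Type} [NormedAddCommGroup E] [InnerProductSpace ℝ E]
    [FiniteDimensional ℝ E] [MeasurableSpace E] [BorelSpace E] {ν : Measure E} {ψ : E → ℂ}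
    (hν : IsInfinitelyDivisible ν) (hψ : IsCharExponent ν ψ) (hr : IsClock r r')
    (hf : ContDiff ℝ 1 f)
    (hint : ∀ y, IntegrableOn (fun s => r' s • ψ (f s • y)) (Set.Ioi 0)) :
    ∃ μ : Measure E, IsProbabilityMeasure μ ∧ IsRandomIntegralLaw f r ν μ ∧
      ∀ y, charFun μ y = Complex.exp (∫ s in Set.Ioi 0, r' s • ψ (f s • y)) := by
  obtain ⟨P, Y, hY⟩ := hν.exists_isLevyProcessOf
  have hprob := hY.1
  obtain ⟨X, hX, hchar⟩ := hY.exists_isImproperRandomIntegral hψ hr hf hint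
  have hpm : IsProbabilityMeasure (P.map X) :=
    Measure.isProbabilityMeasure_map hX.1.aemeasurable
  refine ⟨P.map X, hpm, ⟨⟨_, _, P, Y, hY⟩, fun Ω' _ P' Y' hY' => ?_⟩, hchar⟩
  have hprob' := hY'.1
  obtain ⟨X', hX', hchar'⟩ := hY'.exists_isImproperRandomIntegral hψ hr hf hint
  have hpm' : IsProbabilityMeasure (P'.map X') :=
    Measure.isProbabilityMeasure_map hX'.1.aemeasurable
  exact ⟨X', hX', Measure.ext_of_charFun (funext fun y => by rw [hchar, hchar'])⟩

end ImproperIntegral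

/-! ### Tail integrals and the linear equation along a ray -/

section TailIntegrals

/-- Two logarithms of the same number closer than 1/2 coincide, so the set of agreement is both
closed and open; the limit makes it nonempty. -/
theorem eq_of_exp_eq_of_tendsto_sub {g h : ℝ → ℂ} (hg : Continuous g) (hh : Continuous h)
    (hexp : ∀ t, Complex.exp (g t) = Complex.exp (h t))
    (hlim : Tendsto (fun t => g t - h t) atTop (𝓝 0)) : g = h := by
  have hsmall : {t | g t = h t} = {t | ‖g t - h t‖ < 1 / 2} := by
    ext t
    refine ⟨fun ht => ?_, fun ht => ?_⟩
    · rw [Set.mem_ofPred_eq] at ht ⊢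
      rw [ht]
      simp
    · have h1 := norm_le_two_mul_norm_exp_sub_one (le_of_lt ht)
      rw [Complex.exp_sub, hexp t, div_self (Complex.exp_ne_zero _), sub_self, norm_zero,
        mul_zero] at h1
      exact sub_eq_zero.1 (norm_le_zero_iff.1 h1)
  have hclopen : IsClopen {t | g t = h t} := by
    refine ⟨isClosed_eq hg hh, ?_⟩
    rw [hsmall]
    exact isOpen_lt (hg.sub hh).norm continuous_const
  have hne : {t | g t = h t}.Nonempty := by
    rw [hsmall]
    have h1 := hlim.norm.eventually (gt_mem_nhds (show ‖(0 : ℂ)‖ < 1 / 2 by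
      rw [norm_zero]
      norm_num))
    exact h1.exists
  have huniv := hclopen.eq_univ hne
  exact funext fun t => (huniv.symm ▸ Set.mem_univ t : t ∈ {t | g t = h t})

variable {F : Type*} [NormedAddCommGroup F] {p q : ℝ → F}

theorem integrableOn_Ioi_of_continuous (hc : Continuous q) (hi : IntegrableOn q (Set.Ioi 0))
    (t : ℝ) : IntegrableOn q (Set.Ioi t) := by
  refine ((hc.continuousOn.integrableOn_Icc (a := t) (b := 0)).union hi).mono_set fun s hs => ?_
  rcases le_or_gt s 0 with h | h
  · exact Or.inl ⟨le_of_lt hs, h⟩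
  · exact Or.inr h

theorem preimage_add_right_Ioi (t : ℝ) : (fun s => s + t) ⁻¹' Set.Ioi t = Set.Ioi 0 := by
  ext s
  simp

theorem integrableOn_comp_add_right_Ioi {t : ℝ} (hi : IntegrableOn q (Set.Ioi t)) :
    IntegrableOn (fun s => q (s + t)) (Set.Ioi 0) := by
  have h := ((measurePreserving_add_right volume t).integrableOn_comp_preimage
    (measurableEmbedding_addRight t)).2 hi
  rwa [preimage_add_right_Ioi] at h

variable [NormedSpace ℝ F]

theorem integral_comp_add_right_Ioi (t : ℝ) :
    ∫ s in Set.Ioi 0, q (s + t) = ∫ s in Set.Ioi t, q s := by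
  have h := (measurePreserving_add_right volume t).setIntegral_preimage_emb
    (measurableEmbedding_addRight t) q (Set.Ioi t)
  rwa [preimage_add_right_Ioi] at h

theorem integral_Ioi_eq_sub_intervalIntegral (hc : Continuous q)
    (hi : IntegrableOn q (Set.Ioi 0)) (t : ℝ) :
    ∫ s in Set.Ioi t, q s = (∫ s in Set.Ioi 0, q s) - ∫ s in (0 : ℝ)..t, q s := by
  rw [← intervalIntegral.integral_interval_add_Ioi hi (integrableOn_Ioi_of_continuous hc hi t)]
  abel

theorem tendsto_integral_Ioi_zero (hc : Continuous q) (hi : IntegrableOn q (Set.Ioi 0)) :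
    Tendsto (fun t => ∫ s in Set.Ioi t, q s) atTop (𝓝 0) := by
  have h := (intervalIntegral_tendsto_integral_Ioi 0 hi tendsto_id).const_sub
    (∫ s in Set.Ioi 0, q s)
  rw [sub_self] at h
  exact h.congr fun t => (integral_Ioi_eq_sub_intervalIntegral hc hi t).symm

variable [CompleteSpace F]

theorem hasDerivAt_integral_Ioi (hc : Continuous q) (hi : IntegrableOn q (Set.Ioi 0)) (t : ℝ) :
    HasDerivAt (fun t => ∫ s in Set.Ioi t, q s) (-q t) t := by
  rw [funext (integral_Ioi_eq_sub_intervalIntegral hc hi)]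
  exact (hc.integral_hasStrictDerivAt 0 t).hasDerivAt.const_sub _

theorem hasDerivAt_exp_neg (t : ℝ) : HasDerivAt (fun t => Real.exp (-t)) (-Real.exp (-t)) t := by
  simpa using (hasDerivAt_neg t).exp

theorem tendsto_exp_neg_smul {g : ℝ → F} (hg : Tendsto g atTop (𝓝 0)) :
    Tendsto (fun t => Real.exp (-t) • g t) atTop (𝓝 0) := by
  simpa using Real.tendsto_exp_neg_atTop_nhds_zero.smul hg

theorem integrableOn_exp_neg_smul (hi : IntegrableOn q (Set.Ioi 0)) :
    IntegrableOn (fun s => Real.exp (-s) • q s) (Set.Ioi 0) :=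
  Integrable.bdd_smul hi 1 (by fun_prop)
    ((ae_restrict_iff' measurableSet_Ioi).2 (ae_of_all _ fun s hs => by
      rw [Real.norm_eq_abs, Real.abs_exp]
      exact Real.exp_le_one_iff.2 (neg_nonpos.2 (le_of_lt hs))))

theorem integral_one_sub_exp_neg_smul (hi : IntegrableOn q (Set.Ioi 0)) :
    ∫ s in Set.Ioi 0, (1 - Real.exp (-s)) • q s
      = (∫ s in Set.Ioi 0, q s) - ∫ s in Set.Ioi 0, Real.exp (-s) • q s := by
  rw [← integral_sub hi (integrableOn_exp_neg_smul hi)]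
  simp_rw [sub_smul, one_smul]

/-- The integral of the solution of a linear equation between tail integrals. -/
theorem integral_eq_of_tail_add_eq_tail (hp : Continuous p) (hq : Continuous q)
    (hpi : IntegrableOn p (Set.Ioi 0)) (hqi : IntegrableOn q (Set.Ioi 0))
    (h : ∀ t, (∫ s in Set.Ioi t, p s) + p t = ∫ s in Set.Ioi t, q s) :
    ∫ s in Set.Ioi 0, p s = ∫ s in Set.Ioi 0, (1 - Real.exp (-s)) • q s := by
  -- With the integrating factor e^{-t} the equation cancels everything except e^{-t} q(t).
  have hderiv : ∀ t, HasDerivAt (fun t => Real.exp (-t) •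
      ((∫ s in Set.Ioi t, p s) - ∫ s in Set.Ioi t, q s)) (Real.exp (-t) • q t) t := by
    intro t
    have h1 := (hasDerivAt_exp_neg t).smul
      ((hasDerivAt_integral_Ioi hp hpi t).sub (hasDerivAt_integral_Ioi hq hqi t))
    refine h1.congr_deriv ?_
    simp only [Pi.sub_apply]
    rw [← h t, neg_smul, ← smul_neg, ← smul_add]
    congr 1
    abel
  have h2 := integral_Ioi_of_hasDerivAt_of_tendsto' (a := 0) (fun t _ => hderiv t)
    (integrableOn_exp_neg_smul hqi) (tendsto_exp_neg_smul (by
      simpa using (tendsto_integral_Ioi_zero hp hpi).sub (tendsto_integral_Ioi_zero hq hqi)))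
  rw [integral_one_sub_exp_neg_smul hqi, h2]
  simp

theorem integrable_exp_neg_smul_comp_add (hq : Continuous q) (hqi : IntegrableOn q (Set.Ioi 0)) :
    Integrable (Function.uncurry fun s t : ℝ => Real.exp (-s) • q (t + s))
      ((volume.restrict (Set.Ioi 0)).prod (volume.restrict (Set.Ioi 0))) := by
  have hcont : Continuous (Function.uncurry fun s t : ℝ => Real.exp (-s) • q (t + s)) := by
    unfold Function.uncurry
    fun_prop
  rw [integrable_prod_iff hcont.stronglyMeasurable.aestronglyMeasurable]
  refine ⟨ae_of_all _ fun s => ?_, ?_⟩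
  · exact (integrableOn_comp_add_right_Ioi (integrableOn_Ioi_of_continuous hq hqi s)).smul
      (Real.exp (-s))
  · refine (((integrableOn_exp_neg_Ioi 0).mul_const (∫ t in Set.Ioi 0, ‖q t‖))).mono'
      hcont.stronglyMeasurable.norm.integral_prod_right.aestronglyMeasurable
      ((ae_restrict_iff' measurableSet_Ioi).2 (ae_of_all _ fun s hs => ?_))
    rw [Real.norm_of_nonneg (integral_nonneg fun _ => norm_nonneg _)]
    simp only [Function.uncurry_apply_pair, norm_smul, Real.norm_eq_abs, Real.abs_exp]
    rw [integral_const_mul, integral_comp_add_right_Ioi (q := fun t => ‖q t‖)]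
    exact mul_le_mul_of_nonneg_left (setIntegral_mono_set hqi.norm
      (ae_of_all _ fun _ => norm_nonneg _) (Set.Ioi_subset_Ioi (le_of_lt hs)).eventuallyLE)
      (Real.exp_pos _).le

theorem integrableOn_integral_exp_neg_smul_comp_add (hq : Continuous q)
    (hqi : IntegrableOn q (Set.Ioi 0)) :
    IntegrableOn (fun t => ∫ s in Set.Ioi 0, Real.exp (-s) • q (t + s)) (Set.Ioi 0) :=
  (integrable_exp_neg_smul_comp_add hq hqi).integral_prod_right

/-- After Fubini the inner integral is the tail of q from s on; integrating its product with e^{-s}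
by parts produces the weight 1 - e^{-s}. -/
theorem integral_integral_exp_neg_smul_comp_add (hq : Continuous q)
    (hqi : IntegrableOn q (Set.Ioi 0)) :
    ∫ t in Set.Ioi 0, ∫ s in Set.Ioi 0, Real.exp (-s) • q (t + s)
      = ∫ s in Set.Ioi 0, (1 - Real.exp (-s)) • q s := by
  have hswap := integral_integral_swap (integrable_exp_neg_smul_comp_add hq hqi)
  have hint : IntegrableOn (fun s => Real.exp (-s) • ∫ t in Set.Ioi s, q t) (Set.Ioi 0) := by
    have := (integrable_exp_neg_smul_comp_add hq hqi).integral_prod_left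
    refine this.congr (ae_of_all _ fun s => ?_)
    simp only [Function.uncurry_apply_pair]
    rw [integral_smul, integral_comp_add_right_Ioi]
  rw [← hswap]
  simp_rw [integral_smul, integral_comp_add_right_Ioi]
  have h1 := integral_Ioi_of_hasDerivAt_of_tendsto' (a := 0)
    (fun t _ => (hasDerivAt_exp_neg t).smul (hasDerivAt_integral_Ioi hq hqi t))
    (by
      simp_rw [smul_neg, neg_smul]
      exact ((integrableOn_exp_neg_smul hqi).neg.add hint.neg))
    (tendsto_exp_neg_smul (tendsto_integral_Ioi_zero hq hqi))
  rw [integral_one_sub_exp_neg_smul hqi]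
  simp_rw [smul_neg, neg_smul, ← neg_add] at h1
  rw [integral_neg, integral_add (integrableOn_exp_neg_smul hqi) hint, zero_sub, neg_inj] at h1
  simp only [Pi.smul_apply', neg_zero, Real.exp_zero, one_smul] at h1
  rw [← h1]
  abel

end TailIntegrals

/-! ### The clocks in use -/

theorem isClock_id : IsClock (fun s => s) (fun _ => 1) where
  hasDerivAt := hasDerivAt_id'
  continuous_deriv := continuous_const
  deriv_nonneg _ _ := zero_le_one
  nonneg_zero := le_rfl

theorem isClock_add_exp_neg_sub_one :
    IsClock (fun s => s + Real.exp (-s) - 1) (fun s => 1 - Real.exp (-s)) where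
  hasDerivAt s := ((hasDerivAt_id' s).add (hasDerivAt_exp_neg s)).sub_const 1
  continuous_deriv := by fun_prop
  deriv_nonneg s hs := sub_nonneg.2 (Real.exp_le_one_iff.2 (neg_nonpos.2 hs))
  nonneg_zero := by simp

/-- For n = 1 this clock produces the factor ν from ρ; for general n it produces the convolution
roots of ν. -/
theorem isClock_one_sub_exp_neg_div (n : ℕ) :
    IsClock (fun s => (1 - Real.exp (-s)) / n) (fun s => Real.exp (-s) / n) where
  hasDerivAt s := by simpa using ((hasDerivAt_exp_neg s).const_sub 1).div_const (n : ℝ)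
  continuous_deriv := by fun_prop
  deriv_nonneg s _ := by positivity
  nonneg_zero := by simp

theorem contDiff_exp_neg : ContDiff ℝ 1 fun s : ℝ => Real.exp (-s) := by fun_prop

/-! ### The factorization property in terms of exponents -/

section Factorization

variable {E : Type} [NormedAddCommGroup E] [InnerProductSpace ℝ E]
  [FiniteDimensional ℝ E] [MeasurableSpace E] [BorelSpace E] {ν : Measure E} {ψ : E → ℂ}
  {r r' : ℝ → ℝ}

theorem IsCharExponent.continuous_ray (hψ : IsCharExponent ν ψ) (y : E) :
    Continuous fun s : ℝ => ψ (Real.exp (-s) • y) := by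
  have := hψ.continuous
  fun_prop

theorem IsCharExponent.tendsto_ray (hψ : IsCharExponent ν ψ) (y : E) :
    Tendsto (fun s : ℝ => ψ (Real.exp (-s) • y)) atTop (𝓝 0) := by
  have h1 : Tendsto (fun s : ℝ => Real.exp (-s) • y) atTop (𝓝 0) := by
    simpa using Real.tendsto_exp_neg_atTop_nhds_zero.smul_const y
  have h2 := (hψ.continuous.tendsto 0).comp h1
  rwa [hψ.map_zero] at h2

theorem exp_neg_smul_exp_neg_smul (s t : ℝ) (y : E) :
    Real.exp (-s) • Real.exp (-t) • y = Real.exp (-(s + t)) • y := by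
  rw [smul_smul, ← Real.exp_add, neg_add]

/-- The laws of `∫_0^∞ e^{-s} dY_ν(r(s))` for clocks with derivative at most one. -/
theorem exists_isRandomIntegralLaw_exp_neg (hν : ν ∈ IDlog E) (hψ : IsCharExponent ν ψ)
    (hr : IsClock r r') (hr1 : ∀ s, 0 ≤ s → r' s ≤ 1) :
    ∃ μ : Measure E, IsProbabilityMeasure μ ∧
      IsRandomIntegralLaw (fun s => Real.exp (-s)) r ν μ ∧
      ∀ y, charFun μ y = Complex.exp (∫ s in Set.Ioi 0, r' s • ψ (Real.exp (-s) • y)) := by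
  have := hν.1.1
  refine exists_isRandomIntegralLaw hν.1 hψ hr contDiff_exp_neg fun y => ?_
  exact Integrable.bdd_smul (hψ.integrable_log_iff.1 hν.2 y) 1
    hr.continuous_deriv.aestronglyMeasurable
    ((ae_restrict_iff' measurableSet_Ioi).2 (ae_of_all _ fun s hs => by
      rw [Real.norm_of_nonneg (hr.deriv_nonneg s (le_of_lt hs))]
      exact hr1 s (le_of_lt hs)))

theorem IsRandomIntegralLaw.charFun_eq {μ : Measure E} (hν : ν ∈ IDlog E)
    (hψ : IsCharExponent ν ψ) (hr : IsClock r r') (hr1 : ∀ s, 0 ≤ s → r' s ≤ 1)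
    (h : IsRandomIntegralLaw (fun s => Real.exp (-s)) r ν μ) :
    IsProbabilityMeasure μ ∧
      ∀ y, charFun μ y = Complex.exp (∫ s in Set.Ioi 0, r' s • ψ (Real.exp (-s) • y)) := by
  obtain ⟨μ', hμ', hlaw, hchar⟩ := exists_isRandomIntegralLaw_exp_neg hν hψ hr hr1
  obtain rfl := h.eq hlaw
  exact ⟨hμ', hchar⟩

theorem isRandomIntegralLaw_of_charFun_eq {μ : Measure E} [IsProbabilityMeasure μ]
    (hν : ν ∈ IDlog E) (hψ : IsCharExponent ν ψ) (hr : IsClock r r')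
    (hr1 : ∀ s, 0 ≤ s → r' s ≤ 1)
    (h : ∀ y, charFun μ y = Complex.exp (∫ s in Set.Ioi 0, r' s • ψ (Real.exp (-s) • y))) :
    IsRandomIntegralLaw (fun s => Real.exp (-s)) r ν μ := by
  obtain ⟨μ', hμ', hlaw, hchar⟩ := exists_isRandomIntegralLaw_exp_neg hν hψ hr hr1
  obtain rfl : μ = μ' := Measure.ext_of_charFun (funext fun y => by rw [h, hchar])
  exact hlaw

theorem one_sub_exp_neg_le_one (s : ℝ) (_ : 0 ≤ s) : 1 - Real.exp (-s) ≤ 1 :=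
  sub_le_self _ (Real.exp_pos _).le

theorem exp_neg_div_le_one {n : ℕ} (hn : 1 ≤ n) (s : ℝ) (hs : 0 ≤ s) :
    Real.exp (-s) / n ≤ 1 := by
  have h1 : Real.exp (-s) ≤ 1 := Real.exp_le_one_iff.2 (neg_nonpos.2 hs)
  have h2 : (1 : ℝ) ≤ n := by exact_mod_cast hn
  rw [div_le_one (by linarith)]
  linarith

theorem existsUnique_isRandomIntegralLaw (hν : ν ∈ IDlog E) : ∃! μ : Measure E,
    IsRandomIntegralLaw (fun s => Real.exp (-s)) (fun s => s + Real.exp (-s) - 1) ν μ := by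
  obtain ⟨ψ, hψ⟩ := hν.1.exists_charExponent
  obtain ⟨μ, -, hlaw, -⟩ := exists_isRandomIntegralLaw_exp_neg hν hψ isClock_add_exp_neg_sub_one
    one_sub_exp_neg_le_one
  exact ⟨μ, hlaw, fun μ' h => h.eq hlaw⟩

/-- The driving law is the ρ for which I(ν) ∗ ν = I(ρ), not ν itself. -/
theorem exists_isRandomIntegralLaw_of_mem_classLf {μ : Measure E} (hμ : μ ∈ classLf E) :
    ∃ ρ ∈ IDlog E,
      IsRandomIntegralLaw (fun s => Real.exp (-s)) (fun s => s + Real.exp (-s) - 1) ρ μ := by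
  obtain ⟨ν, hν, hlaw, ρ, hρ, hconv⟩ := hμ
  have := hν.1.1
  have := hρ.1.1
  obtain ⟨ψ, hψ⟩ := hν.1.exists_charExponent
  obtain ⟨φ, hφ⟩ := hρ.1.exists_charExponent
  obtain ⟨hprob, h1⟩ := hlaw.charFun_eq hν hψ isClock_id fun _ _ => le_rfl
  obtain ⟨-, h2⟩ := hconv.charFun_eq hρ hφ isClock_id fun _ _ => le_rfl
  simp only [one_smul] at h1 h2
  refine ⟨ρ, hρ, isRandomIntegralLaw_of_charFun_eq hρ hφ isClock_add_exp_neg_sub_one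
    one_sub_exp_neg_le_one fun y => ?_⟩
  have hp := hψ.continuous_ray y
  have hq := hφ.continuous_ray y
  have hpi := hψ.integrable_log_iff.1 hν.2 y
  have hqi := hφ.integrable_log_iff.1 hρ.2 y
  have htail : ∀ (χ : E → ℂ) (t : ℝ), ∫ s in Set.Ioi 0, χ (Real.exp (-s) • Real.exp (-t) • y)
      = ∫ s in Set.Ioi t, χ (Real.exp (-s) • y) := fun χ t => by
    simp_rw [exp_neg_smul_exp_neg_smul]
    exact integral_comp_add_right_Ioi (q := fun s => χ (Real.exp (-s) • y)) t
  have hcont : ∀ {q : ℝ → ℂ}, Continuous q → IntegrableOn q (Set.Ioi 0) →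
      Continuous fun t => ∫ s in Set.Ioi t, q s := fun hq hqi =>
    continuous_iff_continuousAt.2 fun t => (hasDerivAt_integral_Ioi hq hqi t).continuousAt
  -- The convolution identity at e^{-t}y equates only exponentials; since both exponents vanish as t
  -- → ∞, the exponents themselves agree.
  have hkey := eq_of_exp_eq_of_tendsto_sub ((hcont hp hpi).add hp) (hcont hq hqi) (fun t => by
      have h3 := h2 (Real.exp (-t) • y)
      rw [charFun_conv, h1, hψ.charFun_eq, ← Complex.exp_add, htail, htail] at h3
      exact h3) (by
    simpa using ((tendsto_integral_Ioi_zero hp hpi).add (hψ.tendsto_ray y)).sub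
      (tendsto_integral_Ioi_zero hq hqi))
  rw [h1, integral_eq_of_tail_add_eq_tail hp hq hpi hqi (fun t => congrFun hkey t)]

/-- The exponent of `∫_0^∞ e^{-s} dY_ρ(1 - e^{-s})`. -/
theorem IsCharExponent.integral_exp_neg_smul {ρ : Measure E} {φ : E → ℂ}
    (hφ : IsCharExponent ρ φ)
    (hν : ∀ y, charFun ν y
      = Complex.exp (∫ s in Set.Ioi 0, Real.exp (-s) • φ (Real.exp (-s) • y))) :
    IsCharExponent ν fun y => ∫ s in Set.Ioi 0, Real.exp (-s) • φ (Real.exp (-s) • y) where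
  continuous := by
    have hc := hφ.continuous
    refine continuous_iff_continuousAt.2 fun y => ?_
    obtain ⟨C, hC⟩ := (isCompact_closedBall (0 : E) (‖y‖ + 1)).exists_bound_of_continuousOn
      hc.continuousOn
    refine continuousAt_of_dominated (bound := fun s => Real.exp (-s) * C)
      (Eventually.of_forall fun z => ?_) ?_ ((integrableOn_exp_neg_Ioi 0).mul_const C)
      (ae_of_all _ fun s => ?_)
    · exact Continuous.aestronglyMeasurable (by fun_prop)
    · have hev : ∀ᶠ z in 𝓝 y, ‖z‖ < ‖y‖ + 1 :=
        continuous_norm.continuousAt.eventually (gt_mem_nhds (lt_add_one _))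
      filter_upwards [hev] with z hz
      refine (ae_restrict_iff' measurableSet_Ioi).2 (ae_of_all _ fun s hs => ?_)
      rw [norm_smul, Real.norm_eq_abs, Real.abs_exp]
      refine mul_le_mul_of_nonneg_left (hC _ ?_) (Real.exp_pos _).le
      rw [mem_closedBall_zero_iff, norm_smul, Real.norm_eq_abs, Real.abs_exp]
      have h1 : Real.exp (-s) ≤ 1 := Real.exp_le_one_iff.2 (neg_nonpos.2 (le_of_lt hs))
      exact (mul_le_of_le_one_left (norm_nonneg _) h1).trans hz.le
    · exact Continuous.continuousAt (by fun_prop)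
  map_zero := by simp [hφ.map_zero]
  charFun_eq := hν

/-- Slowing the clock by the factor n divides the exponent by n, so the resulting law is a
convolution root of order n. -/
theorem isInfinitelyDivisible_of_charFun_eq {ρ : Measure E} {φ : E → ℂ} (hρ : ρ ∈ IDlog E)
    (hφ : IsCharExponent ρ φ) [hν' : IsProbabilityMeasure ν]
    (hν : ∀ y, charFun ν y
      = Complex.exp (∫ s in Set.Ioi 0, Real.exp (-s) • φ (Real.exp (-s) • y))) :
    IsInfinitelyDivisible ν := by
  refine ⟨hν', fun n hn => ?_⟩
  have hn0 : (n : ℂ) ≠ 0 := Nat.cast_ne_zero.2 (by omega)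
  obtain ⟨μ, hμ, -, hchar⟩ := exists_isRandomIntegralLaw_exp_neg hρ hφ
    (isClock_one_sub_exp_neg_div n) (exp_neg_div_le_one hn)
  obtain ⟨hpow, hpowchar⟩ := charFun_convPow μ n
  refine ⟨μ, hμ, Measure.ext_of_charFun (funext fun y => ?_)⟩
  rw [hpowchar, hchar, hν, ← Complex.exp_nat_mul]
  congr 1
  rw [← integral_const_mul]
  refine integral_congr_ae (ae_of_all _ fun s => ?_)
  simp only [Complex.real_smul, Complex.ofReal_div, Complex.ofReal_natCast]
  field_simp

/-- The factor is ν, the law of ∫ e^{-s} dY_ρ(1 - e^{-s}). Its logarithmic moment comes from the ray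
criterion, and the factorization from (1 - e^{-s}) + e^{-s} = 1. -/
theorem mem_classLf_of_isRandomIntegralLaw {ρ μ : Measure E} (hρ : ρ ∈ IDlog E)
    (hlaw : IsRandomIntegralLaw (fun s => Real.exp (-s)) (fun s => s + Real.exp (-s) - 1) ρ μ) :
    μ ∈ classLf E := by
  have := hρ.1.1
  obtain ⟨φ, hφ⟩ := hρ.1.exists_charExponent
  obtain ⟨hprob, hμ⟩ := hlaw.charFun_eq hρ hφ isClock_add_exp_neg_sub_one one_sub_exp_neg_le_one
  obtain ⟨ν, hνprob, -, hν⟩ := exists_isRandomIntegralLaw_exp_neg hρ hφ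
    (isClock_one_sub_exp_neg_div 1) (exp_neg_div_le_one le_rfl)
  simp only [Nat.cast_one, div_one] at hν
  have hψ := hφ.integral_exp_neg_smul hν
  have hray : ∀ (y : E) (t : ℝ),
      ∫ s in Set.Ioi 0, Real.exp (-s) • φ (Real.exp (-s) • Real.exp (-t) • y)
      = ∫ s in Set.Ioi 0, Real.exp (-s) • φ (Real.exp (-(t + s)) • y) := fun y t => by
    simp_rw [exp_neg_smul_exp_neg_smul, add_comm t]
  have hq := hφ.continuous_ray
  have hqi := hφ.integrable_log_iff.1 hρ.2
  have hνmem : ν ∈ IDlog E := by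
    refine ⟨isInfinitelyDivisible_of_charFun_eq hρ hφ hν, hψ.integrable_log_iff.2 fun y => ?_⟩
    simp_rw [hray]
    exact integrableOn_integral_exp_neg_smul_comp_add (hq y) (hqi y)
  have hint : ∀ y : E, ∫ t in Set.Ioi 0, ∫ s in Set.Ioi 0,
      Real.exp (-s) • φ (Real.exp (-s) • Real.exp (-t) • y)
      = ∫ s in Set.Ioi 0, (1 - Real.exp (-s)) • φ (Real.exp (-s) • y) := fun y => by
    simp_rw [hray]
    exact integral_integral_exp_neg_smul_comp_add (hq y) (hqi y)
  refine ⟨ν, hνmem, ?_, ρ, hρ, ?_⟩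
  · refine isRandomIntegralLaw_of_charFun_eq hνmem hψ isClock_id (fun _ _ => le_rfl) fun y => ?_
    simp only [one_smul]
    rw [hμ, hint]
  · refine isRandomIntegralLaw_of_charFun_eq hρ hφ isClock_id (fun _ _ => le_rfl) fun y => ?_
    simp only [one_smul]
    rw [charFun_conv, hμ, hν, ← Complex.exp_add, integral_one_sub_exp_neg_smul (hqi y),
      sub_add_cancel]

end Factorization

theorem corollary3 (d : ℕ) :
    (∀ ν ∈ IDlog (EuclideanSpace ℝ (Fin d)), ∃! μ : Measure (EuclideanSpace ℝ (Fin d)),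
      IsRandomIntegralLaw (fun s => Real.exp (-s)) (fun s => s + Real.exp (-s) - 1) ν μ) ∧
    classLf (EuclideanSpace ℝ (Fin d)) =
      {μ | ∃ ν ∈ IDlog (EuclideanSpace ℝ (Fin d)),
        IsRandomIntegralLaw (fun s => Real.exp (-s)) (fun s => s + Real.exp (-s) - 1) ν μ} :=
  ⟨fun _ hν => existsUnique_isRandomIntegralLaw hν,
    Set.Subset.antisymm (fun _ hμ => exists_isRandomIntegralLaw_of_mem_classLf hμ)
      fun _ ⟨_, hρ, hlaw⟩ => mem_classLf_of_isRandomIntegralLaw hρ hlaw⟩
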